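/- **Theorem (Uniform consistency of the monotone log-concave MLE).** Let $f$ be a non-increasing, log-concave probability density on $[0,\infty)$ and let $X_1, X_2, \dots$ be i.i.d. with density $f$. Let $\mathcal{MC}$ be the class of functions $\psi:[0,\infty)\to[-\infty,\infty)$ that are non-increasing, concave, proper (not identically $-\infty$) and closed (upper semicontinuous), and let $\hat f_n = \exp\hat\psi_n$, where $\hat\psi_n$ is the minimizer over $\psi \in \mathcal{MC}$ of $$\Lambda_n(\psi) = -\sum_{i=1}^n \psi(X_i) + n\int_0^\infty e^{\psi(x)}\,dx .$$ For an interval $J\subset\mathbb{R}$, $\beta\in[1,2]$ and $L>0$, let $\mathcal H^{\beta,L}(J)$ be the class of functions $g$ on $J$ such that $|g(y)-g(x)|\le L|y-x|$ for all $x,y\in J$ if $\beta=1$, and such that $g$ is differentiable on $J$ (one-sidedly at end points belonging to $J$) with $|g'(y)-g'(x)|\le L|y-x|^{\beta-1}$ for all $x,y\in J$ if $\beta\in(1,2]$. Let $I=[a,b]\subset[0,\infty)$ be a compact interval with $f>0$ on $I$, and assume that for some $\beta\in[1,2]$, $L>0$ and $\delta>0$ the function $f$ belongs to $\mathcal H^{\beta,L}\big([a-\delta,b+\delta]\cap[0,\infty)\big)$;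 if $a=0$ and $\beta>1$, assume also that $f'(0)=0$ (one-sided derivative), that is, that $x \mapsto f(|x|)$ is differentiable at $0$. Then $$\sup_{t\in I}\big|\hat f_n(t)-f(t)\big| = O_{\mathbb P}\Big(\big(\log n/n\big)^{\beta/(2\beta+1)}\Big),$$ that is, for every $\varepsilon>0$ there is $M>0$ such that, for all sufficiently large $n$, the probability that $\sup_{t\in I}|\hat f_n(t)-f(t)|> M(\log n/n)^{\beta/(2\beta+1)}$ is at most $\varepsilon$. -/

import Mathlib

open Set Filter MeasureTheory ProbabilityTheory
open scoped ENNReal Topology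

/-- `f` (only its values on `[0, ∞)` matter) is a non-increasing log-concave probability density
on `[0, ∞)`. -/
structure IsMonotoneLogConcaveDensity (f : ℝ → ℝ) : Prop where
  nonneg : ∀ x, 0 ≤ x → 0 ≤ f x
  antitone : AntitoneOn f (Ici 0)
  logConcave : ∀ x y a b : ℝ, 0 ≤ x → 0 ≤ y → 0 < a → 0 < b → a + b = 1 →
    f x ^ a * f y ^ b ≤ f (a * x + b * y)
  lintegral_eq_one : ∫⁻ x in Ici (0 : ℝ), ENNReal.ofReal (f x) = 1

/-- The law on `ℝ`, carried by `[0, ∞)`, that has density `f` there. -/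
noncomputable def densityLaw (f : ℝ → ℝ) : Measure ℝ :=
  (volume.restrict (Ici (0 : ℝ))).withDensity fun x => ENNReal.ofReal (f x)

/-- The class of functions `ψ : [0, ∞) → [-∞, ∞)` that are non-increasing, concave, proper and
closed. A concave function is closed when it is upper semicontinuous. -/
structure IsMC (ψ : ℝ → EReal) : Prop where
  antitone : AntitoneOn ψ (Ici 0)
  concave : ∀ x y a b : ℝ, 0 ≤ x → 0 ≤ y → 0 < a → 0 < b → a + b = 1 →
    (a : EReal) * ψ x + (b : EReal) * ψ y ≤ ψ (a * x + b * y)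
  lt_top : ∀ x, 0 ≤ x → ψ x < ⊤
  exists_ne_bot : ∃ x, 0 ≤ x ∧ ψ x ≠ ⊥
  closed : UpperSemicontinuousOn ψ (Ici 0)

/-- The functional `Λ_n(ψ) = -∑ ψ(x_i) + n ∫₀^∞ exp ψ(x) dx` for the sample `x_1, …, x_n`. -/
noncomputable def negLogLik {n : ℕ} (x : Fin n → ℝ) (ψ : ℝ → EReal) : EReal :=
  -(∑ i, ψ (x i)) + (n : EReal) * ((∫⁻ t in Ici (0 : ℝ), EReal.exp (ψ t) : ℝ≥0∞) : EReal)

/-- `ψ` minimizes `Λ_n` over the class of non-increasing, concave, proper, closed functions. -/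
def IsLogMLE {n : ℕ} (x : Fin n → ℝ) (ψ : ℝ → EReal) : Prop :=
  IsMC ψ ∧ ∀ φ : ℝ → EReal, IsMC φ → negLogLik x ψ ≤ negLogLik x φ

open Classical in
/-- The minimizer of `Λ_n`; the value `-∞` everywhere is used if there is none. -/
noncomputable def logMLE {n : ℕ} (x : Fin n → ℝ) : ℝ → EReal :=
  if h : ∃ ψ, IsLogMLE x ψ then h.choose else fun _ => ⊥

/-- The maximum likelihood estimator `exp (logMLE x)` of a non-increasing log-concave density. -/
noncomputable def densityMLE {n : ℕ} (x : Fin n → ℝ) (t : ℝ) : ℝ :=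
  (EReal.exp (logMLE x t)).toReal

/-- The Hölder class with exponent `β ∈ [1, 2]` and constant `L` on the interval `I`; derivatives
at end points that belong to `I` are one-sided. -/
def HolderClass (β L : ℝ) (I : Set ℝ) (g : ℝ → ℝ) : Prop :=
  (β = 1 → ∀ x ∈ I, ∀ y ∈ I, |g y - g x| ≤ L * |y - x|) ∧
  (1 < β → DifferentiableOn ℝ g I ∧
    ∀ x ∈ I, ∀ y ∈ I, |derivWithin g I y - derivWithin g I x| ≤ L * |y - x| ^ (β - 1))

/-- `Y n = O_P(r n)` for a sequence of nonnegative (possibly infinite) random quantities. -/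
def IsBigOInProb {Ω : Type*} [MeasurableSpace Ω] (P : Measure Ω) (Y : ℕ → Ω → ℝ≥0∞)
    (r : ℕ → ℝ) : Prop :=
  ∀ ε : ℝ, 0 < ε → ∃ M : ℝ, 0 < M ∧ ∀ᶠ n in atTop,
    P {ω | ENNReal.ofReal (M * r n) < Y n ω} ≤ ENNReal.ofReal ε

/-!
Let `g = log f̂ₙ` on `[0, max X i]`, where it is a real function, and let `ρ = log n / n`. Since `g`
minimizes the convex functional `Λₙ`, an admissible perturbation in a direction `h` satisfies
`∫ h dFₙ ≤ ∫ h exp g`, with `Fₙ` the empirical distribution (`IsFit.empMean_sub_le`). Hence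
`∫ h (f - exp g) ≤ |∫ h d(Fₙ - F)|`: the gain of a perturbation that moves `g` towards `log f` is
bounded by a fluctuation of the empirical process. By Bernstein's inequality for intervals and the
layer cake formula, the fluctuation of a unimodal `h` with values in `[0, H]` on an interval of mass
`M` is of order `H * (√(ρ * M) + ρ)` (`IsTypical.abs_empMean_sub_le`).

This shows that an error `|g - log f| ≥ ε` of constant sign can only persist on an interval of
length `δ` if `ε ^ 2 * δ` is at most of order `ρ` (`IsTypical.sq_mul_le`): one looks for a unimodal
`h` whose gain is of order `ε * δ * H` while its fluctuation is of order `H * √(ρ * δ)`. Which `h` is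
admissible depends on the fit.
* If `g` exceeds `log f` and is not affine there, `g` is cut off by its chord. If it is affine, the
  excess persists in one direction up to the end of the maximal affine piece, since `log f` is
  concave, and `g` is tilted down on that side.
* If `log f` exceeds `g` and `g` is affine neither on the first nor on the last third of the
  interval, then `g` can be raised in between. If it is affine on one of these, `log f - g` is
  concave on the maximal affine piece, and `h` is a concave piecewise linear function with the same
  sign there. Such an `h` takes negative values far away, possibly large ones, but gain and
  fluctuation are both controlled by the second moment `∫ h ^ 2 f`
  (`sq_mul_le_of_affOn_below`).

By Hölder continuity, `log f` is affine up to `K * η ^ β` at scale `η`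
(`exists_affine_approx`). As `g` is concave, an error `ε ≥ 8 * K * η ^ β` at a point then spreads to
an interval of length `η` next to it (`IsTypical.abs_sub_lt`); at the boundary point `0` this uses
monotonicity of `g` and `f' 0 = 0`. So `ε ^ 2 * η ≲ ρ` with `ε ≍ η ^ β`, which is the rate
`ρ ^ (β / (2 * β + 1))`.

The samples that are good enough for this argument have probability tending to one
(`tendsto_measureReal_not_gridDev_or`): a union bound over intervals with end points in a grid
extends to all intervals, and log-concave densities have light tails.
-/

/-! ### The maximum likelihood estimator as a minimizer over real functions on `[0, R]` -/

/-- The real-valued functions on `[0, R]` over which the likelihood is maximized: concave,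
non-increasing and continuous on `[0, R]`. Values outside `[0, R]` are irrelevant. -/
structure IsAdm (R : ℝ) (g : ℝ → ℝ) : Prop where
  concave : ConcaveOn ℝ (Icc 0 R) g
  antitone : AntitoneOn g (Icc 0 R)
  cont : ContinuousOn g (Icc 0 R)

/-- The real counterpart on `[0, R]` of `negLogLik`. -/
noncomputable def nll {n : ℕ} (x : Fin n → ℝ) (R : ℝ) (g : ℝ → ℝ) : ℝ :=
  -(∑ i, g (x i)) + n * ∫ t in Icc 0 R, Real.exp (g t)

/-- `g` minimizes `nll` over the admissible functions on `[0, R]`, an interval that contains the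
sample. -/
structure IsFit {n : ℕ} (x : Fin n → ℝ) (R : ℝ) (g : ℝ → ℝ) : Prop where
  mem : ∀ i, x i ∈ Icc 0 R
  adm : IsAdm R g
  opt : ∀ φ, IsAdm R φ → nll x R g ≤ nll x R φ

/-- Concavity without division: the chord lies below the graph. -/
lemma ConcaveOn.chord_le {S : Set ℝ} {g : ℝ → ℝ} (hg : ConcaveOn ℝ S g) {x y z : ℝ}
    (hx : x ∈ S) (hz : z ∈ S) (hxy : x ≤ y) (hyz : y ≤ z) :
    (z - y) * g x + (y - x) * g z ≤ (z - x) * g y := by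
  rcases eq_or_lt_of_le (hxy.trans hyz) with h | h
  · have h1 : y = x := by linarith
    subst h1; subst h; simp
  · have hzx : 0 < z - x := by linarith
    have := hg.2 hx hz (div_nonneg (sub_nonneg.2 hyz) hzx.le)
      (div_nonneg (sub_nonneg.2 hxy) hzx.le) (by field_simp; ring)
    have e : (z - y) / (z - x) * x + (y - x) / (z - x) * z = y := by field_simp; ring
    simp only [smul_eq_mul] at this
    rw [e] at this
    calc (z - y) * g x + (y - x) * g z
        = (z - x) * ((z - y) / (z - x) * g x + (y - x) / (z - x) * g z) := by field_simp
      _ ≤ _ := by gcongr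

/-- On `[0, R]` a concave non-increasing function is lower semicontinuous, so that upper
semicontinuity is all that continuity asks for. -/
lemma continuousOn_of_concaveOn_antitoneOn {R : ℝ} {g : ℝ → ℝ} (hc : ConcaveOn ℝ (Icc 0 R) g)
    (ha : AntitoneOn g (Icc 0 R)) (hu : UpperSemicontinuousOn g (Icc 0 R)) :
    ContinuousOn g (Icc 0 R) := by
  refine continuousOn_iff_lower_upperSemicontinuousOn.2 ⟨?_, hu⟩
  intro t ht y hy
  rcases eq_or_lt_of_le ht.2 with h | h
  · filter_upwards [self_mem_nhdsWithin] with x hx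
    exact hy.trans_le (ha hx ht (h ▸ hx.2))
  · have hc' : Tendsto (fun x => ((R - x) * g t + (x - t) * g R) / (R - t)) (𝓝 t)
        (𝓝 (((R - t) * g t + (t - t) * g R) / (R - t))) :=
      (Continuous.tendsto (by fun_prop) t)
    have e : ((R - t) * g t + (t - t) * g R) / (R - t) = g t := by
      have : R - t ≠ 0 := by linarith
      field_simp; ring
    rw [e] at hc'
    filter_upwards [self_mem_nhdsWithin, (hc'.eventually (lt_mem_nhds hy)).filter_mono
      nhdsWithin_le_nhds] with x hx hx2
    rcases le_total x t with hxt | hxt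
    · exact hy.trans_le (ha hx ht hxt)
    · refine hx2.trans_le ?_
      rw [div_le_iff₀ (by linarith)]
      have := hc.chord_le ht (right_mem_Icc.2 (ht.1.trans ht.2)) hxt hx.2
      linarith

/-- A concave function has a supporting line at each interior point. -/
lemma ConcaveOn.exists_support {R : ℝ} {g : ℝ → ℝ} (hc : ConcaveOn ℝ (Icc 0 R) g) {t : ℝ}
    (ht : t ∈ Ioo 0 R) : ∃ s, ∀ z ∈ Icc 0 R, g z ≤ g t + s * (z - t) := by
  have hint : t ∈ interior (Icc 0 R) := by rwa [interior_Icc]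
  have htI := Ioo_subset_Icc_self ht
  have h1 := bddBelow_slope_lt_of_mem_interior hc.neg hint
  have h0 : ∀ w, slope (-g) t w = -slope g t w := by
    intro w; simp [slope_def_field]; ring
  refine ⟨sSup ((slope g t) '' {y | y ∈ Icc 0 R ∧ t < y}), fun z hz => ?_⟩
  have hne : ((slope g t) '' {y | y ∈ Icc 0 R ∧ t < y}).Nonempty :=
    ⟨_, R, ⟨right_mem_Icc.2 (ht.1.le.trans ht.2.le), ht.2⟩, rfl⟩
  have key : ∀ u ∈ Icc 0 R, u < t → ∀ v ∈ Icc 0 R, t < v → slope g t v ≤ slope g t u := by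
    intro u hu hut v hv htv
    have := hc.chord_le hu hv hut.le htv.le
    rw [slope_def_field, slope_def_field, ← neg_div_neg_eq (g u - g t),
      div_le_div_iff₀ (by linarith) (by linarith)]
    nlinarith
  have hbdd : BddAbove ((slope g t) '' {y | y ∈ Icc 0 R ∧ t < y}) := by
    refine ⟨slope g t 0, ?_⟩
    rintro _ ⟨v, ⟨hv, htv⟩, rfl⟩
    exact key 0 (left_mem_Icc.2 (ht.1.le.trans ht.2.le)) ht.1 v hv htv
  rcases lt_trichotomy z t with h | h | h
  · have : sSup ((slope g t) '' {y | y ∈ Icc 0 R ∧ t < y}) ≤ slope g t z := by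
      refine csSup_le hne ?_
      rintro _ ⟨v, ⟨hv, htv⟩, rfl⟩
      exact key z hz h v hv htv
    have h2 : slope g t z * (z - t) = g z - g t := by
      rw [slope_def_field]; field_simp [sub_ne_zero.2 h.ne]
    nlinarith
  · subst h; simp
  · have : slope g t z ≤ sSup ((slope g t) '' {y | y ∈ Icc 0 R ∧ t < y}) :=
      le_csSup hbdd ⟨z, ⟨hz, h⟩, rfl⟩
    have h2 : slope g t z * (z - t) = g z - g t := by
      rw [slope_def_field]; field_simp [sub_ne_zero.2 h.ne']
    nlinarith

namespace IsAdm
variable {R : ℝ} {g k : ℝ → ℝ}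

lemma inf (hg : IsAdm R g) (hk : IsAdm R k) : IsAdm R (fun x => min (g x) (k x)) where
  concave := hg.concave.inf hk.concave
  antitone := hg.antitone.inf hk.antitone
  cont := hg.cont.inf hk.cont

lemma affine (R : ℝ) (u v s : ℝ) (hs : s ≤ 0) : IsAdm R (fun x => u + s * (x - v)) where
  concave := ⟨convex_Icc _ _, fun x _ y _ a b _ _ hab => by
    simp only [smul_eq_mul]
    have : a = 1 - b := by linarith
    subst this; apply le_of_eq; ring⟩
  antitone := fun x _ y _ hxy => by
    have := mul_le_mul_of_nonpos_left (sub_le_sub_right hxy v) hs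
    simpa using this
  cont := by fun_prop

lemma combo (hg : IsAdm R g) (hk : IsAdm R k) {t : ℝ} (h0 : 0 ≤ t) (h1 : t ≤ 1) :
    IsAdm R (fun x => g x + t * (k x - g x)) := by
  have e : (fun x => g x + t * (k x - g x)) = fun x => (1 - t) * g x + t * k x := by
    ext x; ring
  rw [e]
  exact ⟨(hg.concave.smul (sub_nonneg.2 h1)).add (hk.concave.smul h0),
    fun x hx y hy hxy => add_le_add
      (mul_le_mul_of_nonneg_left (hg.antitone hx hy hxy) (sub_nonneg.2 h1))
      (mul_le_mul_of_nonneg_left (hk.antitone hx hy hxy) h0),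
    (hg.cont.const_mul _).add (hk.cont.const_mul _)⟩

lemma add_const (hg : IsAdm R g) (c : ℝ) : IsAdm R (fun x => g x + c) where
  concave := hg.concave.add_const c
  antitone := hg.antitone.add_const c
  cont := hg.cont.add continuousOn_const

lemma integrableOn_exp (hg : IsAdm R g) : IntegrableOn (fun t => Real.exp (g t)) (Icc 0 R) :=
  (Real.continuous_exp.comp_continuousOn hg.cont).integrableOn_Icc

end IsAdm

/-- The extension of a function on `[0, R]` by `-∞`. -/
noncomputable def botExtend (R : ℝ) (g : ℝ → ℝ) (t : ℝ) : EReal := if t ≤ R then (g t : EReal) else ⊥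

lemma IsAdm.isMC_botExtend {R : ℝ} (hR : 0 ≤ R) {g : ℝ → ℝ} (hg : IsAdm R g) :
    IsMC (botExtend R g) where
  antitone := by
    intro x hx y hy hxy
    unfold botExtend
    split_ifs with h1 h2
    · exact EReal.coe_le_coe_iff.2 (hg.antitone ⟨hx, h2⟩ ⟨hy, h1⟩ hxy)
    · exact absurd (hxy.trans h1) h2
    · exact bot_le
    · exact le_rfl
  concave := by
    intro x y a b hx hy ha hb hab
    unfold botExtend
    by_cases h1 : x ≤ R
    · by_cases h2 : y ≤ R
      · have h3 : a * x + b * y ≤ R := by nlinarith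
        rw [if_pos h1, if_pos h2, if_pos h3]
        have := hg.concave.2 (⟨hx, h1⟩ : x ∈ Icc 0 R) (⟨hy, h2⟩ : y ∈ Icc 0 R) ha.le hb.le hab
        simp only [smul_eq_mul] at this
        exact_mod_cast this
      · rw [if_neg h2, EReal.coe_mul_bot_of_pos hb, EReal.add_bot]; exact bot_le
    · rw [if_neg h1, EReal.coe_mul_bot_of_pos ha, EReal.bot_add]; exact bot_le
  lt_top := by
    intro x _; unfold botExtend; split_ifs
    · exact EReal.coe_lt_top _
    · exact bot_lt_top
  exists_ne_bot := ⟨0, le_rfl, by unfold botExtend; rw [if_pos hR]; exact EReal.coe_ne_bot _⟩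
  closed := by
    intro x hx y hy
    unfold botExtend at hy ⊢
    by_cases h : x ≤ R
    · rw [if_pos h] at hy
      have hxm : x ∈ Icc 0 R := ⟨hx, h⟩
      have hc : Tendsto (fun z => (g z : EReal)) (𝓝[Icc 0 R] x) (𝓝 (g x : EReal)) :=
        (continuous_coe_real_ereal.tendsto _).comp (hg.cont x hxm)
      have := eventually_nhdsWithin_iff.1 (hc.eventually (gt_mem_nhds hy))
      filter_upwards [nhdsWithin_le_nhds this, self_mem_nhdsWithin] with z hz hz0
      split_ifs with h3
      · exact hz ⟨hz0, h3⟩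
      · exact bot_le.trans_lt hy
    · rw [if_neg h] at hy
      filter_upwards [nhdsWithin_le_nhds (lt_mem_nhds (not_le.1 h))] with z hz
      rw [if_neg (not_le.2 hz)]; exact hy

lemma EReal.coe_finset_sum {ι : Type*} (s : Finset ι) (h : ι → ℝ) :
    ((∑ i ∈ s, h i : ℝ) : EReal) = ∑ i ∈ s, (h i : EReal) := by
  classical
  induction s using Finset.induction_on with
  | empty => simp
  | insert a s ha ih => rw [Finset.sum_insert ha, Finset.sum_insert ha, EReal.coe_add, ih]

lemma negLogLik_botExtend {n : ℕ} {x : Fin n → ℝ} {R : ℝ} {g : ℝ → ℝ} (hg : IsAdm R g)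
    (hx : ∀ i, x i ≤ R) : negLogLik x (botExtend R g) = (nll x R g : EReal) := by
  have h1 : ∑ i, botExtend R g (x i) = ((∑ i, g (x i) : ℝ) : EReal) := by
    rw [EReal.coe_finset_sum]
    exact Finset.sum_congr rfl fun i _ => by unfold botExtend; rw [if_pos (hx i)]
  have h2 : ∫⁻ t in Ici (0 : ℝ), EReal.exp (botExtend R g t)
      = ENNReal.ofReal (∫ t in Icc 0 R, Real.exp (g t)) := by
    rw [ofReal_integral_eq_lintegral_ofReal hg.integrableOn_exp
      (Eventually.of_forall fun t => (Real.exp_pos _).le)]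
    have : Ici (0 : ℝ) ∩ Iic R = Icc 0 R := rfl
    rw [← lintegral_indicator measurableSet_Ici, ← lintegral_indicator measurableSet_Icc]
    congr 1; ext t
    by_cases h0 : 0 ≤ t
    · by_cases h : t ≤ R
      · simp [indicator, botExtend, h0, h]
      · simp [indicator, botExtend, h0, h]
    · simp [indicator, h0]
  unfold negLogLik nll
  rw [h1, h2, EReal.coe_ennreal_ofReal,
    max_eq_left (integral_nonneg fun t => (Real.exp_pos _).le)]
  push_cast
  rfl

/-- A function in the class that is finite at `R` is finite on `[0, R]`, by monotonicity. -/
lemma IsMC.coe_toReal {ψ : ℝ → EReal} (hψ : IsMC ψ) {R : ℝ} (hR : ψ R ≠ ⊥) {t : ℝ}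
    (ht : t ∈ Icc 0 R) : ((ψ t).toReal : EReal) = ψ t := by
  refine EReal.coe_toReal (hψ.lt_top t ht.1).ne fun h => hR ?_
  have := hψ.antitone (mem_Ici.2 ht.1) (mem_Ici.2 (ht.1.trans ht.2)) ht.2
  rw [h] at this; exact le_bot_iff.1 this

lemma IsMC.isAdm_toReal {ψ : ℝ → EReal} (hψ : IsMC ψ) {R : ℝ} (hR : ψ R ≠ ⊥) :
    IsAdm R (fun t => (ψ t).toReal) := by
  have hco : ∀ t ∈ Icc 0 R, ((ψ t).toReal : EReal) = ψ t := fun t ht => hψ.coe_toReal hR ht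
  have hc : ConcaveOn ℝ (Icc 0 R) (fun t => (ψ t).toReal) := by
    refine concaveOn_iff_forall_pos.2 ⟨convex_Icc _ _, fun x hx y hy a b ha hb hab => ?_⟩
    have := hψ.concave x y a b hx.1 hy.1 ha hb hab
    have hm : a * x + b * y ∈ Icc 0 R := by
      have := (convex_Icc 0 R) hx hy ha.le hb.le hab
      simpa using this
    rw [← hco x hx, ← hco y hy, ← hco _ hm] at this
    simp only [smul_eq_mul]
    exact_mod_cast this
  have ha : AntitoneOn (fun t => (ψ t).toReal) (Icc 0 R) := by
    intro x hx y hy hxy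
    have := hψ.antitone (mem_Ici.2 hx.1) (mem_Ici.2 hy.1) hxy
    rw [← hco x hx, ← hco y hy] at this
    exact_mod_cast this
  refine ⟨hc, ha, continuousOn_of_concaveOn_antitoneOn hc ha ?_⟩
  intro x hx y hy
  have h1 : ψ x < (y : EReal) := by rw [← hco x hx]; exact_mod_cast hy
  have h2 := hψ.closed x hx.1 (y : EReal) h1
  filter_upwards [nhdsWithin_mono x Icc_subset_Ici_self h2, self_mem_nhdsWithin] with z hz hzm
  rw [← hco z hzm] at hz
  exact_mod_cast hz

/-- Cutting a function off beyond the sample decreases its integral term only. -/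
lemma nll_toReal_le_negLogLik {n : ℕ} (hn : n ≠ 0) {x : Fin n → ℝ} {R : ℝ} {ψ : ℝ → EReal}
    (hψ : IsMC ψ) (hR : ψ R ≠ ⊥) (hx : ∀ i, x i ∈ Icc 0 R) :
    (nll x R (fun t => (ψ t).toReal) : EReal) ≤ negLogLik x ψ := by
  have hadm := hψ.isAdm_toReal hR
  rw [← negLogLik_botExtend hadm (fun i => (hx i).2)]
  unfold negLogLik
  have h1 : ∀ i, botExtend R (fun t => (ψ t).toReal) (x i) = ψ (x i) := fun i => by
    unfold botExtend; rw [if_pos (hx i).2]; exact hψ.coe_toReal hR (hx i)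
  simp only [h1]
  have h2 : ∫⁻ t in Ici (0 : ℝ), EReal.exp (botExtend R (fun t => (ψ t).toReal) t)
      ≤ ∫⁻ t in Ici (0 : ℝ), EReal.exp (ψ t) := by
    refine setLIntegral_mono' measurableSet_Ici fun t ht => ?_
    refine EReal.exp_monotone ?_
    unfold botExtend
    split_ifs with h
    · rw [hψ.coe_toReal hR ⟨ht, h⟩]
    · exact bot_le
  gcongr
  exact_mod_cast h2

lemma negLogLik_eq_top {n : ℕ} {x : Fin n → ℝ} {ψ : ℝ → EReal} {j : Fin n} (h : ψ (x j) = ⊥) :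
    negLogLik x ψ = ⊤ := by
  classical
  unfold negLogLik
  rw [← Finset.add_sum_erase _ _ (Finset.mem_univ j), h, EReal.bot_add, EReal.neg_bot,
    EReal.top_add_of_ne_bot]
  exact ne_of_gt (EReal.bot_lt_zero.trans_le
    (EReal.mul_nonneg (by exact_mod_cast Nat.zero_le n) (EReal.coe_ennreal_nonneg _)))

/-- The least concave non-increasing majorant of the points `(x i, y i)`, as the infimum of the
non-increasing affine functions (of slope `-s`) above these points. -/
noncomputable def hull {n : ℕ} (x y : Fin n → ℝ) (t : ℝ) : ℝ :=
  ⨅ s : NNReal, ((⨆ i, (y i + s * x i)) - s * t)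

section Hull
variable {n : ℕ} {x : Fin n → ℝ} {R : ℝ} {j : Fin n}

lemma le_hull_aux (hj : x j = R) (y : Fin n → ℝ) {t : ℝ} (ht : t ≤ R) (s : NNReal) :
    y j ≤ (⨆ i, (y i + s * x i)) - s * t := by
  have h1 : y j + s * x j ≤ ⨆ i, (y i + s * x i) :=
    le_ciSup (f := fun i => y i + s * x i) (Set.finite_range _).bddAbove j
  have : (s : ℝ) * t ≤ s * x j := by rw [hj]; gcongr
  linarith

lemma hull_bddBelow (hj : x j = R) (y : Fin n → ℝ) {t : ℝ} (ht : t ≤ R) :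
    BddBelow (range fun s : NNReal => (⨆ i, (y i + s * x i)) - s * t) :=
  ⟨y j, by rintro _ ⟨s, rfl⟩; exact le_hull_aux hj y ht s⟩

lemma le_hull (y : Fin n → ℝ) (i : Fin n) {t : ℝ}
    (ht : t ≤ x i) : y i ≤ hull x y t := by
  refine le_ciInf fun s => ?_
  have h1 : y i + s * x i ≤ ⨆ i, (y i + s * x i) :=
    le_ciSup (f := fun i => y i + s * x i) (Set.finite_range _).bddAbove i
  have : (s : ℝ) * t ≤ s * x i := by gcongr
  linarith

lemma hull_le_hull_add (hj : x j = R) (y y' : Fin n → ℝ) {t : ℝ} (ht : t ≤ R) :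
    hull x y t ≤ hull x y' t + dist y y' := by
  have : Nonempty (Fin n) := ⟨j⟩
  rw [← sub_le_iff_le_add]
  refine le_ciInf fun s => ?_
  rw [sub_le_iff_le_add]
  refine (ciInf_le (hull_bddBelow hj y ht) s).trans ?_
  have : (⨆ i, (y i + s * x i)) ≤ (⨆ i, (y' i + s * x i)) + dist y y' := by
    refine ciSup_le fun i => ?_
    have h1 : y' i + s * x i ≤ ⨆ i, (y' i + s * x i) :=
      le_ciSup (f := fun i => y' i + s * x i) (Set.finite_range _).bddAbove i
    have h2 : y i - y' i ≤ dist y y' :=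
      (le_abs_self _).trans ((Real.dist_eq (y i) (y' i)).symm.le.trans (dist_le_pi_dist y y' i))
    linarith
  linarith

lemma isAdm_hull (hj : x j = R) (y : Fin n → ℝ) : IsAdm R (hull x y) := by
  have hc : ConcaveOn ℝ (Icc 0 R) (hull x y) := by
    refine ⟨convex_Icc _ _, fun u hu v hv a b ha hb hab => ?_⟩
    refine le_ciInf fun s => ?_
    have h1 := ciInf_le (hull_bddBelow hj y hu.2) s
    have h2 := ciInf_le (hull_bddBelow hj y hv.2) s
    have h1' := mul_le_mul_of_nonneg_left h1 ha
    have h2' := mul_le_mul_of_nonneg_left h2 hb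
    simp only [smul_eq_mul]
    refine (add_le_add h1' h2').trans (le_of_eq ?_)
    have : a = 1 - b := by linarith
    subst this; ring
  have ha : AntitoneOn (hull x y) (Icc 0 R) := by
    intro u hu v hv huv
    refine ciInf_mono (hull_bddBelow hj y hv.2) fun s => ?_
    gcongr
  refine ⟨hc, ha, continuousOn_of_concaveOn_antitoneOn hc ha ?_⟩
  refine upperSemicontinuousOn_ciInf (f := fun (s : NNReal) t => (⨆ i, (y i + s * x i)) - s * t)
    (fun t ht => hull_bddBelow hj y ht.2) fun s => ?_
  exact (Continuous.upperSemicontinuous (by fun_prop)).upperSemicontinuousOn _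

/-- Inside `(0, R)` the hull of the values of an admissible function at the sample points lies below
the function, because the supporting lines of the function compete in the infimum. -/
lemma hull_le (hx0 : ∀ i, 0 ≤ x i) (hj : x j = R) (hx : ∀ i, x i ≤ R) {φ : ℝ → ℝ}
    (hφ : IsAdm R φ) {t : ℝ} (ht : t ∈ Ioo 0 R) : hull x (fun i => φ (x i)) t ≤ φ t := by
  have : Nonempty (Fin n) := ⟨j⟩
  obtain ⟨s, hs⟩ := hφ.concave.exists_support ht
  have hs0 : s ≤ 0 := by
    have h0 : (0 : ℝ) ∈ Icc 0 R := left_mem_Icc.2 (ht.1.le.trans ht.2.le)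
    have h1 := hs 0 h0
    have h2 := hφ.antitone h0 (Ioo_subset_Icc_self ht) ht.1.le
    by_contra h
    nlinarith [mul_pos (not_le.1 h) ht.1]
  obtain ⟨s', hs'⟩ : ∃ s' : NNReal, (s' : ℝ) = -s :=
    ⟨(-s).toNNReal, Real.coe_toNNReal _ (by linarith)⟩
  refine (ciInf_le (hull_bddBelow hj _ ht.2.le) s').trans ?_
  rw [sub_le_iff_le_add]
  refine ciSup_le fun i => ?_
  have := hs (x i) ⟨hx0 i, hx i⟩
  rw [hs']
  linarith

/-- The likelihood functional on vectors of values at the sample points. -/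
noncomputable def hullNll (x : Fin n → ℝ) (R : ℝ) (y : Fin n → ℝ) : ℝ :=
  -(∑ i, y i) + n * ∫ t in Icc 0 R, Real.exp (hull x y t)

lemma continuous_hullNll (hj : x j = R) : Continuous (hullNll x R) := by
  unfold hullNll
  refine Continuous.add (by fun_prop) (continuous_const.mul ?_)
  refine continuous_iff_continuousAt.2 fun y => ?_
  refine MeasureTheory.continuousAt_of_dominated
    (bound := fun t => Real.exp (hull x y t + 1)) ?_ ?_ ?_ ?_
  · exact Eventually.of_forall fun y' => (isAdm_hull hj y').integrableOn_exp.aestronglyMeasurable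
  · filter_upwards [Metric.ball_mem_nhds y one_pos] with y' hy'
    filter_upwards [ae_restrict_mem measurableSet_Icc] with t ht
    rw [Real.norm_eq_abs, abs_of_pos (Real.exp_pos _)]
    refine Real.exp_le_exp.2 ((hull_le_hull_add hj y' y ht.2).trans ?_)
    have := (Metric.mem_ball.1 hy').le
    linarith
  · exact ((isAdm_hull hj y).add_const 1).integrableOn_exp
  · filter_upwards [ae_restrict_mem measurableSet_Icc] with t ht
    refine Real.continuous_exp.continuousAt.comp ?_
    refine LipschitzWith.continuous (K := 1) (f := fun y => hull x y t) ?_ |>.continuousAt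
    refine LipschitzWith.of_le_add_mul 1 fun a b => ?_
    simpa using hull_le_hull_add hj a b ht.2

/-- Coercivity. The hull is at least `max y` on `[0, min x]`, so a large maximum is penalized by the
integral and a small value by the sum. -/
lemma norm_sub_le_hullNll {κ : ℝ} (hκ : 0 < κ) (hxκ : ∀ i, κ ≤ x i) (hj : x j = R)
    (hx : ∀ i, x i ≤ R) (y : Fin n → ℝ) : ‖y‖ - n * (2 / κ) ≤ hullNll x R y := by
  have : Nonempty (Fin n) := ⟨j⟩
  obtain ⟨m, hm⟩ := Finite.exists_max y
  set M := y m
  have hn : (1 : ℝ) ≤ n := by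
    have : 0 < n := Fin.pos j
    exact_mod_cast this
  have hint : κ * Real.exp M ≤ ∫ t in Icc 0 R, Real.exp (hull x y t) := by
    have hsub : Icc 0 κ ⊆ Icc 0 R := Icc_subset_Icc_right ((hxκ m).trans (hx m))
    have h1 : ∫ t in Icc 0 κ, Real.exp M ≤ ∫ t in Icc 0 κ, Real.exp (hull x y t) := by
      refine setIntegral_mono_on (by simp) ((isAdm_hull hj y).integrableOn_exp.mono_set hsub)
        measurableSet_Icc fun t ht => Real.exp_le_exp.2 ?_
      exact le_hull y m (ht.2.trans (hxκ m))
    have h2 := setIntegral_mono_set (isAdm_hull hj y).integrableOn_exp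
      (Eventually.of_forall fun t => (Real.exp_pos _).le) hsub.eventuallyLE
    simp [hκ.le] at h1
    linarith
  have hexp : |M| - 2 / κ ≤ κ * Real.exp M - M := by
    rcases le_total 0 M with h | h
    · rw [abs_of_nonneg h]
      have h1 := Real.quadratic_le_exp_of_nonneg h
      have h2 : κ * (M ^ 2 / 2) ≤ κ * Real.exp M := by gcongr; linarith
      have h3 : 0 ≤ κ * (M - 2 / κ) ^ 2 := by positivity
      have h4 : κ * (M - 2 / κ) ^ 2 = κ * M ^ 2 - 4 * M + 4 / κ := by field_simp; ring
      have h5 : 4 / κ = 2 * (2 / κ) := by ring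
      linarith
    · rw [abs_of_nonpos h]
      have : 0 < 2 / κ := by positivity
      have := mul_pos hκ (Real.exp_pos M)
      linarith
  have hsum : ∀ i, |y i| ≤ |M| + ∑ k, (M - y k) := by
    intro i
    have h1 : M - y i ≤ ∑ k, (M - y k) :=
      Finset.single_le_sum (f := fun k => M - y k) (fun k _ => sub_nonneg.2 (hm k))
        (Finset.mem_univ i)
    have h2 := hm i
    rw [abs_le]
    constructor
    · linarith [neg_abs_le M]
    · linarith [le_abs_self M, sub_nonneg.2 (hm i)]
  have hS : ∑ k, (M - y k) = n * M - ∑ k, y k := by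
    rw [Finset.sum_sub_distrib]; simp
  have hnorm : ‖y‖ ≤ |M| + ∑ k, (M - y k) :=
    (pi_norm_le_iff_of_nonempty y).2 hsum
  unfold hullNll
  have h6 : (n : ℝ) * (|M| - 2 / κ) ≤ n * (κ * Real.exp M - M) := by gcongr
  have h7 : (n : ℝ) * (κ * Real.exp M) ≤ n * ∫ t in Icc 0 R, Real.exp (hull x y t) := by gcongr
  have h8 : |M| ≤ n * |M| := le_mul_of_one_le_left (abs_nonneg _) hn
  linarith

/-- The minimum is attained: for vectors of values the functional is continuous and coercive, and
passing from a function to the hull of its values at the sample points does not increase it. -/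
lemma exists_isFit (hx0 : ∀ i, 0 < x i) (hj : x j = R) (hx : ∀ i, x i ≤ R) :
    ∃ g, IsFit x R g := by
  have : Nonempty (Fin n) := ⟨j⟩
  obtain ⟨k, hk⟩ := Finite.exists_min x
  have htend : Tendsto (hullNll x R) (cocompact _) atTop := by
    refine tendsto_atTop_mono (norm_sub_le_hullNll (hx0 k) hk hj hx) ?_
    exact tendsto_atTop_add_const_right _ _ tendsto_norm_cocompact_atTop
  obtain ⟨y, hy⟩ := (continuous_hullNll hj).exists_forall_le htend
  refine ⟨hull x y, fun i => ⟨(hx0 i).le, hx i⟩, isAdm_hull hj y, fun φ hφ => ?_⟩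
  calc nll x R (hull x y) ≤ hullNll x R y := by
        unfold nll hullNll
        gcongr with i
        exact le_hull y i le_rfl
    _ ≤ hullNll x R (fun i => φ (x i)) := hy _
    _ ≤ nll x R φ := by
        unfold nll hullNll
        refine add_le_add_right (mul_le_mul_of_nonneg_left ?_ (Nat.cast_nonneg n)) _
        rw [integral_Icc_eq_integral_Ioo, integral_Icc_eq_integral_Ioo (f := fun t => Real.exp (φ t))]
        refine setIntegral_mono_on ((isAdm_hull hj _).integrableOn_exp.mono_set Ioo_subset_Icc_self)
          (hφ.integrableOn_exp.mono_set Ioo_subset_Icc_self) measurableSet_Ioo fun t ht => ?_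
        exact Real.exp_le_exp.2 (hull_le (fun i => (hx0 i).le) hj hx hφ ht)

end Hull

/-- For a sample of positive points, `densityMLE` is on `[0, max x i]` the exponential of a
minimizer of the real-valued problem. -/
lemma exists_isFit_densityMLE {n : ℕ} {x : Fin n → ℝ} {R : ℝ} {j : Fin n} (hx0 : ∀ i, 0 < x i)
    (hj : x j = R) (hx : ∀ i, x i ≤ R) :
    ∃ g, IsFit x R g ∧ ∀ t ∈ Icc 0 R, densityMLE x t = Real.exp (g t) := by
  have hn : n ≠ 0 := (Fin.pos j).ne'
  have hR : 0 < R := hj ▸ hx0 j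
  have hlow : ∀ (g₀ : ℝ → ℝ), IsFit x R g₀ → ∀ ψ, IsMC ψ →
      (nll x R g₀ : EReal) ≤ negLogLik x ψ := by
    intro g₀ hg₀ ψ hψ
    by_cases h : ψ R = ⊥
    · rw [negLogLik_eq_top (j := j) (by rw [hj, h])]; exact le_top
    · exact (EReal.coe_le_coe_iff.2 (hg₀.opt _ (hψ.isAdm_toReal h))).trans
        (nll_toReal_le_negLogLik hn hψ h hg₀.mem)
  obtain ⟨g₀, hg₀⟩ := exists_isFit hx0 hj hx
  have hex : ∃ ψ, IsLogMLE x ψ := by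
    refine ⟨botExtend R g₀, hg₀.adm.isMC_botExtend hR.le, fun φ hφ => ?_⟩
    rw [negLogLik_botExtend hg₀.adm hx]
    exact hlow g₀ hg₀ φ hφ
  have hM : IsLogMLE x (logMLE x) := by
    unfold logMLE; rw [dif_pos hex]; exact hex.choose_spec
  have hle : negLogLik x (logMLE x) ≤ (nll x R g₀ : EReal) := by
    rw [← negLogLik_botExtend hg₀.adm hx]
    exact hM.2 _ (hg₀.adm.isMC_botExtend hR.le)
  have hbot : logMLE x R ≠ ⊥ := by
    intro h
    rw [negLogLik_eq_top (j := j) (by rw [hj, h])] at hle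
    exact absurd (top_le_iff.1 hle) (EReal.coe_ne_top _)
  refine ⟨fun t => (logMLE x t).toReal, ⟨fun i => ⟨(hx0 i).le, hx i⟩,
    hM.1.isAdm_toReal hbot, fun φ hφ => ?_⟩, fun t ht => ?_⟩
  · have h1 := (nll_toReal_le_negLogLik hn hM.1 hbot hg₀.mem).trans
      (hle.trans (EReal.coe_le_coe_iff.2 (hg₀.opt φ hφ)))
    exact_mod_cast h1
  · unfold densityMLE
    conv_lhs => rw [← hM.1.coe_toReal hbot ht]
    rw [EReal.exp_coe, ENNReal.toReal_ofReal (Real.exp_pos _).le]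

/-! ### Optimality conditions for the estimator -/

/-- The mean of `h` under the empirical measure of the sample `x`. -/
noncomputable def empMean {n : ℕ} (x : Fin n → ℝ) (h : ℝ → ℝ) : ℝ := (∑ i, h (x i)) / n

/-- `g` is affine on `[u, v]`. -/
def AffOn (g : ℝ → ℝ) (u v : ℝ) : Prop := ∃ s, ∀ x ∈ Icc u v, g x = g u + s * (x - u)

namespace IsFit
variable {n : ℕ} {x : Fin n → ℝ} {R : ℝ} {g : ℝ → ℝ}

/-- The directional derivative of the likelihood at the minimizer, in the direction of another
admissible function, has a sign. -/
lemma empMean_sub_le (hg : IsFit x R g) (hn : n ≠ 0) {φ : ℝ → ℝ} (hφ : IsAdm R φ) :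
    empMean x (fun t => φ t - g t) ≤ ∫ t in Icc 0 R, (φ t - g t) * Real.exp (g t) := by
  have hn' : (0 : ℝ) < n := by exact_mod_cast Nat.pos_of_ne_zero hn
  have hcont : ContinuousOn (fun t => φ t - g t) (Icc 0 R) := hφ.cont.sub hg.adm.cont
  obtain ⟨K, hK⟩ := isCompact_Icc.exists_bound_of_continuousOn hcont
  set K' := max K 1
  have hK1 : 1 ≤ K' := le_max_right _ _
  have hKb : ∀ t ∈ Icc 0 R, |φ t - g t| ≤ K' := fun t ht => (hK t ht).trans (le_max_left _ _)
  have hexp := hg.adm.integrableOn_exp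
  have hmul : IntegrableOn (fun t => (φ t - g t) * Real.exp (g t)) (Icc 0 R) :=
    (hcont.mul (Real.continuous_exp.comp_continuousOn hg.adm.cont)).integrableOn_Icc
  set I := ∫ t in Icc 0 R, Real.exp (g t)
  have hI : 0 ≤ I := integral_nonneg fun t => (Real.exp_pos _).le
  set J := ∫ t in Icc 0 R, (φ t - g t) * Real.exp (g t)
  have main : ∀ s : ℝ, 0 < s → s ≤ 1 / K' →
      ∑ i, (φ (x i) - g (x i)) ≤ n * (J + s * (K' ^ 2 * I)) := by
    intro s hs hs1
    have hsK : s * K' ≤ 1 := by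
      rwa [le_div_iff₀ (by linarith)] at hs1
    have hs2 : s ≤ 1 := hs1.trans ((div_le_one (by linarith)).2 hK1)
    have hadm := hg.adm.combo hφ hs.le hs2
    have h1 := hg.opt _ hadm
    have h2 : ∫ t in Icc 0 R, Real.exp (g t + s * (φ t - g t)) ≤ I + s * J + s ^ 2 * K' ^ 2 * I := by
      have e : I + s * J + s ^ 2 * K' ^ 2 * I = ∫ t in Icc 0 R, (Real.exp (g t)
          + s * ((φ t - g t) * Real.exp (g t)) + s ^ 2 * K' ^ 2 * Real.exp (g t)) := by
        have hh : IntegrableOn (fun t => Real.exp (g t) + s * ((φ t - g t) * Real.exp (g t)))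
            (Icc 0 R) := hexp.add (hmul.const_mul _)
        rw [integral_add hh (hexp.const_mul _),
          integral_add hexp (hmul.const_mul _), integral_const_mul, integral_const_mul]
      rw [e]
      refine setIntegral_mono_on hadm.integrableOn_exp
        ((hexp.add (hmul.const_mul _)).add (hexp.const_mul _)) measurableSet_Icc fun t ht => ?_
      rw [Real.exp_add]
      have hu : |s * (φ t - g t)| ≤ s * K' := by
        rw [abs_mul, abs_of_pos hs]; exact mul_le_mul_of_nonneg_left (hKb t ht) hs.le
      have h3 := (abs_le.1 (Real.abs_exp_sub_one_sub_id_le (hu.trans hsK))).2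
      have h4 : (s * (φ t - g t)) ^ 2 ≤ (s * K') ^ 2 := sq_le_sq' (by linarith [(abs_le.1 hu).1])
        (abs_le.1 hu).2
      have h5 : Real.exp (s * (φ t - g t)) ≤ 1 + s * (φ t - g t) + (s * K') ^ 2 := by linarith
      calc Real.exp (g t) * Real.exp (s * (φ t - g t))
          ≤ Real.exp (g t) * (1 + s * (φ t - g t) + (s * K') ^ 2) := by gcongr
        _ = _ := by ring
    unfold nll at h1
    rw [Finset.sum_add_distrib, ← Finset.mul_sum] at h1
    have h3 := mul_le_mul_of_nonneg_left h2 hn'.le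
    have h4 : s * ∑ i, (φ (x i) - g (x i)) ≤ s * (n * (J + s * (K' ^ 2 * I))) := by
      have : s * (n * (J + s * (K' ^ 2 * I))) = n * (I + s * J + s ^ 2 * K' ^ 2 * I) - n * I := by
        ring
      rw [this]
      linarith
    exact le_of_mul_le_mul_left h4 hs
  unfold empMean
  rw [div_le_iff₀ hn']
  have hlim : Tendsto (fun s : ℝ => n * (J + s * (K' ^ 2 * I))) (𝓝[>] 0)
      (𝓝 (n * (J + 0 * (K' ^ 2 * I)))) :=
    ((Continuous.tendsto (by fun_prop) 0).mono_left nhdsWithin_le_nhds)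
  have hfin := ge_of_tendsto (b := ∑ i, (φ (x i) - g (x i))) hlim (by
    filter_upwards [Ioc_mem_nhdsGT (show (0 : ℝ) < 1 / K' by positivity)] with s hs
    exact main s hs.1 hs.2)
  linarith

/-- The optimality condition for the downward perturbation `min g k`. -/
lemma le_empMean_of_dent (hg : IsFit x R g) (hn : n ≠ 0) {k : ℝ → ℝ} (hk : IsAdm R k) :
    ∫ t in Icc 0 R, max (g t - k t) 0 * Real.exp (g t) ≤ empMean x (fun t => max (g t - k t) 0) := by
  have h := hg.empMean_sub_le hn (hg.adm.inf hk)
  have e : ∀ t, min (g t) (k t) - g t = -max (g t - k t) 0 := fun t => by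
    rcases le_total (g t) (k t) with h | h
    · rw [min_eq_left h, max_eq_right (by linarith)]; ring
    · rw [min_eq_right h, max_eq_left (by linarith)]; ring
  simp only [e, neg_mul, integral_neg, empMean, Finset.sum_neg_distrib, neg_div] at h
  unfold empMean
  linarith

/-- The optimality condition for the minimum of two upward perturbations. -/
lemma empMean_min_le (hg : IsFit x R g) (hn : n ≠ 0) {W₁ W₂ : ℝ → ℝ}
    (h₁ : IsAdm R (fun t => g t + W₁ t)) (h₂ : IsAdm R (fun t => g t + W₂ t)) :
    empMean x (fun t => min (W₁ t) (W₂ t))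
      ≤ ∫ t in Icc 0 R, min (W₁ t) (W₂ t) * Real.exp (g t) := by
  have h := hg.empMean_sub_le hn (h₁.inf h₂)
  have e : ∀ t, min (g t + W₁ t) (g t + W₂ t) - g t = min (W₁ t) (W₂ t) := fun t => by
    rw [min_add_add_left]; ring
  simpa only [e] using h

lemma tendsto_integral_mul_exp (hg : IsFit x R g) {h : ℕ → ℝ → ℝ} {h' : ℝ → ℝ} {K : ℝ}
    (hm : ∀ k, AEStronglyMeasurable (h k) (volume.restrict (Icc 0 R)))
    (hb : ∀ k, ∀ t ∈ Icc 0 R, |h k t| ≤ K)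
    (hl : ∀ t ∈ Icc 0 R, Tendsto (fun k => h k t) atTop (𝓝 (h' t))) :
    Tendsto (fun k => ∫ t in Icc 0 R, h k t * Real.exp (g t)) atTop
      (𝓝 (∫ t in Icc 0 R, h' t * Real.exp (g t))) := by
  refine tendsto_integral_of_dominated_convergence (fun t => K * Real.exp (g t))
    (fun k => (hm k).mul hg.adm.integrableOn_exp.aestronglyMeasurable)
    (hg.adm.integrableOn_exp.const_mul K) (fun k => ?_) ?_
  · filter_upwards [ae_restrict_mem measurableSet_Icc] with t ht
    rw [norm_mul, Real.norm_eq_abs, Real.norm_eq_abs, abs_of_pos (Real.exp_pos _)]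
    exact mul_le_mul_of_nonneg_right (hb k t ht) (Real.exp_pos _).le
  · filter_upwards [ae_restrict_mem measurableSet_Icc] with t ht
    exact (hl t ht).mul_const _

lemma tendsto_empMean (hg : IsFit x R g) {h : ℕ → ℝ → ℝ} {h' : ℝ → ℝ}
    (hl : ∀ t ∈ Icc 0 R, Tendsto (fun k => h k t) atTop (𝓝 (h' t))) :
    Tendsto (fun k => empMean x (h k)) atTop (𝓝 (empMean x h')) :=
  (tendsto_finsetSum _ fun i _ => hl (x i) (hg.mem i)).div_const _

/-- Concave non-positive perturbations that live on a maximal affine piece of the minimizer. The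
test function may jump to `0` at the ends of the piece: it is the limit of
`-(g - (ℓ + η * Δ))⁺ / η` as `η → 0`, where `ℓ` is the affine function. -/
lemma empMean_indicator_le (hg : IsFit x R g) (hn : n ≠ 0) {p q u v s : ℝ} {Δ : ℝ → ℝ}
    (hon : ∀ t ∈ Icc p q, g t = u + s * (t - v))
    (hoff : ∀ t ∈ Icc 0 R, t ∉ Icc p q → g t < u + s * (t - v))
    (hc : ConcaveOn ℝ (Icc 0 R) Δ) (hcont : ContinuousOn Δ (Icc 0 R))
    (hneg : ∀ t ∈ Icc 0 R, Δ t ≤ 0) {η₀ : ℝ} (hη₀ : 0 < η₀)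
    (hanti : ∀ η, 0 < η → η ≤ η₀ → AntitoneOn (fun t => u + s * (t - v) + η * Δ t) (Icc 0 R)) :
    empMean x ((Icc p q).indicator Δ)
      ≤ ∫ t in Icc 0 R, (Icc p q).indicator Δ t * Real.exp (g t) := by
  set η : ℕ → ℝ := fun k => η₀ / (k + 1)
  have hη : ∀ k, 0 < η k := fun k => by positivity
  have hηle : ∀ k, η k ≤ η₀ := fun k => div_le_self hη₀.le (by linarith [k.cast_nonneg (α := ℝ)])
  have hηlim : Tendsto η atTop (𝓝 0) := by
    have := (tendsto_one_div_add_atTop_nhds_zero_nat (𝕜 := ℝ)).const_mul η₀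
    simpa [η, div_eq_mul_inv] using this
  have haff : ConcaveOn ℝ (Icc 0 R) (fun t => u + s * (t - v)) :=
    ⟨convex_Icc _ _, fun x _ y _ a b _ _ hab => by
      simp only [smul_eq_mul]
      have : a = 1 - b := by linarith
      subst this; apply le_of_eq; ring⟩
  have hadm : ∀ k, IsAdm R (fun t => u + s * (t - v) + η k * Δ t) := fun k =>
    ⟨haff.add (hc.smul (hη k).le), hanti _ (hη k) (hηle k),
      (by fun_prop : ContinuousOn (fun t => u + s * (t - v)) _).add (hcont.const_mul _)⟩
  have hg_le : ∀ t ∈ Icc 0 R, g t ≤ u + s * (t - v) := fun t ht => by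
    by_cases h : t ∈ Icc p q
    · exact (hon t h).le
    · exact (hoff t ht h).le
  obtain ⟨K, hK⟩ := isCompact_Icc.exists_bound_of_continuousOn hcont
  set h : ℕ → ℝ → ℝ := fun k t => -(max (g t - (u + s * (t - v) + η k * Δ t)) 0 / η k)
  have htest : ∀ k, empMean x (h k) ≤ ∫ t in Icc 0 R, h k t * Real.exp (g t) := by
    intro k
    have h1 := hg.le_empMean_of_dent hn (hadm k)
    have e1 : empMean x (h k)
        = -(empMean x (fun t => max (g t - (u + s * (t - v) + η k * Δ t)) 0) / η k) := by
      simp only [empMean, h, Finset.sum_neg_distrib, ← Finset.sum_div]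
      ring
    have e2 : ∫ t in Icc 0 R, h k t * Real.exp (g t)
        = -((∫ t in Icc 0 R, max (g t - (u + s * (t - v) + η k * Δ t)) 0 * Real.exp (g t)) / η k) := by
      rw [← integral_div, ← integral_neg]
      congr 1; ext t; simp only [h]; ring
    rw [e1, e2]
    have := div_le_div_of_nonneg_right h1 (hη k).le
    linarith
  have hbound : ∀ k, ∀ t ∈ Icc 0 R, |h k t| ≤ K := by
    intro k t ht
    have h1 : max (g t - (u + s * (t - v) + η k * Δ t)) 0 ≤ K * η k := by
      refine max_le ?_ (mul_nonneg ((abs_nonneg _).trans (hK t ht)) (hη k).le)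
      have := (abs_le.1 (hK t ht)).1
      nlinarith [hg_le t ht, hη k]
    have h2 : 0 ≤ max (g t - (u + s * (t - v) + η k * Δ t)) 0 / η k :=
      div_nonneg (le_max_right _ _) (hη k).le
    simp only [h, abs_neg, abs_of_nonneg h2]
    rwa [div_le_iff₀ (hη k)]
  have hlim : ∀ t ∈ Icc 0 R, Tendsto (fun k => h k t) atTop (𝓝 ((Icc p q).indicator Δ t)) := by
    intro t ht
    by_cases hpq : t ∈ Icc p q
    · have : ∀ k, h k t = (Icc p q).indicator Δ t := fun k => by
        rw [indicator_of_mem hpq]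
        simp only [h]
        rw [hon t hpq, max_eq_left (by nlinarith [hneg t ht, hη k])]
        field_simp [(hη k).ne']; ring
      simp only [this]
      exact tendsto_const_nhds
    · rw [indicator_of_notMem hpq]
      have h1 : Tendsto (fun k => η k * Δ t) atTop (𝓝 (0 * Δ t)) := hηlim.mul_const _
      rw [zero_mul] at h1
      have h2 := h1.eventually (lt_mem_nhds (sub_neg.2 (hoff t ht hpq)))
      refine tendsto_const_nhds.congr' ?_
      filter_upwards [h2] with k hk
      simp only [h]
      rw [max_eq_right (by linarith)]; simp
  have hmeas : ∀ k, AEStronglyMeasurable (h k) (volume.restrict (Icc 0 R)) := fun k =>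
    ContinuousOn.aestronglyMeasurable
      (((hg.adm.cont.sub (hadm k).cont).sup continuousOn_const).div_const _).neg measurableSet_Icc
  exact le_of_tendsto_of_tendsto' (hg.tendsto_empMean hlim)
    (hg.tendsto_integral_mul_exp hmeas hbound hlim) htest

end IsFit

section Caps
variable {R : ℝ} {g : ℝ → ℝ}

lemma IsAdm.exists_support (hg : IsAdm R g) {c : ℝ} (hc : c ∈ Ico 0 R) :
    ∃ s ≤ 0, ∀ z ∈ Icc 0 R, g z ≤ g c + s * (z - c) := by
  have h0 : (0 : ℝ) ∈ Icc 0 R := left_mem_Icc.2 (hc.1.trans hc.2.le)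
  rcases eq_or_lt_of_le hc.1 with h | h
  · subst h
    exact ⟨0, le_rfl, fun z hz => by simpa using hg.antitone h0 hz hz.1⟩
  · obtain ⟨s, hs⟩ := hg.concave.exists_support ⟨h, hc.2⟩
    refine ⟨s, ?_, hs⟩
    have h1 := hs 0 h0
    have h2 := hg.antitone h0 ⟨hc.1, hc.2.le⟩ hc.1
    by_contra hpos
    nlinarith [mul_pos (not_le.1 hpos) h]

/-- Replacing an admissible function to the right of `c` by a supporting line at `c`. -/
lemma IsAdm.extend_right (hg : IsAdm R g) {c s : ℝ} (hc : c ∈ Icc 0 R) (hs : s ≤ 0)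
    (hsup : ∀ z ∈ Icc 0 R, g z ≤ g c + s * (z - c)) :
    IsAdm R (fun t => g (min t c) + s * max (t - c) 0) where
  antitone := by
    intro t ht t' ht' htt'
    have h1 : g (min t' c) ≤ g (min t c) := hg.antitone
      ⟨le_min ht.1 hc.1, (min_le_right _ _).trans hc.2⟩
      ⟨le_min ht'.1 hc.1, (min_le_right _ _).trans hc.2⟩ (min_le_min_right _ htt')
    have h2 : max (t - c) 0 ≤ max (t' - c) 0 := max_le_max_right _ (by linarith)
    exact add_le_add h1 (mul_le_mul_of_nonpos_left h2 hs)
  cont := by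
    refine ContinuousOn.add (hg.cont.comp (by fun_prop) fun t ht => ?_) (by fun_prop)
    exact ⟨le_min ht.1 hc.1, (min_le_right _ _).trans hc.2⟩
  concave := by
    refine LinearOrder.concaveOn_of_lt (convex_Icc _ _) fun u hu v hv huv a b ha hb hab => ?_
    simp only [smul_eq_mul]
    have ea : a = 1 - b := by linarith
    set z := a * u + b * v with hz
    have hz1 : z = u + b * (v - u) := by rw [hz, ea]; ring
    have huz : u ≤ z := by nlinarith
    have hzv : z ≤ v := by nlinarith
    rcases le_total v c with h | h
    · rw [min_eq_left h, min_eq_left (huv.le.trans h), min_eq_left (hzv.trans h),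
        max_eq_right (by linarith), max_eq_right (by linarith), max_eq_right (by linarith)]
      have := hg.concave.2 hu hv ha.le hb.le hab
      simp only [smul_eq_mul] at this
      simpa using this
    · rcases le_total c u with h' | h'
      · rw [min_eq_right h, min_eq_right h', min_eq_right (h'.trans huz),
          max_eq_left (by linarith), max_eq_left (by linarith), max_eq_left (by linarith), hz, ea]
        apply le_of_eq; ring
      · rw [min_eq_right h, min_eq_left h', max_eq_right (by linarith), max_eq_left (by linarith)]
        have hLu := hsup u hu
        rcases le_total c z with h2 | h2
        · rw [min_eq_right h2, max_eq_left (by linarith), hz, ea]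
          have := mul_le_mul_of_nonneg_left hLu ha.le
          rw [ea] at this
          nlinarith
        · rw [min_eq_left h2, max_eq_right (by linarith)]
          rcases eq_or_lt_of_le h' with h3 | h3
          · have : z = c := le_antisymm h2 (h3 ▸ huz)
            subst h3
            have : b * (v - u) = 0 := by linarith
            nlinarith
          · have hch := hg.concave.chord_le hu hc huz h2
            have h4 : 0 ≤ b * (v - c) * (g c + s * (u - c) - g u) :=
              mul_nonneg (mul_nonneg hb.le (by linarith)) (by linarith)
            have h5 : (c - u) * (a * (g u + s * 0) + b * (g c + s * (v - c)))
                = (c - z) * g u + (z - u) * g c - b * (v - c) * (g c + s * (u - c) - g u) := by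
              rw [hz1, ea]; ring
            refine le_of_mul_le_mul_left ?_ (sub_pos.2 h3)
            rw [h5]; linarith

/-- Replacing an admissible function to the left of `d` by a supporting line at `d`. -/
lemma IsAdm.extend_left (hg : IsAdm R g) {d s : ℝ} (hd : d ∈ Icc 0 R) (hs : s ≤ 0)
    (hsup : ∀ z ∈ Icc 0 R, g z ≤ g d + s * (z - d)) :
    IsAdm R (fun t => g (max t d) + s * min (t - d) 0) where
  antitone := by
    intro t ht t' ht' htt'
    have h1 : g (max t' d) ≤ g (max t d) := hg.antitone
      ⟨hd.1.trans (le_max_right _ _), max_le ht.2 hd.2⟩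
      ⟨hd.1.trans (le_max_right _ _), max_le ht'.2 hd.2⟩ (max_le_max_right _ htt')
    have h2 : min (t - d) 0 ≤ min (t' - d) 0 := min_le_min_right _ (by linarith)
    exact add_le_add h1 (mul_le_mul_of_nonpos_left h2 hs)
  cont := by
    refine ContinuousOn.add (hg.cont.comp (by fun_prop) fun t ht => ?_) (by fun_prop)
    exact ⟨hd.1.trans (le_max_right _ _), max_le ht.2 hd.2⟩
  concave := by
    refine LinearOrder.concaveOn_of_lt (convex_Icc _ _) fun u hu v hv huv a b ha hb hab => ?_
    simp only [smul_eq_mul]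
    have ea : a = 1 - b := by linarith
    have eb : b = 1 - a := by linarith
    set z := a * u + b * v with hz
    have hz1 : z = v - a * (v - u) := by rw [hz, eb]; ring
    have huz : u ≤ z := by nlinarith
    have hzv : z ≤ v := by nlinarith
    rcases le_total d u with h | h
    · rw [max_eq_left h, max_eq_left (h.trans huv.le), max_eq_left (h.trans huz),
        min_eq_right (by linarith), min_eq_right (by linarith), min_eq_right (by linarith)]
      have := hg.concave.2 hu hv ha.le hb.le hab
      simp only [smul_eq_mul] at this
      simpa using this
    · rcases le_total v d with h' | h'
      · rw [max_eq_right h, max_eq_right h', max_eq_right (hzv.trans h'),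
          min_eq_left (by linarith), min_eq_left (by linarith), min_eq_left (by linarith), hz, ea]
        apply le_of_eq; ring
      · rw [max_eq_right h, max_eq_left h', min_eq_left (by linarith), min_eq_right (by linarith)]
        have hLv := hsup v hv
        rcases le_total z d with h2 | h2
        · rw [max_eq_right h2, min_eq_left (by linarith), hz, ea]
          have := mul_le_mul_of_nonneg_left hLv hb.le
          nlinarith
        · rw [max_eq_left h2, min_eq_right (by linarith)]
          rcases eq_or_lt_of_le h' with h3 | h3
          · have : z = d := le_antisymm (h3 ▸ hzv) h2
            subst h3
            have : a * (d - u) = 0 := by linarith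
            nlinarith
          · have hch := hg.concave.chord_le hd hv h2 hzv
            have h4 : 0 ≤ a * (d - u) * (g d + s * (v - d) - g v) :=
              mul_nonneg (mul_nonneg ha.le (by linarith)) (by linarith)
            have h5 : (v - d) * (a * (g d + s * (u - d)) + b * (g v + s * 0))
                = (v - z) * g d + (z - d) * g v - a * (d - u) * (g d + s * (v - d) - g v) := by
              rw [hz1, eb]; ring
            refine le_of_mul_le_mul_left ?_ (sub_pos.2 h3)
            rw [h5]; linarith

/-- An upward perturbation of size `η` to the right of `c₁` that leaves `g` unchanged to the left
of `c` exists as soon as `g` is not affine on `[c, c₁]`: cap `g + η` by a supporting line at `c`. -/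
lemma IsAdm.exists_left_cap (hg : IsAdm R g) {c c₁ : ℝ} (hc : c ∈ Ico 0 R) (hcc : c ≤ c₁)
    (hc₁ : c₁ ≤ R) (hna : ¬ AffOn g c c₁) :
    ∃ η₀ > 0, ∀ η, 0 < η → η ≤ η₀ → ∃ W : ℝ → ℝ, IsAdm R (fun t => g t + W t) ∧
      MonotoneOn W (Icc 0 R) ∧ (∀ t ∈ Icc 0 R, t ≤ c → W t = 0) ∧
      (∀ t ∈ Icc 0 R, c₁ ≤ t → W t = η) ∧ ∀ t ∈ Icc 0 R, 0 ≤ W t ∧ W t ≤ η := by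
  obtain ⟨s, hs, hsup⟩ := hg.exists_support hc
  have hcR : c ∈ Icc 0 R := ⟨hc.1, hc.2.le⟩
  have hc₁R : c₁ ∈ Icc 0 R := ⟨hc.1.trans hcc, hc₁⟩
  set E : ℝ → ℝ := fun t => g (min t c) + s * max (t - c) 0 with hE
  have hEadm : IsAdm R E := hg.extend_right hcR hs hsup
  have hEl : ∀ t, t ≤ c → E t = g t := fun t ht => by
    simp only [hE]; rw [min_eq_left ht, max_eq_right (by linarith)]; simp
  have hEr : ∀ t, c ≤ t → E t = g c + s * (t - c) := fun t ht => by
    simp only [hE]; rw [min_eq_right ht, max_eq_left (by linarith)]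
  have hgE : ∀ t ∈ Icc 0 R, g t ≤ E t := fun t ht => by
    rcases le_total t c with h | h
    · rw [hEl t h]
    · rw [hEr t h]; exact hsup t ht
  have hmono : MonotoneOn (fun t => E t - g t) (Icc 0 R) := by
    intro t ht t' ht' htt'
    rcases le_total t c with h | h
    · simp only [hEl t h, sub_self]; linarith [hgE t' ht']
    · simp only [hEr t h, hEr t' (h.trans htt')]
      rcases eq_or_lt_of_le h with h1 | h1
      · subst h1; linarith [hsup t' ht']
      · have hch := hg.concave.chord_le hcR ht' h htt'
        have h2 := mul_le_mul_of_nonneg_left (hsup t ht) (sub_nonneg.2 htt')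
        have h3 : (t - c) * (g t' - g t) ≤ (t - c) * (s * (t' - t)) := by nlinarith
        have := le_of_mul_le_mul_left h3 (sub_pos.2 h1)
        linarith
  have hpos : 0 < E c₁ - g c₁ := by
    by_contra hcon
    refine hna ⟨s, fun t ht => le_antisymm (hsup t ⟨hc.1.trans ht.1, ht.2.trans hc₁⟩) ?_⟩
    rw [hEr _ hcc] at hcon
    rcases eq_or_lt_of_le hcc with h | h
    · have : t = c := le_antisymm (h ▸ ht.2) ht.1
      subst this; simp
    · have hch := hg.concave.chord_le hcR hc₁R ht.1 ht.2
      have h1 : (t - c) * (g c + s * (c₁ - c)) ≤ (t - c) * g c₁ :=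
        mul_le_mul_of_nonneg_left (by linarith) (sub_nonneg.2 ht.1)
      refine le_of_mul_le_mul_left ?_ (sub_pos.2 h)
      nlinarith
  refine ⟨E c₁ - g c₁, hpos, fun η hη hη' => ⟨fun t => min η (E t - g t), ?_, ?_, ?_, ?_, ?_⟩⟩
  · have e : (fun t => g t + min η (E t - g t)) = fun t => min (g t + η) (E t) := by
      ext t; rw [← min_add_add_left]; congr 1; ring
    rw [e]; exact (hg.add_const η).inf hEadm
  · exact fun t ht t' ht' htt' => min_le_min_left _ (hmono ht ht' htt')
  · intro t _ htc
    simp only [hEl t htc, sub_self]; exact min_eq_right hη.le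
  · intro t ht htc
    exact min_eq_left (hη'.trans (hmono hc₁R ht htc))
  · exact fun t ht => ⟨le_min hη.le (sub_nonneg.2 (hgE t ht)), min_le_left _ _⟩

/-- The mirror image of `IsAdm.exists_left_cap`. -/
lemma IsAdm.exists_right_cap (hg : IsAdm R g) {d₁ d : ℝ} (hd : d ∈ Ico 0 R) (hdd : d₁ ≤ d)
    (hd₁ : 0 ≤ d₁) (hna : ¬ AffOn g d₁ d) :
    ∃ η₀ > 0, ∀ η, 0 < η → η ≤ η₀ → ∃ W : ℝ → ℝ, IsAdm R (fun t => g t + W t) ∧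
      AntitoneOn W (Icc 0 R) ∧ (∀ t ∈ Icc 0 R, d ≤ t → W t = 0) ∧
      (∀ t ∈ Icc 0 R, t ≤ d₁ → W t = η) ∧ ∀ t ∈ Icc 0 R, 0 ≤ W t ∧ W t ≤ η := by
  obtain ⟨s, hs, hsup⟩ := hg.exists_support hd
  have hdR : d ∈ Icc 0 R := ⟨hd.1, hd.2.le⟩
  have hd₁R : d₁ ∈ Icc 0 R := ⟨hd₁, hdd.trans hd.2.le⟩
  set E : ℝ → ℝ := fun t => g (max t d) + s * min (t - d) 0 with hE
  have hEadm : IsAdm R E := hg.extend_left hdR hs hsup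
  have hEr : ∀ t, d ≤ t → E t = g t := fun t ht => by
    simp only [hE]; rw [max_eq_left ht, min_eq_right (by linarith)]; simp
  have hEl : ∀ t, t ≤ d → E t = g d + s * (t - d) := fun t ht => by
    simp only [hE]; rw [max_eq_right ht, min_eq_left (by linarith)]
  have hgE : ∀ t ∈ Icc 0 R, g t ≤ E t := fun t ht => by
    rcases le_total t d with h | h
    · rw [hEl t h]; exact hsup t ht
    · rw [hEr t h]
  have hmono : AntitoneOn (fun t => E t - g t) (Icc 0 R) := by
    intro t ht t' ht' htt'
    rcases le_total d t' with h | h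
    · simp only [hEr t' h, sub_self]; linarith [hgE t ht]
    · simp only [hEl t' h, hEl t (htt'.trans h)]
      rcases eq_or_lt_of_le h with h1 | h1
      · subst h1; linarith [hsup t ht]
      · have hch := hg.concave.chord_le ht hdR htt' h
        have h2 := mul_le_mul_of_nonneg_left (hsup t' ht') (sub_nonneg.2 htt')
        have h3 : (d - t') * (g t - g t') ≤ (d - t') * (s * (t - t')) := by nlinarith
        have := le_of_mul_le_mul_left h3 (sub_pos.2 h1)
        linarith
  have hpos : 0 < E d₁ - g d₁ := by
    by_contra hcon
    rw [hEl _ hdd] at hcon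
    have heq : g d₁ = g d + s * (d₁ - d) := le_antisymm (hsup _ hd₁R) (by linarith)
    refine hna ⟨s, fun t ht => ?_⟩
    have hup := hsup t ⟨hd₁.trans ht.1, ht.2.trans hd.2.le⟩
    rcases eq_or_lt_of_le hdd with h | h
    · have : t = d₁ := le_antisymm (h ▸ ht.2) ht.1
      subst this; simp
    · have hch := hg.concave.chord_le hd₁R hdR ht.1 ht.2
      refine le_antisymm (by linarith) ?_
      refine le_of_mul_le_mul_left ?_ (sub_pos.2 h)
      rw [heq] at hch ⊢
      nlinarith
  refine ⟨E d₁ - g d₁, hpos, fun η hη hη' => ⟨fun t => min η (E t - g t), ?_, ?_, ?_, ?_, ?_⟩⟩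
  · have e : (fun t => g t + min η (E t - g t)) = fun t => min (g t + η) (E t) := by
      ext t; rw [← min_add_add_left]; congr 1; ring
    rw [e]; exact (hg.add_const η).inf hEadm
  · exact fun t ht t' ht' htt' => min_le_min_left _ (hmono ht ht' htt')
  · intro t _ htc
    simp only [hEr t htc, sub_self]; exact min_eq_right hη.le
  · intro t ht htc
    exact min_eq_left (hη'.trans (hmono ht hd₁R htc))
  · exact fun t ht => ⟨le_min hη.le (sub_nonneg.2 (hgE t ht)), min_le_left _ _⟩

end Caps

/-- Every affine piece extends to a maximal one, which the affine function determines. -/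
lemma IsAdm.exists_maximal_affine {R : ℝ} {g : ℝ → ℝ} (hg : IsAdm R g) {c d s : ℝ} (hc : 0 ≤ c)
    (hcd : c < d) (hd : d ≤ R) (haff : ∀ t ∈ Icc c d, g t = g c + s * (t - c)) :
    ∃ p q, 0 ≤ p ∧ p ≤ c ∧ d ≤ q ∧ q ≤ R ∧ (∀ t ∈ Icc p q, g t = g c + s * (t - c)) ∧
      ∀ t ∈ Icc 0 R, t ∉ Icc p q → g t < g c + s * (t - c) := by
  have hcR : c ∈ Icc 0 R := ⟨hc, hcd.le.trans hd⟩
  have hdR : d ∈ Icc 0 R := ⟨hc.trans hcd.le, hd⟩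
  have hd' := haff d (right_mem_Icc.2 hcd.le)
  have hle : ∀ t ∈ Icc 0 R, g t ≤ g c + s * (t - c) := by
    intro t ht
    rcases le_total t c with h | h
    · have := hg.concave.chord_le ht hdR h hcd.le
      rw [hd'] at this
      refine le_of_mul_le_mul_left ?_ (sub_pos.2 hcd)
      nlinarith
    · rcases le_total t d with h' | h'
      · exact (haff t ⟨h, h'⟩).le
      · have := hg.concave.chord_le hcR ht hcd.le h'
        rw [hd'] at this
        refine le_of_mul_le_mul_left ?_ (sub_pos.2 hcd)
        nlinarith
  set Z : Set ℝ := {t | t ∈ Icc 0 R ∧ g c + s * (t - c) ≤ g t} with hZ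
  have hZc : IsCompact Z := by
    have : Z = Icc 0 R ∩ (fun t => g t - (g c + s * (t - c))) ⁻¹' Ici 0 := by
      ext t; simp [hZ]
    rw [this]
    refine IsCompact.of_isClosed_subset isCompact_Icc ?_ inter_subset_left
    exact (hg.cont.sub (by fun_prop)).preimage_isClosed_of_isClosed isClosed_Icc isClosed_Ici
  have hcZ : c ∈ Z := ⟨hcR, by simp⟩
  have hdZ : d ∈ Z := ⟨hdR, hd'.ge⟩
  have hp := hZc.sInf_mem ⟨c, hcZ⟩
  have hq := hZc.sSup_mem ⟨c, hcZ⟩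
  have hpl : ∀ t ∈ Z, sInf Z ≤ t := fun t ht => csInf_le hZc.bddBelow ht
  have hql : ∀ t ∈ Z, t ≤ sSup Z := fun t ht => le_csSup hZc.bddAbove ht
  refine ⟨sInf Z, sSup Z, hp.1.1, hpl c hcZ, hql d hdZ, hq.1.2, fun t ht => ?_, fun t ht hnot => ?_⟩
  · have htR : t ∈ Icc 0 R := ⟨hp.1.1.trans ht.1, ht.2.trans hq.1.2⟩
    refine le_antisymm (hle t htR) ?_
    have hlt : sInf Z < sSup Z := (hpl c hcZ).trans_lt (hcd.trans_le (hql d hdZ))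
    have := hg.concave.chord_le hp.1 hq.1 ht.1 ht.2
    have h1 := mul_le_mul_of_nonneg_left hp.2 (sub_nonneg.2 ht.2)
    have h2 := mul_le_mul_of_nonneg_left hq.2 (sub_nonneg.2 ht.1)
    refine le_of_mul_le_mul_left ?_ (sub_pos.2 hlt)
    nlinarith
  · refine lt_of_le_of_ne (hle t ht) fun h => hnot ⟨hpl t ⟨ht, h.ge⟩, hql t ⟨ht, h.ge⟩⟩

/-- Two affine pieces that overlap lie on a common line. -/
lemma AffOn.eq_of_overlap {g : ℝ → ℝ} {u v p q c s : ℝ} (h : AffOn g u v)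
    (hpq : ∀ t ∈ Icc p q, g t = g c + s * (t - c)) {a b : ℝ} (hab : a < b)
    (ha : a ∈ Icc u v) (hb : b ∈ Icc u v) (ha' : a ∈ Icc p q) (hb' : b ∈ Icc p q) {t : ℝ}
    (ht : t ∈ Icc u v) : g t = g c + s * (t - c) := by
  obtain ⟨r, hr⟩ := h
  have h1 := hr a ha
  have h2 := hr b hb
  rw [hpq a ha'] at h1
  rw [hpq b hb'] at h2
  have h3 : (r - s) * (b - a) = 0 := by linarith
  have h4 : r = s := by
    rcases mul_eq_zero.1 h3 with h | h
    · linarith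
    · linarith
  rw [hr t ht]; subst h4; linarith

/-- Between the ends of a maximal affine piece the empirical mass is at most the fitted mass. -/
lemma IsFit.empMean_Ioo_le {n : ℕ} {x : Fin n → ℝ} {R : ℝ} {g : ℝ → ℝ} (hg : IsFit x R g)
    (hn : n ≠ 0) {p q c s : ℝ} (hp : 0 ≤ p) (hpq : p < q) (hq : q ≤ R)
    (hon : ∀ t ∈ Icc p q, g t = g c + s * (t - c))
    (hoff : ∀ t ∈ Icc 0 R, t ∉ Icc p q → g t < g c + s * (t - c)) :
    empMean x ((Ioo p q).indicator 1)
      ≤ ∫ t in Icc 0 R, (Icc p q).indicator 1 t * Real.exp (g t) := by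
  have hn' : (0 : ℝ) < n := by exact_mod_cast Nat.pos_of_ne_zero hn
  -- test functions that vanish off `[p - θ, q + θ]` and equal `1` on `[p + θ, q - θ]`
  have key : ∀ θ, 0 < θ → θ < (q - p) / 2 →
      empMean x ((Icc (p + θ) (q - θ)).indicator 1)
        ≤ ∫ t in Icc 0 R, (Icc (p - θ) (q + θ)).indicator 1 t * Real.exp (g t) := by
    intro θ hθ hθ'
    have hleft : ∃ η₀ > 0, ∀ η, 0 < η → η ≤ η₀ → ∃ W : ℝ → ℝ, IsAdm R (fun t => g t + W t) ∧
        (∀ t ∈ Icc 0 R, t < p - θ → W t = 0) ∧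
        (∀ t ∈ Icc 0 R, p + θ ≤ t → W t = η) ∧ ∀ t ∈ Icc 0 R, 0 ≤ W t ∧ W t ≤ η := by
      rcases lt_or_ge (p - θ) 0 with h | h
      · exact ⟨1, one_pos, fun η hη _ => ⟨fun _ => η, hg.adm.add_const η,
          fun t ht ht' => absurd (ht.1.trans_lt ht') (not_lt.2 h.le), fun _ _ _ => rfl,
          fun _ _ => ⟨hη.le, le_rfl⟩⟩⟩
      · obtain ⟨η₀, h0, h1⟩ := hg.adm.exists_left_cap (c := p - θ) (c₁ := p + θ)
          ⟨h, by linarith⟩ (by linarith) (by linarith) (fun haff => by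
            have := haff.eq_of_overlap hon (a := p) (b := p + θ) (by linarith)
              ⟨by linarith, by linarith⟩ ⟨by linarith, by linarith⟩ ⟨by linarith, by linarith⟩
              ⟨by linarith, by linarith⟩ (t := p - θ) ⟨by linarith, by linarith⟩
            have h2 := hoff (p - θ) ⟨h, by linarith⟩ (fun h => by linarith [h.1])
            linarith)
        refine ⟨η₀, h0, fun η hη hη' => ?_⟩
        obtain ⟨W, w1, -, w2, w3, w4⟩ := h1 η hη hη'
        exact ⟨W, w1, fun t ht ht' => w2 t ht ht'.le, w3, w4⟩
    have hright : ∃ η₀ > 0, ∀ η, 0 < η → η ≤ η₀ → ∃ W : ℝ → ℝ, IsAdm R (fun t => g t + W t) ∧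
        (∀ t ∈ Icc 0 R, q + θ < t → W t = 0) ∧
        (∀ t ∈ Icc 0 R, t ≤ q - θ → W t = η) ∧ ∀ t ∈ Icc 0 R, 0 ≤ W t ∧ W t ≤ η := by
      rcases le_or_gt R (q + θ) with h | h
      · exact ⟨1, one_pos, fun η hη _ => ⟨fun _ => η, hg.adm.add_const η,
          fun t ht ht' => absurd (ht'.trans_le ht.2) (not_lt.2 h), fun _ _ _ => rfl,
          fun _ _ => ⟨hη.le, le_rfl⟩⟩⟩
      · obtain ⟨η₀, h0, h1⟩ := hg.adm.exists_right_cap (d := q + θ) (d₁ := q - θ)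
          ⟨by linarith, h⟩ (by linarith) (by linarith) (fun haff => by
            have := haff.eq_of_overlap hon (a := q - θ) (b := q) (by linarith)
              ⟨by linarith, by linarith⟩ ⟨by linarith, by linarith⟩ ⟨by linarith, by linarith⟩
              ⟨by linarith, by linarith⟩ (t := q + θ) ⟨by linarith, by linarith⟩
            have h2 := hoff (q + θ) ⟨by linarith, h.le⟩ (fun h => by linarith [h.2])
            linarith)
        refine ⟨η₀, h0, fun η hη hη' => ?_⟩
        obtain ⟨W, w1, -, w2, w3, w4⟩ := h1 η hη hη'
        exact ⟨W, w1, fun t ht ht' => w2 t ht ht'.le, w3, w4⟩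
    obtain ⟨η₁, h₁, hW₁⟩ := hleft
    obtain ⟨η₂, h₂, hW₂⟩ := hright
    set η := min η₁ η₂
    have hη : 0 < η := lt_min h₁ h₂
    obtain ⟨W₁, a1, a2, a3, a4⟩ := hW₁ η hη (min_le_left _ _)
    obtain ⟨W₂, b1, b2, b3, b4⟩ := hW₂ η hη (min_le_right _ _)
    have htest := hg.empMean_min_le hn a1 b1
    have hlow : η * empMean x ((Icc (p + θ) (q - θ)).indicator 1)
        ≤ empMean x (fun t => min (W₁ t) (W₂ t)) := by
      unfold empMean
      rw [← mul_div_assoc, Finset.mul_sum]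
      gcongr with i
      by_cases h : x i ∈ Icc (p + θ) (q - θ)
      · rw [indicator_of_mem h]
        change η * 1 ≤ min (W₁ (x i)) (W₂ (x i))
        rw [a3 _ (hg.mem i) h.1, b3 _ (hg.mem i) h.2]; simp
      · rw [indicator_of_notMem h, mul_zero]
        exact le_min (a4 _ (hg.mem i)).1 (b4 _ (hg.mem i)).1
    have hcW : ContinuousOn (fun t => min (W₁ t) (W₂ t)) (Icc 0 R) := by
      have e1 : W₁ = fun t => (g t + W₁ t) - g t := by ext t; ring
      have e2 : W₂ = fun t => (g t + W₂ t) - g t := by ext t; ring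
      rw [e1, e2]
      exact (a1.cont.sub hg.adm.cont).inf (b1.cont.sub hg.adm.cont)
    have hup : ∫ t in Icc 0 R, min (W₁ t) (W₂ t) * Real.exp (g t)
        ≤ η * ∫ t in Icc 0 R, (Icc (p - θ) (q + θ)).indicator 1 t * Real.exp (g t) := by
      rw [← integral_const_mul]
      have hi : IntegrableOn (fun t => (Icc (p - θ) (q + θ)).indicator 1 t * Real.exp (g t))
          (Icc 0 R) := by
        have := hg.adm.integrableOn_exp.indicator (measurableSet_Icc (a := p - θ) (b := q + θ))
        refine this.congr (Eventually.of_forall fun t => ?_)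
        simp [indicator]
      refine setIntegral_mono_on
        (hcW.mul (Real.continuous_exp.comp_continuousOn hg.adm.cont)).integrableOn_Icc
        (hi.const_mul η) measurableSet_Icc fun t ht => ?_
      rw [← mul_assoc]
      refine mul_le_mul_of_nonneg_right ?_ (Real.exp_pos _).le
      by_cases h : t ∈ Icc (p - θ) (q + θ)
      · rw [indicator_of_mem h]; simpa using Or.inl (a4 t ht).2
      · rw [indicator_of_notMem h, mul_zero]
        rw [mem_Icc, not_and_or, not_le, not_le] at h
        rcases h with h | h
        · rw [a2 t ht h]; exact min_le_left _ _
        · rw [b2 t ht h]; exact min_le_right _ _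
    exact le_of_mul_le_mul_left (hlow.trans (htest.trans hup)) hη
  set θ : ℕ → ℝ := fun k => (q - p) / 3 / (k + 1)
  have h3 : 0 < (q - p) / 3 := by linarith
  have hθ : ∀ k, 0 < θ k := fun k => by positivity
  have hθle : ∀ k, θ k ≤ (q - p) / 3 :=
    fun k => div_le_self h3.le (by linarith [k.cast_nonneg (α := ℝ)])
  have hθlim : Tendsto θ atTop (𝓝 0) := by
    have := (tendsto_one_div_add_atTop_nhds_zero_nat (𝕜 := ℝ)).const_mul ((q - p) / 3)
    simpa [θ, div_eq_mul_inv] using this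
  refine le_of_tendsto_of_tendsto' (hg.tendsto_empMean (h := fun k =>
    (Icc (p + θ k) (q - θ k)).indicator 1) fun t _ => ?_)
    (hg.tendsto_integral_mul_exp (h := fun k => (Icc (p - θ k) (q + θ k)).indicator 1) (K := 1)
      (fun k => ?_) (fun k t _ => ?_) fun t _ => ?_) fun k => key (θ k) (hθ k) ?_
  · by_cases h : t ∈ Ioo p q
    · refine tendsto_const_nhds.congr' ?_
      filter_upwards [hθlim.eventually (gt_mem_nhds (sub_pos.2 h.1)),
        hθlim.eventually (gt_mem_nhds (sub_pos.2 h.2))] with k h1 h2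
      rw [indicator_of_mem h, indicator_of_mem]
      exact ⟨by linarith, by linarith⟩
    · have : ∀ k, (Icc (p + θ k) (q - θ k)).indicator (1 : ℝ → ℝ) t = 0 := fun k => by
        refine indicator_of_notMem (fun hk => h ?_) _
        exact ⟨by linarith [hk.1, hθ k], by linarith [hk.2, hθ k]⟩
      simp only [this, indicator_of_notMem h]
      exact tendsto_const_nhds
  · exact (measurable_one.indicator measurableSet_Icc).aestronglyMeasurable
  · by_cases h : t ∈ Icc (p - θ k) (q + θ k)
    · simp [indicator_of_mem h]
    · simp [indicator_of_notMem h]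
  · by_cases h : t ∈ Icc p q
    · have : ∀ k, (Icc (p - θ k) (q + θ k)).indicator (1 : ℝ → ℝ) t = 1 := fun k => by
        rw [indicator_of_mem]; · rfl
        exact ⟨by linarith [h.1, hθ k], by linarith [h.2, hθ k]⟩
      simp only [this, indicator_of_mem h]
      exact tendsto_const_nhds
    · rw [indicator_of_notMem h]
      refine tendsto_const_nhds.congr' ?_
      rw [mem_Icc, not_and_or, not_le, not_le] at h
      rcases h with h | h
      · filter_upwards [hθlim.eventually (gt_mem_nhds (sub_pos.2 h))] with k h1
        rw [indicator_of_notMem]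
        exact fun hk => by linarith [hk.1]
      · filter_upwards [hθlim.eventually (gt_mem_nhds (sub_pos.2 h))] with k h1
        rw [indicator_of_notMem]
        exact fun hk => by linarith [hk.2]
  · linarith [hθle k]

/-! ### Typical samples and fluctuations of empirical means -/

/-- If the superlevel sets of `h : ℝ → [0, H]` have nearly the same mass under two finite measures,
then `h` has nearly the same integral under them. -/
lemma abs_integral_sub_integral_le {ν μ : Measure ℝ} [IsFiniteMeasure ν] [IsFiniteMeasure μ]
    {h b : ℝ → ℝ} {H : ℝ} (hm : Measurable h) (h0 : ∀ t, 0 ≤ h t)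
    (hle : ∀ t, h t ≤ H) (hb : IntegrableOn b (Ioc 0 H))
    (hdev : ∀ s ∈ Ioc 0 H, |ν.real {t | s ≤ h t} - μ.real {t | s ≤ h t}| ≤ b s) :
    |∫ t, h t ∂ν - ∫ t, h t ∂μ| ≤ ∫ s in Ioc 0 H, b s := by
  have hint : ∀ (κ : Measure ℝ) [IsFiniteMeasure κ], Integrable h κ := fun κ _ =>
    Integrable.of_bound hm.aestronglyMeasurable H (Eventually.of_forall fun t => by
      rw [Real.norm_eq_abs, abs_of_nonneg (h0 t)]; exact hle t)
  have hanti : ∀ (κ : Measure ℝ) [IsFiniteMeasure κ],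
      IntegrableOn (fun s => κ.real {t | s ≤ h t}) (Ioc 0 H) := fun κ _ => by
    have : Antitone (fun s => κ.real {t | s ≤ h t}) := fun s s' hss =>
      measureReal_mono (fun t ht => hss.trans ht) (measure_ne_top _ _)
    exact ((this.antitoneOn _).integrableOn_isCompact (isCompact_Icc (a := 0) (b := H))).mono_set
      Ioc_subset_Icc_self
  rw [(hint ν).integral_eq_integral_Ioc_meas_le (Eventually.of_forall h0) (Eventually.of_forall hle),
    (hint μ).integral_eq_integral_Ioc_meas_le (Eventually.of_forall h0) (Eventually.of_forall hle),
    ← integral_sub (hanti ν) (hanti μ)]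
  refine (abs_integral_le_integral_abs).trans ?_
  exact setIntegral_mono_on ((hanti ν).sub (hanti μ)).abs hb measurableSet_Ioc hdev

/-- What is needed of a sample from `f` at the noise level `ρ`: the sample lies in `[0, R]`, with
`R` at most `1 / √ρ`, and the empirical mass of every interval is close to its mass under `f`, with
an error of the order of the standard deviation up to the factor `ρ` in place of `1 / n`. The
constants are an upper bound `A` and a lower bound `m` for `f`, the latter on `[0, B]`. The fourth
power in the tail bound makes the square root of the tail mass integrable. -/
structure IsTypical {n : ℕ} (x : Fin n → ℝ) (R : ℝ) (f : ℝ → ℝ) (ρ A m B : ℝ) : Prop where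
  ne_zero : n ≠ 0
  one_le : 1 ≤ A
  m_pos : 0 < m
  m_le : m ≤ 1
  rho_pos : 0 < ρ
  B_le : B ≤ R
  R_sq : ρ * R ^ 2 ≤ 1
  mem : ∀ i, x i ∈ Icc 0 R
  pos : ∀ t ∈ Icc 0 R, 0 < f t
  le : ∀ t ∈ Icc 0 R, f t ≤ A
  ge : ∀ t ∈ Icc 0 B, m ≤ f t
  antitone : AntitoneOn f (Icc 0 R)
  logConcave : ConcaveOn ℝ (Icc 0 R) (fun t => Real.log (f t))
  tail : ∀ t ∈ Icc 0 R, ∫ y in Icc t R, f y ≤ A / (1 + t) ^ 4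
  dev : ∀ J ⊆ Icc 0 R, J.OrdConnected →
    |empMean x (J.indicator 1) - ∫ y in J, f y| ≤ A * (√(ρ * ∫ y in J, f y) + ρ)

namespace IsTypical
variable {n : ℕ} {x : Fin n → ℝ} {R : ℝ} {f : ℝ → ℝ} {ρ A m B : ℝ}

lemma integrableOn (hx : IsTypical x R f ρ A m B) : IntegrableOn f (Icc 0 R) :=
  hx.antitone.integrableOn_isCompact isCompact_Icc

lemma mass_mono (hx : IsTypical x R f ρ A m B) {J J' : Set ℝ} (h : J ⊆ J') (h' : J' ⊆ Icc 0 R)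
    (hm : MeasurableSet J') : ∫ y in J, f y ≤ ∫ y in J', f y := by
  refine setIntegral_mono_set (hx.integrableOn.mono_set h') ?_ h.eventuallyLE
  filter_upwards [ae_restrict_mem hm] with t ht using (hx.pos t (h' ht)).le

lemma mass_Icc_le (hx : IsTypical x R f ρ A m B) {u v : ℝ} (hu : 0 ≤ u) (huv : u ≤ v)
    (hv : v ≤ R) : ∫ y in Icc u v, f y ≤ A * (v - u) := by
  have hsub : Icc u v ⊆ Icc 0 R := Icc_subset_Icc hu hv
  have : ∫ y in Icc u v, f y ≤ ∫ y in Icc u v, A :=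
    setIntegral_mono_on (hx.integrableOn.mono_set hsub) (by simp) measurableSet_Icc
      fun t ht => hx.le t (hsub ht)
  refine this.trans (le_of_eq ?_)
  simp [huv, mul_comm]

lemma mass_Icc_le_const (hx : IsTypical x R f ρ A m B) {u v : ℝ} (hu : 0 ≤ u)
    (hv : v ≤ R) (hR : 0 ≤ R) : ∫ y in Icc u v, f y ≤ A := by
  have := hx.tail 0 (left_mem_Icc.2 hR)
  simp only [add_zero, one_pow, div_one] at this
  exact (hx.mass_mono (Icc_subset_Icc hu hv) le_rfl measurableSet_Icc).trans this

/-- Empirical minus true mean of a function `h ≥ 0` that lives on `[0, R]`, in terms of the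
superlevel sets of `h`. -/
lemma abs_empMean_sub_le_integral (hx : IsTypical x R f ρ A m B) {h : ℝ → ℝ} {H : ℝ} {b : ℝ → ℝ}
    (h0 : ∀ t, 0 ≤ h t) (hle : ∀ t, h t ≤ H) (hoff : ∀ t, t ∉ Icc 0 R → h t = 0)
    (hconv : ∀ s > 0, {t | s ≤ h t}.OrdConnected) (hb : IntegrableOn b (Ioc 0 H))
    (hdev : ∀ s ∈ Ioc 0 H, A * (√(ρ * ∫ y in {t | s ≤ h t}, f y) + ρ) ≤ b s) :
    |empMean x h - ∫ t in Icc 0 R, h t * f t| ≤ ∫ s in Ioc 0 H, b s := by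
  have hn : (n : ℝ) ≠ 0 := by exact_mod_cast hx.ne_zero
  have hm : Measurable h := measurable_of_Ici fun s => by
    rcases le_or_gt s 0 with hs | hs
    · have : h ⁻¹' Ici s = univ := by ext t; simpa using hs.trans (h0 t)
      rw [this]; exact MeasurableSet.univ
    · exact (hconv s hs).measurableSet
  set ν : Measure ℝ := (n : ℝ≥0∞)⁻¹ • ∑ i, Measure.dirac (x i) with hν
  set μ : Measure ℝ := (volume.restrict (Icc 0 R)).withDensity fun t => ENNReal.ofReal (f t) with hμ
  have hninv : (n : ℝ≥0∞)⁻¹ ≠ ⊤ := by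
    rw [Ne, ENNReal.inv_eq_top]; exact_mod_cast hx.ne_zero
  have hνfin : IsFiniteMeasure ν := by
    rw [hν]; exact Measure.smul_finite _ hninv
  have hμfin : IsFiniteMeasure μ :=
    isFiniteMeasure_withDensity_ofReal hx.integrableOn.2
  have hνint : ∀ k : ℝ → ℝ, Measurable k → ∫ t, k t ∂ν = empMean x k := fun k hk => by
    rw [hν, integral_smul_measure, integral_finsetSum_measure]
    · simp [empMean, div_eq_inv_mul]
    · intro i _; exact integrable_dirac (by simp [enorm_lt_top])
  have hμint : ∀ k : ℝ → ℝ, ∫ t, k t ∂μ = ∫ t in Icc 0 R, k t * f t := fun k => by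
    rw [hμ, integral_withDensity_eq_integral_toReal_smul₀
      hx.integrableOn.aestronglyMeasurable.aemeasurable.ennreal_ofReal
      (Eventually.of_forall fun _ => ENNReal.ofReal_lt_top)]
    refine setIntegral_congr_fun measurableSet_Icc fun t ht => ?_
    simp only [smul_eq_mul, ENNReal.toReal_ofReal (hx.pos t ht).le]
    ring
  rw [← hνint h hm, ← hμint h]
  refine abs_integral_sub_integral_le hm h0 hle hb fun s hs => ?_
  have hS := hconv s hs.1
  have hSR : {t | s ≤ h t} ⊆ Icc 0 R := fun t ht => by
    by_contra hcon
    have := hoff t hcon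
    simp only [mem_ofPred_eq] at ht
    linarith [hs.1]
  have e1 : ν.real {t | s ≤ h t} = empMean x ({t | s ≤ h t}.indicator 1) := by
    rw [← integral_indicator_one hS.measurableSet,
      hνint _ (measurable_one.indicator hS.measurableSet)]
  have e2 : μ.real {t | s ≤ h t} = ∫ y in {t | s ≤ h t}, f y := by
    rw [← integral_indicator_one hS.measurableSet, hμint]
    have : ∀ t, ({t | s ≤ h t}.indicator 1 t : ℝ) * f t = {t | s ≤ h t}.indicator f t := fun t => by
      by_cases ht : t ∈ {t | s ≤ h t}
      · rw [indicator_of_mem ht, indicator_of_mem ht]; simp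
      · rw [indicator_of_notMem ht, indicator_of_notMem ht]; simp
    simp only [this]
    rw [setIntegral_indicator hS.measurableSet, inter_eq_right.2 hSR]
  rw [e1, e2]
  exact (hx.dev _ hSR hS).trans (hdev s hs)

/-- Empirical minus true mean of a unimodal function with values in `[0, H]` that lives on an
interval `[u, v]` of mass at most `M`. -/
lemma abs_empMean_sub_le (hx : IsTypical x R f ρ A m B) {u v H M : ℝ} {k : ℝ → ℝ} (hu : 0 ≤ u)
    (hv : v ≤ R) (hH : 0 ≤ H) (hk : QuasiconcaveOn ℝ (Icc u v) k)
    (hk0 : ∀ t ∈ Icc u v, 0 ≤ k t) (hkH : ∀ t ∈ Icc u v, k t ≤ H)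
    (hM : ∫ y in Icc u v, f y ≤ M) :
    |empMean x ((Icc u v).indicator k) - ∫ t in Icc 0 R, (Icc u v).indicator k t * f t|
      ≤ H * (A * (√(ρ * M) + ρ)) := by
  have hsub : Icc u v ⊆ Icc 0 R := Icc_subset_Icc hu hv
  have hlev : ∀ s > 0, {t | s ≤ (Icc u v).indicator k t} = {t ∈ Icc u v | s ≤ k t} := by
    intro s hs
    ext t
    by_cases ht : t ∈ Icc u v
    · simp only [mem_ofPred_eq, indicator_of_mem ht, ht, true_and]
    · simp only [mem_ofPred_eq, indicator_of_notMem ht, ht, false_and, iff_false, not_le, hs]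
  have := hx.abs_empMean_sub_le_integral (h := (Icc u v).indicator k) (H := H)
    (b := fun _ => A * (√(ρ * M) + ρ))
    (fun t => indicator_nonneg hk0 t)
    (fun t => by
      by_cases ht : t ∈ Icc u v
      · rw [indicator_of_mem ht]; exact hkH t ht
      · rw [indicator_of_notMem ht]; exact hH)
    (fun t ht => indicator_of_notMem (fun h => ht (hsub h)) _)
    (fun s hs => by rw [hlev s hs]; exact (hk s).ordConnected)
    (integrableOn_const measure_Ioc_lt_top.ne)
    (fun s hs => by
      rw [hlev s hs.1]
      have h1 : ∫ y in {t ∈ Icc u v | s ≤ k t}, f y ≤ M :=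
        (hx.mass_mono (fun t ht => ht.1) hsub measurableSet_Icc).trans hM
      have := hx.one_le
      have := hx.rho_pos
      gcongr)
  refine this.trans (le_of_eq ?_)
  simp [hH]

lemma integral_inv_sq_le {H : ℝ} (hH : 0 ≤ H) : ∫ s in Ioc 0 H, 1 / (1 + s) ^ 2 ≤ 1 := by
  rw [← intervalIntegral.integral_of_le hH]
  have hpos : ∀ s ∈ uIcc 0 H, (1 + s) ≠ 0 := fun s hs => by
    rw [uIcc_of_le hH] at hs; linarith [hs.1]
  have : ∫ s in (0 : ℝ)..H, 1 / (1 + s) ^ 2 = -(1 / (1 + H)) - -(1 / (1 + 0)) := by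
    refine intervalIntegral.integral_eq_sub_of_hasDerivAt (f := fun s => -(1 / (1 + s)))
      (fun s hs => ?_) ?_
    · have h1 : HasDerivAt (fun s : ℝ => 1 + s) 1 s := (hasDerivAt_id s).const_add 1
      have h2 := (h1.inv (hpos s hs)).neg
      convert h2 using 1
      · ext s; simp
      · ring
    · refine ContinuousOn.intervalIntegrable ?_
      exact continuousOn_const.div (by fun_prop) fun s hs => pow_ne_zero 2 (hpos s hs)
  rw [this]
  have : 0 ≤ 1 / (1 + H) := by positivity
  linarith

/-- Empirical minus true mean of `t ↦ (t - v)` on `[v, q]`, an interval of arbitrary length. The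
main term is controlled by the tail of `f`, the term `ρ * (q - v)` by `R ≤ 1 / √ρ`. -/
lemma abs_empMean_sub_le_tail (hx : IsTypical x R f ρ A m B) {v q : ℝ} (hv : 0 ≤ v) (hvq : v ≤ q)
    (hq : q ≤ R) :
    |empMean x ((Icc v q).indicator fun t => t - v)
      - ∫ t in Icc 0 R, (Icc v q).indicator (fun t => t - v) t * f t| ≤ 2 * A ^ 2 * √ρ := by
  have hsub : Icc v q ⊆ Icc 0 R := Icc_subset_Icc hv hq
  have hA := hx.one_le
  have hρ := hx.rho_pos
  set H := q - v
  have hH : 0 ≤ H := sub_nonneg.2 hvq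
  have hlev : ∀ s > 0, {t | s ≤ (Icc v q).indicator (fun t => t - v) t} = Icc (v + s) q := by
    intro s hs
    ext t
    by_cases ht : t ∈ Icc v q
    · simp only [mem_ofPred_eq, indicator_of_mem ht, mem_Icc]
      exact ⟨fun h => ⟨by linarith, ht.2⟩, fun h => by linarith [h.1]⟩
    · simp only [mem_ofPred_eq, indicator_of_notMem ht, mem_Icc]
      exact ⟨fun h => by linarith, fun h => absurd ⟨by linarith [h.1], h.2⟩ ht⟩
  have hbint : IntegrableOn (fun s : ℝ => 1 / (1 + s) ^ 2) (Ioc 0 H) := by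
    refine (ContinuousOn.integrableOn_Icc ?_).mono_set Ioc_subset_Icc_self
    exact continuousOn_const.div (by fun_prop) fun s hs => pow_ne_zero 2 (by linarith [hs.1])
  have hcint : IntegrableOn (fun _ : ℝ => ρ) (Ioc 0 H) := by simp
  have hbint2 : IntegrableOn (fun s => A * √ρ * (1 / (1 + s) ^ 2) + ρ) (Ioc 0 H) :=
    (hbint.const_mul (A * √ρ)).add hcint
  have := hx.abs_empMean_sub_le_integral (h := (Icc v q).indicator fun t => t - v) (H := H)
    (b := fun s => A * (A * √ρ * (1 / (1 + s) ^ 2) + ρ))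
    (fun t => indicator_nonneg (fun t ht => sub_nonneg.2 ht.1) t)
    (fun t => by
      by_cases ht : t ∈ Icc v q
      · rw [indicator_of_mem ht]; linarith [ht.2]
      · rw [indicator_of_notMem ht]; exact hH)
    (fun t ht => indicator_of_notMem (fun h => ht (hsub h)) _)
    (fun s hs => by rw [hlev s hs]; exact ordConnected_Icc)
    (hbint2.const_mul A)
    (fun s hs => by
      rw [hlev s hs.1]
      have h0 : v + s ≤ q := by linarith [hs.2]
      have h1 : ∫ y in Icc (v + s) q, f y ≤ A / (1 + s) ^ 4 := by
        have h2 : Icc (v + s) R ⊆ Icc 0 R := Icc_subset_Icc_left (by linarith [hs.1])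
        refine (hx.mass_mono (Icc_subset_Icc_right hq) h2 measurableSet_Icc).trans ?_
        refine (hx.tail (v + s) ⟨by linarith [hs.1], h0.trans hq⟩).trans ?_
        have := hs.1
        gcongr
        linarith
      have h2 : √(ρ * ∫ y in Icc (v + s) q, f y) ≤ A * √ρ * (1 / (1 + s) ^ 2) := by
        rw [Real.sqrt_le_left (by have := hs.1; positivity)]
        have h3 : (A * √ρ * (1 / (1 + s) ^ 2)) ^ 2 = ρ * (A ^ 2 / (1 + s) ^ 4) := by
          rw [mul_pow, mul_pow, Real.sq_sqrt hρ.le, div_pow, one_pow, ← pow_mul]; ring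
        rw [h3]
        have h4 : A ≤ A ^ 2 := by nlinarith
        have : A / (1 + s) ^ 4 ≤ A ^ 2 / (1 + s) ^ 4 := by have := hs.1; gcongr
        exact mul_le_mul_of_nonneg_left (h1.trans this) hρ.le
      gcongr)
  refine this.trans ?_
  rw [integral_const_mul, integral_add (hbint.const_mul _) hcint, integral_const_mul]
  have h5 := integral_inv_sq_le hH
  have h6 : ∫ s in Ioc 0 H, ρ = ρ * H := by simp [hH, mul_comm]
  rw [h6]
  have h7 : ρ * H ≤ √ρ := by
    have hHR : H ≤ R := by simp only [H]; linarith
    refine Real.le_sqrt_of_sq_le ?_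
    calc (ρ * H) ^ 2 = ρ * (ρ * H ^ 2) := by ring
      _ ≤ ρ * (ρ * R ^ 2) := by gcongr
      _ ≤ ρ * 1 := by gcongr; exact hx.R_sq
      _ = ρ := mul_one _
  have h8 : 0 ≤ √ρ := Real.sqrt_nonneg _
  calc A * (A * √ρ * (∫ s in Ioc 0 H, 1 / (1 + s) ^ 2) + ρ * H)
      ≤ A * (A * √ρ * 1 + √ρ) := by gcongr
    _ ≤ A * (A * √ρ * 1 + A * √ρ) := by gcongr; nlinarith
    _ = 2 * A ^ 2 * √ρ := by ring

/-- A lower bound for integrals against `f`. -/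
lemma le_integral_mul (hx : IsTypical x R f ρ A m B) {h : ℝ → ℝ} {i j κ : ℝ} (hi : 0 ≤ i)
    (hij : i ≤ j) (hj : j ≤ B) (h0 : ∀ t ∈ Icc 0 R, 0 ≤ h t)
    (hh : ∀ t ∈ Icc i j, κ ≤ h t) (hint : IntegrableOn (fun t => h t * f t) (Icc 0 R)) :
    m * κ * (j - i) ≤ ∫ t in Icc 0 R, h t * f t := by
  have hsub : Icc i j ⊆ Icc 0 R := Icc_subset_Icc hi (hj.trans hx.B_le)
  have h1 : ∫ t in Icc i j, m * κ ≤ ∫ t in Icc i j, h t * f t := by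
    refine setIntegral_mono_on (integrableOn_const measure_Icc_lt_top.ne) (hint.mono_set hsub)
      measurableSet_Icc fun t ht => ?_
    rw [mul_comm m]
    exact mul_le_mul (hh t ht) (hx.ge t ⟨hi.trans ht.1, ht.2.trans hj⟩) hx.m_pos.le (h0 t (hsub ht))
  have h2 : ∫ t in Icc i j, h t * f t ≤ ∫ t in Icc 0 R, h t * f t := by
    refine setIntegral_mono_set hint ?_ hsub.eventuallyLE
    filter_upwards [ae_restrict_mem measurableSet_Icc] with t ht
    exact mul_nonneg (h0 t ht) (hx.pos t ht).le
  have h3 : ∫ t in Icc i j, m * κ = m * κ * (j - i) := by simp [hij, mul_comm]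
  linarith

end IsTypical

/-! ### Errors of constant sign: an excess, and a deficit where the fit is not affine -/

lemma integrableOn_indicator_mul {R : ℝ} {w k : ℝ → ℝ} (hw : IntegrableOn w (Icc 0 R))
    (hk : ContinuousOn k (Icc 0 R)) (u v : ℝ) :
    IntegrableOn (fun t => (Icc u v).indicator k t * w t) (Icc 0 R) := by
  have h1 : IntegrableOn (fun t => k t * w t) (Icc 0 R) :=
    hw.continuousOn_mul hk isCompact_Icc
  refine (h1.indicator (measurableSet_Icc (a := u) (b := v))).congr (Eventually.of_forall fun t => ?_)
  by_cases h : t ∈ Icc u v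
  · simp only [indicator_of_mem h]
  · simp only [indicator_of_notMem h, zero_mul]

/-- The bound on `ε` that comes from comparing a gain `ε * ℓ` with a fluctuation of the order
`√(ρ * ℓ)`. -/
lemma sq_mul_le_of_gain_le {ε m ℓ A ρ : ℝ} (hm : 0 < m) (hA : 1 ≤ A) (hρ : 0 < ρ)
    (hρℓ : ρ ≤ ℓ) (hε : 0 < ε) (h : ε * m * ℓ / 8 ≤ A * (√(ρ * (A * ℓ)) + ρ)) :
    ε ^ 2 * ℓ ≤ (16 * A ^ 2 / m) ^ 2 * ρ := by
  have hℓ : 0 < ℓ := hρ.trans_le hρℓ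
  set a := √ρ
  set b := √ℓ
  have ha : 0 ≤ a := Real.sqrt_nonneg _
  have hb : 0 < b := Real.sqrt_pos.2 hℓ
  have ha2 : a ^ 2 = ρ := Real.sq_sqrt hρ.le
  have hb2 : b ^ 2 = ℓ := Real.sq_sqrt hℓ.le
  have hab : a ≤ b := Real.sqrt_le_sqrt hρℓ
  have h1 : √(ρ * (A * ℓ)) ≤ A * a * b := by
    rw [Real.sqrt_le_left (by positivity), ← ha2, ← hb2]
    have : A ≤ A ^ 2 := by nlinarith
    calc a ^ 2 * (A * b ^ 2) ≤ a ^ 2 * (A ^ 2 * b ^ 2) := by gcongr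
      _ = _ := by ring
  have h2 : ρ ≤ A * a * b := by
    rw [← ha2]
    calc a ^ 2 = 1 * a * a := by ring
      _ ≤ A * a * b := by gcongr
  have h3 : b * (ε * m * b) ≤ b * (16 * A ^ 2 * a) := by
    have : ε * m * ℓ / 8 ≤ A * (A * a * b + A * a * b) := h.trans (by gcongr)
    rw [← hb2] at this
    nlinarith
  have h4 : ε * b ≤ 16 * A ^ 2 / m * a := by
    have := le_of_mul_le_mul_left h3 hb
    rw [div_mul_eq_mul_div, le_div_iff₀ hm]; linarith
  calc ε ^ 2 * ℓ = (ε * b) ^ 2 := by rw [mul_pow, hb2]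
    _ ≤ (16 * A ^ 2 / m * a) ^ 2 := by gcongr
    _ = _ := by rw [mul_pow, ha2]

lemma exp_neg_le_one_sub_half {y : ℝ} (h0 : 0 ≤ y) (h1 : y ≤ 1) : Real.exp (-y) ≤ 1 - y / 2 := by
  rw [Real.exp_neg, inv_le_iff_one_le_mul₀ (Real.exp_pos y)]
  have h2 := Real.add_one_le_exp y
  have h3 : (1 - y / 2) * (y + 1) ≤ (1 - y / 2) * Real.exp y :=
    mul_le_mul_of_nonneg_left h2 (by linarith)
  nlinarith

section Deviations
variable {n : ℕ} {x : Fin n → ℝ} {R : ℝ} {f g : ℝ → ℝ} {ρ A m B ε : ℝ}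

lemma empMean_congr {h h' : ℝ → ℝ} (hx : ∀ i, x i ∈ Icc 0 R) (h1 : ∀ t ∈ Icc 0 R, h t = h' t) :
    empMean x h = empMean x h' := by
  unfold empMean
  rw [Finset.sum_congr rfl fun i _ => h1 (x i) (hx i)]

/-- The gain of a test function that lives where `exp g` exceeds `f`. -/
lemma gain_of_le (hx : IsTypical x R f ρ A m B) (hg : IsFit x R g) {u v : ℝ} {k : ℝ → ℝ}
    (hk : ContinuousOn k (Icc 0 R)) (hk0 : ∀ t ∈ Icc u v, 0 ≤ k t)
    (hD : ∀ t ∈ Icc u v, Real.log (f t) + ε ≤ g t)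
    (htest : ∫ t in Icc 0 R, (Icc u v).indicator k t * Real.exp (g t)
      ≤ empMean x ((Icc u v).indicator k)) :
    ε * ∫ t in Icc 0 R, (Icc u v).indicator k t * f t ≤
      |empMean x ((Icc u v).indicator k) - ∫ t in Icc 0 R, (Icc u v).indicator k t * f t| := by
  refine le_trans ?_ (le_abs_self _)
  have hint := integrableOn_indicator_mul hx.integrableOn hk u v
  have h1 : (1 + ε) * ∫ t in Icc 0 R, (Icc u v).indicator k t * f t
      ≤ ∫ t in Icc 0 R, (Icc u v).indicator k t * Real.exp (g t) := by
    rw [← integral_const_mul]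
    refine setIntegral_mono_on (hint.const_mul _)
      (integrableOn_indicator_mul hg.adm.integrableOn_exp hk u v) measurableSet_Icc fun t ht => ?_
    by_cases h : t ∈ Icc u v
    · rw [indicator_of_mem h]
      have hf := hx.pos t ht
      have h2 : (1 + ε) * f t ≤ Real.exp (g t) := by
        calc (1 + ε) * f t ≤ Real.exp ε * f t := by
              gcongr; linarith [Real.add_one_le_exp ε]
          _ = Real.exp (Real.log (f t) + ε) := by rw [Real.exp_add, Real.exp_log hf]; ring
          _ ≤ _ := Real.exp_le_exp.2 (hD t h)
      have := mul_le_mul_of_nonneg_left h2 (hk0 t h)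
      linarith
    · rw [indicator_of_notMem h]; simp
  linarith

/-- The fit exceeds `f` on an interval where it is not affine: cut it off by its chord. -/
lemma gain_le_of_not_affOn (hx : IsTypical x R f ρ A m B) (hg : IsFit x R g) {c d : ℝ}
    (hε : 0 < ε) (hc : 0 ≤ c) (hcd : c < d) (hd : d ≤ B)
    (hD : ∀ t ∈ Icc c d, Real.log (f t) + ε ≤ g t) (hna : ¬ AffOn g c d) :
    ε * m * (d - c) / 8 ≤ A * (√(ρ * (A * (d - c))) + ρ) := by
  have hdR := hd.trans hx.B_le
  have hcI : c ∈ Icc 0 R := ⟨hc, hcd.le.trans hdR⟩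
  have hdI : d ∈ Icc 0 R := ⟨hc.trans hcd.le, hdR⟩
  have hsub : Icc c d ⊆ Icc 0 R := Icc_subset_Icc hc hdR
  have hdc : 0 < d - c := sub_pos.2 hcd
  set s := (g d - g c) / (d - c) with hs
  have hsd : s * (d - c) = g d - g c := div_mul_cancel₀ _ hdc.ne'
  have hs0 : s ≤ 0 := div_nonpos_of_nonpos_of_nonneg
    (sub_nonpos.2 (hg.adm.antitone hcI hdI hcd.le)) hdc.le
  set k : ℝ → ℝ := fun t => g t - (g c + s * (t - c)) with hk
  have hkcont : ContinuousOn k (Icc 0 R) := hg.adm.cont.sub (by fun_prop)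
  have hkconc : ConcaveOn ℝ (Icc 0 R) k := by
    have h1 : ConvexOn ℝ (Icc 0 R) (fun t => g c + s * (t - c)) :=
      ⟨convex_Icc _ _, fun x _ y _ a b _ _ hab => by
        simp only [smul_eq_mul]
        have : a = 1 - b := by linarith
        subst this; apply le_of_eq; ring⟩
    exact hg.adm.concave.sub h1
  have hkc : k c = 0 := by simp [hk]
  have hkd : k d = 0 := by simp only [hk]; linarith
  have hkin : ∀ t ∈ Icc c d, 0 ≤ k t := fun t ht => by
    have := hkconc.chord_le hcI hdI ht.1 ht.2
    rw [hkc, hkd] at this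
    simp only [mul_zero, add_zero] at this
    exact nonneg_of_mul_nonneg_right this hdc
  have hkout : ∀ t ∈ Icc 0 R, t ∉ Icc c d → k t ≤ 0 := fun t ht h => by
    rw [mem_Icc, not_and_or, not_le, not_le] at h
    rcases h with h | h
    · have := hkconc.chord_le ht hdI h.le hcd.le
      rw [hkc, hkd] at this
      nlinarith
    · have := hkconc.chord_le hcI ht hcd.le h.le
      rw [hkc, hkd] at this
      nlinarith
  have heq : ∀ t ∈ Icc 0 R, max (k t) 0 = (Icc c d).indicator k t := fun t ht => by
    by_cases h : t ∈ Icc c d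
    · rw [indicator_of_mem h, max_eq_left (hkin t h)]
    · rw [indicator_of_notMem h, max_eq_right (hkout t ht h)]
  have htest := hg.le_empMean_of_dent hx.ne_zero (IsAdm.affine R (g c) c s hs0)
  have htest' : ∫ t in Icc 0 R, (Icc c d).indicator k t * Real.exp (g t)
      ≤ empMean x ((Icc c d).indicator k) := by
    rw [← empMean_congr hx.mem heq]
    refine le_trans (le_of_eq ?_) htest
    refine setIntegral_congr_fun measurableSet_Icc fun t ht => ?_
    rw [← heq t ht]
  have hgain := gain_of_le hx hg hkcont hkin hD htest'
  obtain ⟨t₁, ht₁, hmax⟩ := isCompact_Icc.exists_isMaxOn (nonempty_Icc.2 hcd.le) (hkcont.mono hsub)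
  set H := k t₁ with hH
  have hHpos : 0 < H := by
    by_contra hcon
    refine hna ⟨s, fun t ht => ?_⟩
    have h1 : k t ≤ H := hmax ht
    have h2 := hkin t ht
    have h3 : k t = 0 := le_antisymm (h1.trans (not_lt.1 hcon)) h2
    simp only [hk] at h3; linarith
  have hfl := hx.abs_empMean_sub_le hc hdR hHpos.le
    ((hkconc.subset hsub (convex_Icc _ _)).quasiconcaveOn) hkin (fun t ht => hmax ht)
    (hx.mass_Icc_le hc hcd.le hdR)
  have hlow : m * H * (d - c) / 8 ≤ ∫ t in Icc 0 R, (Icc c d).indicator k t * f t := by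
    have hint := integrableOn_indicator_mul hx.integrableOn hkcont c d
    have h0 : ∀ t ∈ Icc 0 R, 0 ≤ (Icc c d).indicator k t := fun t _ => indicator_nonneg hkin t
    have hmH : 0 < m * H := mul_pos hx.m_pos hHpos
    rcases le_total ((d - c) / 2) (t₁ - c) with h | h
    · have := hx.le_integral_mul (i := (c + t₁) / 2) (j := t₁) (κ := H / 2) (by linarith)
        (by linarith) (ht₁.2.trans hd) h0 (fun t ht => by
          have ht' : t ∈ Icc c d := ⟨by linarith [ht.1], ht.2.trans ht₁.2⟩
          rw [indicator_of_mem ht']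
          have h1 := hkconc.chord_le hcI (hsub ht₁) ht'.1 ht.2
          rw [hkc, ← hH] at h1
          have h2 : 0 < t₁ - c := by linarith
          have h3 : (t₁ - c) / 2 * H ≤ (t - c) * H := by gcongr; linarith [ht.1]
          refine le_of_mul_le_mul_left ?_ h2
          linarith) hint
      nlinarith
    · have := hx.le_integral_mul (i := t₁) (j := (t₁ + d) / 2) (κ := H / 2) (hc.trans ht₁.1)
        (by linarith) (by linarith) h0 (fun t ht => by
          have ht' : t ∈ Icc c d := ⟨ht₁.1.trans ht.1, by linarith [ht.2]⟩
          rw [indicator_of_mem ht']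
          have h1 := hkconc.chord_le (hsub ht₁) hdI ht.1 ht'.2
          rw [hkd, ← hH] at h1
          have h2 : 0 < d - t₁ := by linarith
          have h3 : (d - t₁) / 2 * H ≤ (d - t) * H := by gcongr; linarith [ht.2]
          refine le_of_mul_le_mul_left ?_ h2
          linarith) hint
      nlinarith
  have hfin : H * (ε * m * (d - c) / 8) ≤ H * (A * (√(ρ * (A * (d - c))) + ρ)) := by
    refine le_trans ?_ (hgain.trans hfl)
    have := mul_le_mul_of_nonneg_left hlow hε.le
    linarith
  exact le_of_mul_le_mul_left hfin hHpos

/-- The fit exceeds `f` on an interval where it is affine. The excess persists in one of the two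
directions up to the end of the maximal affine piece, and the fit is tilted down on that side. -/
lemma sq_mul_le_of_affOn (hx : IsTypical x R f ρ A m B) (hg : IsFit x R g) {c d s τ : ℝ}
    (hε : 0 < ε) (hc : 0 ≤ c) (hcd : c < d) (hτ : 0 < τ) (hτ1 : τ ≤ 1) (hd : d + τ ≤ B)
    (hρd : ρ ≤ d - c) (hdτ : d - c ≤ τ)
    (hD : ∀ t ∈ Icc c d, Real.log (f t) + ε ≤ g t)
    (haff : ∀ t ∈ Icc c d, g t = g c + s * (t - c)) :
    ε ^ 2 * (d - c) ≤ (16 * A ^ 2 / (m * τ ^ 2)) ^ 2 * ρ := by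
  have hm := hx.m_pos
  have hA := hx.one_le
  have hρ := hx.rho_pos
  have hBR := hx.B_le
  have hdR : d ≤ R := by linarith
  have hdc : 0 < d - c := sub_pos.2 hcd
  have hcI : c ∈ Icc 0 R := ⟨hc, hcd.le.trans hdR⟩
  have hdI : d ∈ Icc 0 R := ⟨hc.trans hcd.le, hdR⟩
  have hgd := haff d (right_mem_Icc.2 hcd.le)
  have hs0 : s ≤ 0 := by
    have := hg.adm.antitone hcI hdI hcd.le
    by_contra h
    nlinarith [mul_pos (not_le.1 h) hdc]
  obtain ⟨p, q, hp0, hpc, hdq, hqR, hon, hoff⟩ :=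
    hg.adm.exists_maximal_affine hc hcd hdR haff
  have hconst : (16 * A ^ 2 / m) ^ 2 * ρ ≤ (16 * A ^ 2 / (m * τ ^ 2)) ^ 2 * ρ := by
    have : τ ^ 2 ≤ 1 := pow_le_one₀ hτ.le hτ1
    gcongr
    nlinarith
  have short : ∀ ℓ, d - c ≤ ℓ → ε * m * ℓ / 8 ≤ A * (√(ρ * (A * ℓ)) + ρ) →
      ε ^ 2 * (d - c) ≤ (16 * A ^ 2 / (m * τ ^ 2)) ^ 2 * ρ := fun ℓ hℓ h => by
    refine le_trans ?_ ((sq_mul_le_of_gain_le hm hA hρ (hρd.trans hℓ) hε h).trans hconst)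
    gcongr
  have hmax : ∀ v, ConcaveOn ℝ (Icc 0 R) (fun t => -max (t - v) 0) := fun v => by
    refine ConvexOn.neg (ConvexOn.sup ?_ (convexOn_const _ (convex_Icc _ _)))
    exact (convexOn_id (convex_Icc _ _)).sub (concaveOn_const _ (convex_Icc _ _))
  have hmax' : ∀ v, ConcaveOn ℝ (Icc 0 R) (fun t => -max (v - t) 0) := fun v => by
    refine ConvexOn.neg (ConvexOn.sup ?_ (convexOn_const _ (convex_Icc _ _)))
    exact (convexOn_const _ (convex_Icc _ _)).sub (concaveOn_id (convex_Icc _ _))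
  rcases le_or_gt (g c - Real.log (f c)) (g d - Real.log (f d)) with hdir | hdir
  · -- the excess does not decrease from `c` to `d`, hence not from `d` to `q`
    have hDq : ∀ t ∈ Icc c q, Real.log (f t) + ε ≤ g t := by
      intro t ht
      rcases le_total t d with h | h
      · exact hD t ⟨ht.1, h⟩
      · have htI : t ∈ Icc 0 R := ⟨hc.trans ht.1, ht.2.trans hqR⟩
        have h1 := hx.logConcave.chord_le hcI htI hcd.le h
        have h2 := hD d (right_mem_Icc.2 hcd.le)
        rw [hon t ⟨hpc.trans ht.1, ht.2⟩]
        have h3 : (t - d) * (g c - Real.log (f c)) ≤ (t - d) * (g d - Real.log (f d)) :=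
          mul_le_mul_of_nonneg_left hdir (sub_nonneg.2 h)
        refine le_of_mul_le_mul_left ?_ hdc
        have h4 : (d - c) * ε ≤ (d - c) * (g d - Real.log (f d)) :=
          mul_le_mul_of_nonneg_left (by linarith) hdc.le
        rw [hgd] at h3 h4
        nlinarith
    set k : ℝ → ℝ := fun t => t - c
    have hkcont : ContinuousOn k (Icc 0 R) := by fun_prop
    have hcq : c ≤ q := hcd.le.trans hdq
    have hkin : ∀ t ∈ Icc c q, 0 ≤ k t := fun t ht => sub_nonneg.2 ht.1
    have htest := hg.empMean_indicator_le hx.ne_zero (Δ := fun t => -max (t - c) 0) hon hoff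
      (hmax c) (by fun_prop) (fun t _ => neg_nonpos.2 (le_max_right _ _)) one_pos
      (fun η hη _ t _ t' _ htt' => by
        have h1 : max (t - c) 0 ≤ max (t' - c) 0 := max_le_max_right _ (by linarith)
        have h2 := mul_le_mul_of_nonneg_left h1 hη.le
        have h3 := mul_le_mul_of_nonpos_left (sub_le_sub_right htt' c) hs0
        simp only
        linarith)
    have heq : (Icc p q).indicator (fun t => -max (t - c) 0) = fun t => -(Icc c q).indicator k t := by
      ext t
      by_cases h : t ∈ Icc c q
      · rw [indicator_of_mem h, indicator_of_mem (Icc_subset_Icc_left hpc h), max_eq_left (hkin t h)]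
      · rw [indicator_of_notMem h]
        by_cases h' : t ∈ Icc p q
        · rw [indicator_of_mem h', max_eq_right]
          by_contra hcon
          exact h ⟨by linarith [not_le.1 hcon], h'.2⟩
        · rw [indicator_of_notMem h', neg_zero]
    rw [heq] at htest
    simp only [neg_mul, integral_neg, empMean, Finset.sum_neg_distrib, neg_div] at htest
    have hgain := gain_of_le hx hg hkcont hkin hDq (by unfold empMean; linarith)
    have hint := integrableOn_indicator_mul hx.integrableOn hkcont c q
    have hlow : ∀ l, 0 ≤ l → l ≤ q - c → c + l ≤ B →
        m * l ^ 2 / 4 ≤ ∫ t in Icc 0 R, (Icc c q).indicator k t * f t := fun l hl hlq hlB => by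
      have := hx.le_integral_mul (i := c + l / 2) (j := c + l) (κ := l / 2) (by linarith)
        (by linarith) hlB (fun t _ => indicator_nonneg hkin t) (fun t ht => by
          have ht' : t ∈ Icc c q := ⟨by linarith [ht.1], by linarith [ht.2]⟩
          rw [indicator_of_mem ht']
          simp only [k]; linarith [ht.1]) hint
      linarith
    rcases le_total (q - c) τ with hlen | hlen
    · set ℓ := q - c
      have hℓ : 0 < ℓ := by simp only [ℓ]; linarith
      refine short ℓ (by simp only [ℓ]; linarith) ?_
      have hfl := hx.abs_empMean_sub_le (H := ℓ) (k := k) hc hqR hℓ.le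
        (((concaveOn_id (convex_Icc _ _)).sub (convexOn_const _ (convex_Icc _ _))).quasiconcaveOn)
        hkin (fun t ht => by simp only [k, ℓ]; linarith [ht.2]) (hx.mass_Icc_le hc hcq hqR)
      have h1 := hlow ℓ hℓ.le le_rfl (by linarith)
      have h2 := mul_le_mul_of_nonneg_left h1 hε.le
      have h3 : ℓ * (ε * m * ℓ / 4) ≤ ℓ * (A * (√(ρ * (A * ℓ)) + ρ)) := by
        refine le_trans ?_ (hgain.trans hfl); linarith
      have h4 := le_of_mul_le_mul_left h3 hℓ
      have : 0 ≤ ε * m * ℓ := by positivity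
      linarith
    · have hfl := hx.abs_empMean_sub_le_tail hc hcq hqR
      have h1 := hlow τ hτ.le hlen (by linarith)
      have h2 := mul_le_mul_of_nonneg_left h1 hε.le
      have h3 : ε * (m * τ ^ 2) ≤ 16 * A ^ 2 * √ρ := by
        have : 0 ≤ A ^ 2 * √ρ := by positivity
        have := hgain.trans hfl
        linarith
      have h4 : ε ≤ 16 * A ^ 2 / (m * τ ^ 2) * √ρ := by
        rw [div_mul_eq_mul_div, le_div_iff₀ (by positivity)]; exact h3
      calc ε ^ 2 * (d - c) ≤ ε ^ 2 * 1 := by gcongr; linarith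
        _ ≤ (16 * A ^ 2 / (m * τ ^ 2) * √ρ) ^ 2 * 1 := by gcongr
        _ = _ := by rw [mul_pow, Real.sq_sqrt hρ.le, mul_one]
  · -- the excess decreases from `c` to `d`, hence also from `p` to `c`, and the fit is not constant
    have hs : s < 0 := by
      have hf : Real.log (f d) ≤ Real.log (f c) :=
        Real.log_le_log (hx.pos d hdI) (hx.antitone hcI hdI hcd.le)
      by_contra hcon
      have : 0 ≤ s * (d - c) := mul_nonneg (not_lt.1 hcon) hdc.le
      linarith
    have hDp : ∀ t ∈ Icc p d, Real.log (f t) + ε ≤ g t := by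
      intro t ht
      rcases le_total c t with h | h
      · exact hD t ⟨h, ht.2⟩
      · have htI : t ∈ Icc 0 R := ⟨hp0.trans ht.1, ht.2.trans hdR⟩
        have h1 := hx.logConcave.chord_le htI hdI h hcd.le
        have h2 := hD c (left_mem_Icc.2 hcd.le)
        rw [hon t ⟨ht.1, ht.2.trans hdq⟩]
        have h3 : (c - t) * (g d - Real.log (f d)) ≤ (c - t) * (g c - Real.log (f c)) :=
          mul_le_mul_of_nonneg_left hdir.le (sub_nonneg.2 h)
        refine le_of_mul_le_mul_left ?_ hdc
        have h4 : (d - c) * ε ≤ (d - c) * (g c - Real.log (f c)) :=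
          mul_le_mul_of_nonneg_left (by linarith) hdc.le
        rw [hgd] at h3
        nlinarith
    set k : ℝ → ℝ := fun t => d - t
    have hkcont : ContinuousOn k (Icc 0 R) := by fun_prop
    have hpd : p ≤ d := hpc.trans hcd.le
    have hkin : ∀ t ∈ Icc p d, 0 ≤ k t := fun t ht => sub_nonneg.2 ht.2
    have htest := hg.empMean_indicator_le hx.ne_zero (Δ := fun t => -max (d - t) 0) hon hoff
      (hmax' d) (by fun_prop) (fun t _ => neg_nonpos.2 (le_max_right _ _)) (neg_pos.2 hs)
      (fun η hη hηs t _ t' _ htt' => by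
        have h1 : max (d - t) 0 ≤ max (d - t') 0 + (t' - t) := by
          refine max_le ?_ ?_
          · linarith [le_max_left (d - t') 0]
          · linarith [le_max_right (d - t') 0]
        have h2 := mul_le_mul_of_nonneg_left h1 hη.le
        have h3 : (η + s) * (t' - t) ≤ 0 :=
          mul_nonpos_of_nonpos_of_nonneg (by linarith) (by linarith)
        simp only
        linarith)
    have heq : (Icc p q).indicator (fun t => -max (d - t) 0) = fun t => -(Icc p d).indicator k t := by
      ext t
      by_cases h : t ∈ Icc p d
      · rw [indicator_of_mem h, indicator_of_mem (Icc_subset_Icc_right hdq h), max_eq_left (hkin t h)]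
      · rw [indicator_of_notMem h]
        by_cases h' : t ∈ Icc p q
        · rw [indicator_of_mem h', max_eq_right]
          by_contra hcon
          exact h ⟨h'.1, by linarith [not_le.1 hcon]⟩
        · rw [indicator_of_notMem h', neg_zero]
    rw [heq] at htest
    simp only [neg_mul, integral_neg, empMean, Finset.sum_neg_distrib, neg_div] at htest
    have hgain := gain_of_le hx hg hkcont hkin hDp (by unfold empMean; linarith)
    have hint := integrableOn_indicator_mul hx.integrableOn hkcont p d
    set ℓ := d - p
    have hℓ : 0 < ℓ := by simp only [ℓ]; linarith
    have hlow : m * ℓ ^ 2 / 4 ≤ ∫ t in Icc 0 R, (Icc p d).indicator k t * f t := by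
      have := hx.le_integral_mul (i := p) (j := p + ℓ / 2) (κ := ℓ / 2) hp0
        (by linarith) (by simp only [ℓ]; linarith) (fun t _ => indicator_nonneg hkin t)
        (fun t ht => by
          have ht' : t ∈ Icc p d := ⟨ht.1, by simp only [ℓ] at ht; linarith [ht.2]⟩
          rw [indicator_of_mem ht']
          simp only [k, ℓ] at ht ⊢; linarith [ht.2]) hint
      linarith
    refine short ℓ (by simp only [ℓ]; linarith) ?_
    have hfl := hx.abs_empMean_sub_le (H := ℓ) (k := k) hp0 hdR hℓ.le
      (((concaveOn_const _ (convex_Icc _ _)).sub (convexOn_id (convex_Icc _ _))).quasiconcaveOn)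
      hkin (fun t ht => by simp only [k, ℓ]; linarith [ht.1]) (hx.mass_Icc_le hp0 hpd hdR)
    have h2 := mul_le_mul_of_nonneg_left hlow hε.le
    have h3 : ℓ * (ε * m * ℓ / 4) ≤ ℓ * (A * (√(ρ * (A * ℓ)) + ρ)) := by
      refine le_trans ?_ (hgain.trans hfl); linarith
    have h4 := le_of_mul_le_mul_left h3 hℓ
    have : 0 ≤ ε * m * ℓ := by positivity
    linarith

/-- `f` exceeds the fit on an interval, and the fit is affine neither on the first nor on the last
third: the fit can be raised in between. -/
lemma gain_le_of_not_affOn_thirds (hx : IsTypical x R f ρ A m B) (hg : IsFit x R g)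
    {c c₁ d₁ d : ℝ} (hε : 0 < ε) (hε1 : ε ≤ 1) (hc : 0 ≤ c) (hcc : c ≤ c₁) (hcd : c₁ ≤ d₁)
    (hdd : d₁ ≤ d) (hd : d ≤ B) (hdR : d < R) (hD : ∀ t ∈ Icc c d, g t + ε ≤ Real.log (f t))
    (h₁ : ¬ AffOn g c c₁) (h₂ : ¬ AffOn g d₁ d) :
    ε * m * (d₁ - c₁) / 2 ≤ A * (√(ρ * (A * (d - c))) + ρ) := by
  obtain ⟨η₁, hη₁, hW₁⟩ := hg.adm.exists_left_cap (c := c) (c₁ := c₁) ⟨hc, by linarith⟩ hcc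
    (by linarith) h₁
  obtain ⟨η₂, hη₂, hW₂⟩ := hg.adm.exists_right_cap (d := d) (d₁ := d₁) ⟨by linarith, hdR⟩ hdd
    (by linarith) h₂
  set η := min η₁ η₂
  have hη : 0 < η := lt_min hη₁ hη₂
  obtain ⟨W₁, a1, amono, a2, a3, a4⟩ := hW₁ η hη (min_le_left _ _)
  obtain ⟨W₂, b1, banti, b2, b3, b4⟩ := hW₂ η hη (min_le_right _ _)
  have hsub : Icc c d ⊆ Icc 0 R := Icc_subset_Icc hc hdR.le
  set k : ℝ → ℝ := fun t => min (W₁ t) (W₂ t) with hk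
  have hkcont : ContinuousOn k (Icc 0 R) := by
    have e1 : W₁ = fun t => (g t + W₁ t) - g t := by ext t; ring
    have e2 : W₂ = fun t => (g t + W₂ t) - g t := by ext t; ring
    rw [hk, e1, e2]
    exact (a1.cont.sub hg.adm.cont).inf (b1.cont.sub hg.adm.cont)
  have hkin : ∀ t ∈ Icc c d, 0 ≤ k t := fun t ht =>
    le_min (a4 t (hsub ht)).1 (b4 t (hsub ht)).1
  have heq : ∀ t ∈ Icc 0 R, k t = (Icc c d).indicator k t := fun t ht => by
    by_cases h : t ∈ Icc c d
    · rw [indicator_of_mem h]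
    · rw [indicator_of_notMem h]
      rw [mem_Icc, not_and_or, not_le, not_le] at h
      rcases h with h | h
      · simp only [hk]; rw [a2 t ht h.le]; exact min_eq_left (b4 t ht).1
      · simp only [hk]; rw [b2 t ht h.le]; exact min_eq_right (a4 t ht).1
  have htest := hg.empMean_min_le hx.ne_zero a1 b1
  have hfl := hx.abs_empMean_sub_le (H := η) (k := k) hc hdR.le hη.le
    (((amono.mono hsub).quasiconcaveOn (convex_Icc _ _)).inf
      ((banti.mono hsub).quasiconcaveOn (convex_Icc _ _))) hkin
    (fun t ht => (min_le_left _ _).trans (a4 t (hsub ht)).2)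
    (hx.mass_Icc_le hc (by linarith) hdR.le)
  rw [← empMean_congr hx.mem heq] at hfl
  have hint := integrableOn_indicator_mul hx.integrableOn hkcont c d
  have hlow : m * η * (d₁ - c₁) ≤ ∫ t in Icc 0 R, (Icc c d).indicator k t * f t := by
    refine hx.le_integral_mul (by linarith) hcd (by linarith)
      (fun t _ => indicator_nonneg hkin t) (fun t ht => ?_) hint
    have ht' : t ∈ Icc c d := ⟨hcc.trans ht.1, ht.2.trans hdd⟩
    rw [indicator_of_mem ht']
    simp only [hk]
    rw [a3 t (hsub ht') ht.1, b3 t (hsub ht') ht.2, min_self]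
  have hup : ∫ t in Icc 0 R, k t * Real.exp (g t)
      ≤ (1 - ε / 2) * ∫ t in Icc 0 R, (Icc c d).indicator k t * f t := by
    rw [← integral_const_mul]
    refine setIntegral_mono_on
      (hkcont.mul (Real.continuous_exp.comp_continuousOn hg.adm.cont)).integrableOn_Icc
      (hint.const_mul _) measurableSet_Icc fun t ht => ?_
    rw [heq t ht]
    by_cases h : t ∈ Icc c d
    · rw [indicator_of_mem h]
      have hf := hx.pos t ht
      have h2 : Real.exp (g t) ≤ (1 - ε / 2) * f t := by
        have h3 : Real.exp (-ε) ≤ 1 - ε / 2 := exp_neg_le_one_sub_half hε.le hε1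
        calc Real.exp (g t) ≤ Real.exp (Real.log (f t) + -ε) :=
              Real.exp_le_exp.2 (by linarith [hD t h])
          _ = Real.exp (-ε) * f t := by rw [Real.exp_add, Real.exp_log hf]; ring
          _ ≤ _ := by gcongr
      have := mul_le_mul_of_nonneg_left h2 (hkin t h)
      linarith
    · rw [indicator_of_notMem h]; simp
  have h1 := (abs_le.1 hfl).1
  have h2 := mul_le_mul_of_nonneg_left hlow hε.le
  have h3 : η * (ε * m * (d₁ - c₁) / 2) ≤ η * (A * (√(ρ * (A * (d - c))) + ρ)) := by
    linarith
  exact le_of_mul_le_mul_left h3 hη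

end Deviations

/-! ### Auxiliary facts for a deficit on an affine piece -/

lemma half_mul_sq_le_of_sign {ε y D : ℝ} (hε : 0 < ε) (hε1 : ε ≤ 1) (hy : y ≤ 1)
    (hpos : 0 < y → ε * y ≤ D) (hneg : y < 0 → D ≤ ε * y) :
    ε / 2 * y ^ 2 ≤ y * (1 - Real.exp (-D)) := by
  rcases lt_trichotomy y 0 with h | h | h
  · have h1 := Real.add_one_le_exp (-D)
    have h2 := hneg h
    have h3 : 1 - Real.exp (-D) ≤ ε * y := by linarith
    have h4 := mul_le_mul_of_nonpos_left h3 h.le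
    nlinarith [sq_nonneg y]
  · subst h; simp
  · have h1 : Real.exp (-D) ≤ Real.exp (-(ε * y)) := Real.exp_le_exp.2 (by linarith [hpos h])
    have h2 := exp_neg_le_one_sub_half (y := ε * y) (by positivity) (by nlinarith)
    have h3 : ε * y / 2 ≤ 1 - Real.exp (-D) := by linarith
    have := mul_le_mul_of_nonneg_left h3 h.le
    linarith

/-- A concave function that is at least `ε` on `[d, d']` lies, on `[d, q]`, above the affine
function with value `ε` at `d` and zero at a suitable `v ≥ d'` before `v`, and below it after `v`.
The point `v` is where the function changes sign, or `q`; since no continuity at `q` is assumed,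
nothing is claimed at `v`. -/
lemma ConcaveOn.exists_crossing {D : ℝ → ℝ} {d d' q ε : ℝ} (hD : ConcaveOn ℝ (Icc d q) D)
    (hdd : d < d') (hdq : d' ≤ q) (hε : 0 ≤ ε) (hlow : ∀ t ∈ Icc d d', ε ≤ D t) :
    ∃ v ∈ Icc d' q, (∀ t, d ≤ t → t < v → ε * (v - t) ≤ (v - d) * D t) ∧
      ∀ t, v < t → t ≤ q → (v - d) * D t ≤ -(ε * (t - v)) := by
  set Z : Set ℝ := {t | t ∈ Icc d' q ∧ 0 ≤ D t} with hZ
  have hne : Z.Nonempty := ⟨d', ⟨le_rfl, hdq⟩, hε.trans (hlow d' ⟨hdd.le, le_rfl⟩)⟩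
  have hbdd : BddAbove Z := ⟨q, fun t ht => ht.1.2⟩
  have hdI : d ∈ Icc d q := ⟨le_rfl, hdd.le.trans hdq⟩
  have hDd := hlow d ⟨le_rfl, hdd.le⟩
  refine ⟨sSup Z, ⟨le_csSup_of_le hbdd ⟨⟨le_rfl, hdq⟩, hε.trans (hlow d' ⟨hdd.le, le_rfl⟩)⟩ le_rfl,
    csSup_le hne fun t ht => ht.1.2⟩, fun t hdt htv => ?_, fun t hvt htq => ?_⟩
  · have hcl : IsClosed {w : ℝ | w ≤ t ∨ ε * (w - t) ≤ (w - d) * D t} := by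
      have : {w : ℝ | w ≤ t ∨ ε * (w - t) ≤ (w - d) * D t}
          = Iic t ∪ {w | ε * (w - t) ≤ (w - d) * D t} := rfl
      rw [this]
      exact isClosed_Iic.union (isClosed_le (by fun_prop) (by fun_prop))
    have hsub : Z ⊆ {w : ℝ | w ≤ t ∨ ε * (w - t) ≤ (w - d) * D t} := by
      intro w hw
      rcases le_or_gt w t with h | h
      · exact Or.inl h
      · right
        have h1 := hD.chord_le hdI ⟨hdd.le.trans hw.1.1, hw.1.2⟩ hdt h.le
        have h2 := mul_le_mul_of_nonneg_left hDd (sub_nonneg.2 h.le)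
        have h3 := mul_nonneg (sub_nonneg.2 hdt) hw.2
        linarith
    rcases closure_minimal hsub hcl (csSup_mem_closure hne hbdd) with h | h
    · exact absurd h (not_le.2 htv)
    · exact h
  · have hcl : IsClosed {w : ℝ | (w - d) * D t ≤ -(ε * (t - w))} :=
      isClosed_le (by fun_prop) (by fun_prop)
    have hsub : Ioo (sSup Z) t ⊆ {w : ℝ | (w - d) * D t ≤ -(ε * (t - w))} := by
      intro w hw
      have hw1 : d' ≤ w :=
        (le_csSup_of_le hbdd ⟨⟨le_rfl, hdq⟩, hε.trans (hlow d' ⟨hdd.le, le_rfl⟩)⟩ le_rfl).trans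
          hw.1.le
      have hDw : D w < 0 := by
        by_contra hcon
        exact absurd (le_csSup hbdd ⟨⟨hw1, hw.2.le.trans htq⟩, not_lt.1 hcon⟩) (not_le.2 hw.1)
      have h1 := hD.chord_le hdI ⟨hdd.le.trans (hw1.trans hw.2.le), htq⟩ (hdd.le.trans hw1) hw.2.le
      have h2 := mul_le_mul_of_nonneg_left hDd (sub_nonneg.2 hw.2.le)
      have h3 : (t - d) * D w ≤ 0 :=
        mul_nonpos_of_nonneg_of_nonpos (by linarith [hw.2]) hDw.le
      change (w - d) * D t ≤ -(ε * (t - w))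
      linarith
    have := closure_minimal hsub hcl
    rw [closure_Ioo hvt.ne] at this
    exact this (left_mem_Icc.2 hvt.le)

lemma empMean_const_mul {n : ℕ} (x : Fin n → ℝ) (a : ℝ) (h : ℝ → ℝ) :
    empMean x (fun t => a * h t) = a * empMean x h := by
  simp only [empMean, ← Finset.mul_sum, mul_div_assoc]

lemma empMean_sub {n : ℕ} (x : Fin n → ℝ) (h k : ℝ → ℝ) :
    empMean x (fun t => h t - k t) = empMean x h - empMean x k := by
  simp only [empMean, Finset.sum_sub_distrib, sub_div]

lemma empMean_add {n : ℕ} (x : Fin n → ℝ) (h k : ℝ → ℝ) :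
    empMean x (fun t => h t + k t) = empMean x h + empMean x k := by
  simp only [empMean, Finset.sum_add_distrib, add_div]

namespace IsTypical
variable {n : ℕ} {x : Fin n → ℝ} {R : ℝ} {f g : ℝ → ℝ} {ρ A m B ε : ℝ}

/-- The fluctuation of a unimodal function `k` relative to a lower bound `S` for its second
moment. -/
lemma abs_empMean_sub_le_sqrt (hx : IsTypical x R f ρ A m B) {u v H ℓ S μ : ℝ} {k : ℝ → ℝ}
    (hu : 0 ≤ u) (hv : v ≤ R) (hH : 0 ≤ H) (hk : QuasiconcaveOn ℝ (Icc u v) k)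
    (hk0 : ∀ t ∈ Icc u v, 0 ≤ k t) (hkH : ∀ t ∈ Icc u v, k t ≤ H) (hℓ : 0 ≤ ℓ)
    (hM : ∫ y in Icc u v, f y ≤ A * ℓ) (hμ : 0 < μ) (hμ1 : μ ≤ 1)
    (hS : μ * H ^ 2 * ℓ / 8 ≤ S) (hor : H ≤ 1 ∨ ρ ≤ ℓ) :
    |empMean x ((Icc u v).indicator k) - ∫ t in Icc 0 R, (Icc u v).indicator k t * f t|
      ≤ 16 * A ^ 2 / μ * (√ρ * √S + ρ) := by
  refine (hx.abs_empMean_sub_le hu hv hH hk hk0 hkH hM).trans ?_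
  have hA := hx.one_le
  have hρ := hx.rho_pos
  have hS0 : 0 ≤ S := le_trans (by positivity) hS
  set c := 8 * A / μ with hc
  have hc1 : 1 ≤ c := by
    rw [hc, le_div_iff₀ hμ]; linarith
  have hHS : H ^ 2 * ℓ ≤ 8 / μ * S := by
    rw [div_mul_eq_mul_div, le_div_iff₀ hμ]; linarith
  have hb : ∀ M, M ≤ A * ℓ → H * √(ρ * M) ≤ c * (√ρ * √S) := by
    intro M hM
    have e1 : H * √(ρ * M) = √(H ^ 2 * (ρ * M)) := by
      rw [Real.sqrt_mul (sq_nonneg H), Real.sqrt_sq hH]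
    have e2 : c * (√ρ * √S) = √(c ^ 2 * (ρ * S)) := by
      rw [Real.sqrt_mul (sq_nonneg c), Real.sqrt_sq (by linarith), Real.sqrt_mul hρ.le]
    rw [e1, e2]
    refine Real.sqrt_le_sqrt ?_
    calc H ^ 2 * (ρ * M) ≤ H ^ 2 * (ρ * (A * ℓ)) := by gcongr
      _ = A * ρ * (H ^ 2 * ℓ) := by ring
      _ ≤ A * ρ * (8 / μ * S) := by gcongr
      _ = c * (ρ * S) := by rw [hc]; ring
      _ ≤ c ^ 2 * (ρ * S) := by
          have : c ≤ c ^ 2 := by nlinarith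
          gcongr
  have h1 := hb (A * ℓ) le_rfl
  have h2 : H * ρ ≤ c * (√ρ * √S) + ρ := by
    rcases hor with h | h
    · have : 0 ≤ c * (√ρ * √S) := by positivity
      nlinarith
    · have h3 : ρ ≤ √(ρ * ℓ) := Real.le_sqrt_of_sq_le (by nlinarith)
      have := hb ℓ (by nlinarith)
      nlinarith
  have hcA : A * c ≤ 8 * A ^ 2 / μ := by rw [hc]; apply le_of_eq; ring
  have h3 : 1 ≤ 8 * A / μ := hc1
  have hP : 0 ≤ √ρ * √S := by positivity
  calc H * (A * (√(ρ * (A * ℓ)) + ρ)) = A * (H * √(ρ * (A * ℓ)) + H * ρ) := by ring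
    _ ≤ A * (c * (√ρ * √S) + (c * (√ρ * √S) + ρ)) := by gcongr
    _ = 16 * A ^ 2 / μ * (√ρ * √S) + A * 1 * ρ := by rw [hc]; ring
    _ ≤ 16 * A ^ 2 / μ * (√ρ * √S) + A * (16 * A / μ) * ρ := by
        gcongr
        rw [le_div_iff₀ hμ]; linarith
    _ = _ := by ring

lemma empMean_singleton_le (hx : IsTypical x R f ρ A m B) {p : ℝ} (hp : p ∈ Icc 0 R) :
    empMean x (({p} : Set ℝ).indicator 1) ≤ A * ρ := by
  have h := hx.dev {p} (singleton_subset_iff.2 hp) ordConnected_singleton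
  rw [setIntegral_measure_zero _ (by simp)] at h
  simp only [mul_zero, Real.sqrt_zero, zero_add, sub_zero] at h
  exact (le_abs_self _).trans h

end IsTypical

/-! ### A deficit of the fit on an affine piece -/

section Deviations
variable {n : ℕ} {x : Fin n → ℝ} {R : ℝ} {f g : ℝ → ℝ} {ρ A m B ε : ℝ}

/-- The test inequality for a function `Δ ≤ 1` that is concave on a maximal affine piece `[p, q]`
of the fit and jumps to `0` at its ends, up to the atoms at the ends: add the inequalities for
`Δ - 1 ≤ 0` and for the indicator of the piece. -/
lemma IsFit.empMean_indicator_sub_le (hg : IsFit x R g) (hn : n ≠ 0) {p q c s : ℝ} {Δ : ℝ → ℝ}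
    (hp : 0 ≤ p) (hpq : p < q) (hq : q ≤ R)
    (hon : ∀ t ∈ Icc p q, g t = g c + s * (t - c))
    (hoff : ∀ t ∈ Icc 0 R, t ∉ Icc p q → g t < g c + s * (t - c))
    (hc : ConcaveOn ℝ (Icc 0 R) Δ) (hcont : ContinuousOn Δ (Icc 0 R))
    (hle : ∀ t ∈ Icc 0 R, Δ t ≤ 1) {η₀ : ℝ} (hη₀ : 0 < η₀)
    (hanti : ∀ η, 0 < η → η ≤ η₀ → AntitoneOn (fun t => s * (t - c) + η * Δ t) (Icc 0 R)) :
    empMean x ((Icc p q).indicator Δ) - empMean x (({p} : Set ℝ).indicator 1)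
        - empMean x (({q} : Set ℝ).indicator 1)
      ≤ ∫ t in Icc 0 R, (Icc p q).indicator Δ t * Real.exp (g t) := by
  have h1 := hg.empMean_indicator_le hn (Δ := fun t => Δ t - 1) hon hoff
    (hc.sub (convexOn_const _ (convex_Icc _ _))) (hcont.sub continuousOn_const)
    (fun t ht => by linarith [hle t ht]) hη₀ (fun η hη hη' t ht t' ht' htt' => by
      have := hanti η hη hη' ht ht' htt'
      simp only at this ⊢
      linarith)
  have h2 := hg.empMean_Ioo_le hn hp hpq hq hon hoff
  have e1 : (Icc p q).indicator (fun t => Δ t - 1)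
      = fun t => (Icc p q).indicator Δ t - (Icc p q).indicator 1 t := by
    ext t
    by_cases h : t ∈ Icc p q
    · simp [indicator_of_mem h]
    · simp [indicator_of_notMem h]
  have e2 : (Icc p q).indicator (1 : ℝ → ℝ) = fun t => (Ioo p q).indicator (1 : ℝ → ℝ) t +
      (({p} : Set ℝ).indicator 1 t + ({q} : Set ℝ).indicator 1 t) := by
    ext t
    by_cases h3 : t = p
    · subst h3; simp [indicator, hpq.le, hpq.ne]
    · by_cases h4 : t = q
      · subst h4; simp [indicator, hpq.le, hpq.ne']
      · have : t ∈ Icc p q ↔ t ∈ Ioo p q :=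
          ⟨fun h => ⟨lt_of_le_of_ne h.1 (Ne.symm h3), lt_of_le_of_ne h.2 h4⟩,
            fun h => Ioo_subset_Icc_self h⟩
        simp [indicator, this, h3, h4]
  rw [e1, empMean_sub] at h1
  have e3 : empMean x ((Icc p q).indicator 1) = empMean x ((Ioo p q).indicator 1) +
      (empMean x (({p} : Set ℝ).indicator 1) + empMean x (({q} : Set ℝ).indicator 1)) := by
    rw [e2, empMean_add, empMean_add]
  have e4 : ∫ t in Icc 0 R, ((Icc p q).indicator Δ t - (Icc p q).indicator 1 t) * Real.exp (g t)
      = (∫ t in Icc 0 R, (Icc p q).indicator Δ t * Real.exp (g t))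
        - ∫ t in Icc 0 R, (Icc p q).indicator 1 t * Real.exp (g t) := by
    rw [← integral_sub (integrableOn_indicator_mul hg.adm.integrableOn_exp hcont p q)
      (integrableOn_indicator_mul hg.adm.integrableOn_exp (k := 1) continuousOn_const p q)]
    simp only [sub_mul]
  rw [e4] at h1
  linarith

/-- Comparison of the constants in the fluctuation bounds. -/
lemma fluctuation_const_bounds {τ : ℝ} (hA : 1 ≤ A) (hm : 0 < m) (hm1 : m ≤ 1) (hτ : 0 < τ)
    (hτ1 : τ ≤ 1) :
    16 * A ^ 2 / m ≤ 16 * A ^ 2 / (m * τ ^ 2) ∧ 16 * A ^ 2 / (m * τ) ≤ 16 * A ^ 2 / (m * τ ^ 2) ∧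
      A ≤ 16 * A ^ 2 / (m * τ ^ 2) ∧ m * τ ≤ 1 ∧ m ^ 2 * τ ^ 2 ≤ m * τ ∧ m * τ ^ 3 ≤ 1 := by
  have hmτ : m * τ ≤ 1 := mul_le_one₀ hm1 hτ.le hτ1
  have hτ2 : τ ^ 2 ≤ τ := by nlinarith
  have hmτ2 : m * τ ^ 2 ≤ m := mul_le_of_le_one_right hm.le (hτ2.trans hτ1)
  refine ⟨by gcongr, by gcongr, ?_, hmτ, ?_, mul_le_one₀ hm1 (by positivity)
    (pow_le_one₀ hτ.le hτ1)⟩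
  · rw [le_div_iff₀ (by positivity)]
    have h1 : m * τ ^ 2 ≤ 1 := hmτ2.trans hm1
    nlinarith
  · rw [← mul_pow, sq]
    exact mul_le_of_le_one_left (by positivity) hmτ

lemma le_of_sq_le_mul_add {y z K : ℝ} (hy : 0 < y) (hz : 0 < z) (hK : 1 ≤ K)
    (h : y ^ 2 ≤ 6 * K * z * y + 10 * K * z ^ 2) : y ≤ 10 * K * z := by
  by_contra hcon
  have h1 := not_le.1 hcon
  have h2 : 10 * K * z * y < y * y := by gcongr
  have h3 : 10 * K * z ^ 2 ≤ z * y := by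
    calc 10 * K * z ^ 2 = z * (10 * K * z) := by ring
      _ ≤ z * y := by gcongr
  have h5 : 0 < z * y := by positivity
  have h4 : z * y ≤ K * (z * y) := le_mul_of_one_le_left h5.le hK
  have : 0 < K * z * y := by positivity
  linarith

set_option maxHeartbeats 2000000 in
/-- `f` exceeds the fit on an interval `[a₀, b₀]` where the fit is affine. On the maximal affine
piece `[p, q]` the log-ratio `D` is concave, so there is a concave piecewise linear `Δ` of the same
sign as `D` with `ε * Δ ≤ D` where `Δ ≥ 0` and `D ≤ ε * Δ` where `Δ ≤ 0`. The gain is then at least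
`ε / 2` times the second moment of `Δ`, and the fluctuation is of the order of its square root. -/
lemma sq_mul_le_of_affOn_below (hx : IsTypical x R f ρ A m B) (hg : IsFit x R g)
    {a₀ b₀ s τ : ℝ} (hε : 0 < ε) (hε1 : ε ≤ 1) (ha₀ : 0 ≤ a₀) (hab : a₀ < b₀) (hτ : 0 < τ)
    (hτ1 : τ ≤ 1) (hbB : b₀ + 2 * τ ≤ B) (hδτ : b₀ - a₀ ≤ τ) (hρδ : 3 * ρ ≤ b₀ - a₀)
    (hD : ∀ t ∈ Icc a₀ b₀, g t + ε ≤ Real.log (f t))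
    (haff : ∀ t ∈ Icc a₀ b₀, g t = g a₀ + s * (t - a₀)) :
    ε ^ 2 * (b₀ - a₀) ≤ 800 / m * (16 * A ^ 2 / (m * τ ^ 2)) ^ 2 * ρ := by
  have hm := hx.m_pos
  have hm1 := hx.m_le
  have hA := hx.one_le
  have hρ := hx.rho_pos
  have hBR := hx.B_le
  set δ := b₀ - a₀ with hδ
  have hδ0 : 0 < δ := sub_pos.2 hab
  set c := a₀ + δ / 3 with hcdef
  set d := a₀ + 2 * δ / 3 with hddef
  have hbd : b₀ = a₀ + δ := by rw [hδ]; ring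
  have hac : a₀ < c := by linarith
  have hcd : c < d := by linarith
  have hdb : d < b₀ := by linarith
  have hbR : b₀ ≤ R := by linarith
  have haI : a₀ ∈ Icc 0 R := ⟨ha₀, by linarith⟩
  have hbI : b₀ ∈ Icc 0 R := ⟨by linarith, hbR⟩
  have hs0 : s ≤ 0 := by
    have h1 := hg.adm.antitone haI hbI hab.le
    have h2 := haff b₀ (right_mem_Icc.2 hab.le)
    by_contra h
    have := mul_pos (not_le.1 h) hδ0
    have e : s * (b₀ - a₀) = s * δ := rfl
    linarith
  obtain ⟨p, q, hp0, hpa, hbq, hqR, hon, hoff⟩ := hg.adm.exists_maximal_affine ha₀ hab hbR haff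
  have hpq : p < q := by linarith
  set D : ℝ → ℝ := fun t => Real.log (f t) - (g a₀ + s * (t - a₀)) with hDdef
  have hDconc : ConcaveOn ℝ (Icc 0 R) D := by
    have h1 : ConvexOn ℝ (Icc 0 R) (fun t => g a₀ + s * (t - a₀)) :=
      ⟨convex_Icc _ _, fun x _ y _ a b _ _ hab => by
        simp only [smul_eq_mul]
        have : a = 1 - b := by linarith
        subst this; apply le_of_eq; ring⟩
    exact hx.logConcave.sub h1
  have hDε : ∀ t ∈ Icc a₀ b₀, ε ≤ D t := fun t ht => by
    have := hD t ht
    rw [haff t ht] at this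
    simp only [hDdef]; linarith
  -- the right end of the positive part, with the slope of `Δ` there
  obtain ⟨v, hv, hv1, hv2⟩ := (hDconc.subset (Icc_subset_Icc (by linarith) hqR)
    (convex_Icc _ _)).exists_crossing (d := d) (d' := b₀) (q := q) hdb hbq hε.le
    (fun t ht => hDε t ⟨by linarith [ht.1], ht.2⟩)
  have hvd : 0 < v - d := by linarith [hv.1]
  set κ := 1 / (v - d) with hκ
  have hκ0 : 0 < κ := by positivity
  have hκv : κ * (v - d) = 1 := one_div_mul_cancel hvd.ne'
  have hκδ : κ * (δ / 3) ≤ 1 := by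
    rw [← hκv]; gcongr; linarith [hv.1]
  -- the left end of the positive part; if the fit is constant then `Δ` does not decrease there
  obtain ⟨κ', u, hκ'0, hκ'δ, hpu, hua, hκ's, hκ'u, hu0, hu1, hu2⟩ : ∃ κ' u, 0 ≤ κ' ∧
      κ' * (δ / 3) ≤ 1 ∧ p ≤ u ∧ u ≤ a₀ ∧ (κ' = 0 ∨ s < 0) ∧ κ' * (c - u) ≤ 1 ∧
      (∀ t, p ≤ t → t < u → 1 - κ' * (c - t) = -(κ' * (u - t))) ∧
      (∀ t, u ≤ t → t ≤ c → 0 < 1 - κ' * (c - t) → ε * (1 - κ' * (c - t)) ≤ D t) ∧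
      ∀ t, p ≤ t → t < u → D t ≤ ε * (1 - κ' * (c - t)) := by
    rcases eq_or_lt_of_le hs0 with hs | hs
    · refine ⟨0, p, le_rfl, by simp, le_rfl, hpa, Or.inl rfl, by simp, fun t h1 h2 => by linarith,
        fun t h1 h2 _ => ?_, fun t h1 h2 => by linarith⟩
      have htI : t ∈ Icc 0 R := ⟨hp0.trans h1, by linarith⟩
      have hcI : c ∈ Icc 0 R := ⟨by linarith, by linarith⟩
      have h3 := hDε c ⟨hac.le, by linarith⟩
      have h4 := Real.log_le_log (hx.pos c hcI) (hx.antitone htI hcI h2)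
      simp only [hDdef, hs, zero_mul, add_zero] at h3 ⊢
      linarith
    · have hrefl : ConcaveOn ℝ (Icc (-c) (-p)) (fun t => D (-t)) := by
        have h1 := (hDconc.subset (Icc_subset_Icc hp0 (by linarith : c ≤ R))
          (convex_Icc _ _)).comp_linearMap (-LinearMap.id)
        have h2 : ((-LinearMap.id : ℝ →ₗ[ℝ] ℝ) ⁻¹' Icc p c) = Icc (-c) (-p) := by
          ext t
          simp only [mem_preimage, LinearMap.neg_apply, LinearMap.id_apply, mem_Icc]
          constructor <;> rintro ⟨h3, h4⟩ <;> constructor <;> linarith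
        rw [h2] at h1
        exact h1
      obtain ⟨w, hw, hw1, hw2⟩ := hrefl.exists_crossing (d := -c) (d' := -a₀) (q := -p)
        (by linarith) (by linarith) hε.le
        (fun t ht => hDε (-t) ⟨by linarith [ht.2], by linarith [ht.1]⟩)
      have hcw : 0 < c - -w := by linarith [hw.1]
      have hκw : 1 / (c - -w) * (c - -w) = 1 := one_div_mul_cancel hcw.ne'
      set κ' := 1 / (c - -w) with hκ'
      have hκ'pos : 0 < κ' := by positivity
      have hlin : ∀ t, 1 - κ' * (c - t) = κ' * (t - -w) := fun t => by
        rw [← hκw]; ring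
      refine ⟨κ', -w, hκ'pos.le, ?_, by linarith [hw.2], by linarith [hw.1], Or.inr hs, hκw.le,
        fun t h1 h2 => ?_, fun t h1 h2 h3 => ?_, fun t h1 h2 => ?_⟩
      · rw [← hκw]; gcongr; linarith [hw.1]
      · rw [hlin]; ring
      · rw [hlin] at h3 ⊢
        have h4 : -t < w := by
          by_contra hcon
          have : t - -w ≤ 0 := by linarith
          have := mul_nonpos_of_nonneg_of_nonpos hκ'pos.le this
          linarith
        have h5 := hw1 (-t) (by linarith) h4
        rw [neg_neg] at h5
        calc ε * (κ' * (t - -w)) = κ' * (ε * (w - -t)) := by ring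
          _ ≤ κ' * ((w - -c) * D t) := by gcongr
          _ = κ' * (c - -w) * D t := by ring
          _ = D t := by rw [hκw, one_mul]
      · rw [hlin]
        have h5 := hw2 (-t) (by linarith) (by linarith)
        rw [neg_neg] at h5
        calc D t = κ' * (c - -w) * D t := by rw [hκw, one_mul]
          _ = κ' * ((w - -c) * D t) := by ring
          _ ≤ κ' * -(ε * (-t - w)) := by gcongr
          _ = _ := by ring
  set Δ : ℝ → ℝ := fun t => min 1 (min (1 - κ' * (c - t)) (1 - κ * (t - d))) with hΔ
  have hΔ1 : ∀ t, Δ t ≤ 1 := fun t => min_le_left _ _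
  have hΔl : ∀ t, t ≤ c → Δ t = 1 - κ' * (c - t) := fun t ht => by
    have h1 : 0 ≤ κ' * (c - t) := mul_nonneg hκ'0 (by linarith)
    have h2 : κ * (t - d) ≤ 0 := mul_nonpos_of_nonneg_of_nonpos hκ0.le (by linarith)
    simp only [hΔ]
    rw [min_eq_left (by linarith : 1 - κ' * (c - t) ≤ 1 - κ * (t - d)), min_eq_right (by linarith)]
  have hΔr : ∀ t, d ≤ t → Δ t = 1 - κ * (t - d) := fun t ht => by
    have h1 : κ' * (c - t) ≤ 0 := mul_nonpos_of_nonneg_of_nonpos hκ'0 (by linarith)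
    have h2 : 0 ≤ κ * (t - d) := mul_nonneg hκ0.le (by linarith)
    simp only [hΔ]
    rw [min_eq_right (by linarith : 1 - κ * (t - d) ≤ 1 - κ' * (c - t)), min_eq_right (by linarith)]
  have hΔm : ∀ t, c ≤ t → t ≤ d → Δ t = 1 := fun t ht ht' => by
    have h1 : κ' * (c - t) ≤ 0 := mul_nonpos_of_nonneg_of_nonpos hκ'0 (by linarith)
    have h2 : κ * (t - d) ≤ 0 := mul_nonpos_of_nonneg_of_nonpos hκ0.le (by linarith)
    simp only [hΔ]
    exact min_eq_left (le_min (by linarith) (by linarith))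
  have hΔr' : ∀ t, d ≤ t → Δ t = κ * (v - t) := fun t ht => by
    rw [hΔr t ht, ← hκv]; ring
  have hΔcont : ContinuousOn Δ (Icc 0 R) := by fun_prop
  have haffc : ∀ a b : ℝ, ConcaveOn ℝ (Icc 0 R) (fun t => a + b * t) := fun a b =>
    ⟨convex_Icc _ _, fun x _ y _ a b _ _ hab => by
      simp only [smul_eq_mul]
      have : a = 1 - b := by linarith
      subst this; apply le_of_eq; ring⟩
  have hΔconc : ConcaveOn ℝ (Icc 0 R) Δ := by
    have e : Δ = fun t => min 1 (min ((1 - κ' * c) + κ' * t) ((1 + κ * d) + (-κ) * t)) := by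
      ext t; simp only [hΔ, mul_sub, neg_mul]; congr 2
      · ring
      · ring
    rw [e]
    exact (concaveOn_const _ (convex_Icc _ _)).inf ((haffc _ _).inf (haffc _ _))
  have hΔin : ∀ t ∈ Icc u v, 0 ≤ Δ t := fun t ht => by
    rcases le_total t c with h | h
    · rw [hΔl t h]
      have : κ' * (c - t) ≤ κ' * (c - u) := by gcongr; exact ht.1
      linarith
    · rcases le_total t d with h' | h'
      · rw [hΔm t h h']; exact zero_le_one
      · rw [hΔr' t h']; exact mul_nonneg hκ0.le (sub_nonneg.2 ht.2)
  -- the sign condition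
  have hsign : ∀ t ∈ Icc p q, (0 < Δ t → ε * Δ t ≤ D t) ∧ (Δ t < 0 → D t ≤ ε * Δ t) := by
    intro t ht
    rcases le_total t c with h | h
    · rw [hΔl t h]
      rcases lt_or_ge t u with h1 | h1
      · refine ⟨fun h2 => ?_, fun _ => hu2 t ht.1 h1⟩
        rw [hu0 t ht.1 h1] at h2
        have := mul_nonneg hκ'0 (sub_nonneg.2 h1.le)
        linarith
      · refine ⟨hu1 t h1 h, fun h2 => ?_⟩
        have : κ' * (c - t) ≤ κ' * (c - u) := by gcongr
        linarith
    · rcases le_total t d with h' | h'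
      · rw [hΔm t h h']
        exact ⟨fun _ => by rw [mul_one]; exact hDε t ⟨by linarith, by linarith⟩, fun h2 => by linarith⟩
      · rw [hΔr' t h']
        refine ⟨fun h2 => ?_, fun h2 => ?_⟩
        · have h3 : t < v := sub_pos.1 (pos_of_mul_pos_right h2 hκ0.le)
          calc ε * (κ * (v - t)) = κ * (ε * (v - t)) := by ring
            _ ≤ κ * ((v - d) * D t) := mul_le_mul_of_nonneg_left (hv1 t h' h3) hκ0.le
            _ = κ * (v - d) * D t := by ring
            _ = D t := by rw [hκv, one_mul]
        · have h3 : v < t := by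
            by_contra hcon
            have := mul_nonneg hκ0.le (sub_nonneg.2 (not_lt.1 hcon))
            linarith
          calc D t = κ * (v - d) * D t := by rw [hκv, one_mul]
            _ = κ * ((v - d) * D t) := by ring
            _ ≤ κ * -(ε * (t - v)) := mul_le_mul_of_nonneg_left (hv2 t h3 ht.2) hκ0.le
            _ = _ := by ring
  -- the test inequality
  have hΔlip : ∀ t t', t ≤ t' → Δ t' ≤ Δ t + κ' * (t' - t) := fun t t' htt' => by
    have h1 : 0 ≤ κ' * (t' - t) := mul_nonneg hκ'0 (by linarith)
    have h2 : 0 ≤ κ * (t' - t) := mul_nonneg hκ0.le (by linarith)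
    rw [← sub_le_iff_le_add]
    refine le_min ?_ (le_min ?_ ?_)
    · linarith [hΔ1 t']
    · have : Δ t' ≤ 1 - κ' * (c - t') := (min_le_right _ _).trans (min_le_left _ _)
      linarith
    · have : Δ t' ≤ 1 - κ * (t' - d) := (min_le_right _ _).trans (min_le_right _ _)
      linarith
  obtain ⟨η₀, hη₀, hη₀s⟩ : ∃ η₀ > 0, ∀ η, 0 < η → η ≤ η₀ → s + η * κ' ≤ 0 := by
    rcases hκ's with h | h
    · exact ⟨1, one_pos, fun η _ _ => by rw [h]; linarith⟩
    · refine ⟨-s / (κ' + 1), div_pos (by linarith) (by linarith), fun η hη hη' => ?_⟩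
      rw [le_div_iff₀ (by linarith)] at hη'
      linarith
  have htest := hg.empMean_indicator_sub_le hx.ne_zero hp0 hpq hqR hon hoff hΔconc hΔcont
    (fun t _ => hΔ1 t) hη₀ (fun η hη hη' t _ t' _ htt' => by
      have h1 := mul_le_mul_of_nonneg_left (hΔlip t t' htt') hη.le
      have h2 := mul_nonpos_of_nonpos_of_nonneg (hη₀s η hη hη') (sub_nonneg.2 htt')
      simp only
      linarith)
  have hpatom := hx.empMean_singleton_le (p := p) ⟨hp0, by linarith⟩
  have hqatom := hx.empMean_singleton_le (p := q) ⟨by linarith, hqR⟩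
  -- decomposition into the positive part and the two negative parts
  set kL : ℝ → ℝ := fun t => κ' * (u - t) with hkL
  set kR : ℝ → ℝ := fun t => t - v with hkR
  have hkLc : ContinuousOn kL (Icc 0 R) := by fun_prop
  have hkRc : ContinuousOn kR (Icc 0 R) := by fun_prop
  have hdec : (Icc p q).indicator Δ = fun t => (Icc u v).indicator Δ t - (Icc p u).indicator kL t
      - κ * (Icc v q).indicator kR t := by
    ext t
    have huv : u < v := by linarith [hv.1]
    by_cases h : t ∈ Icc p q
    · rw [indicator_of_mem h]
      rcases lt_or_ge t u with h1 | h1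
      · rw [indicator_of_notMem (fun hh => absurd hh.1 (not_le.2 h1)),
          indicator_of_mem (show t ∈ Icc p u from ⟨h.1, h1.le⟩),
          indicator_of_notMem (fun hh => absurd hh.1 (not_le.2 (h1.trans huv))),
          hΔl t (by linarith), hu0 t h.1 h1]
        simp only [hkL]; ring
      · rcases le_or_gt t v with h2 | h2
        · rw [indicator_of_mem (show t ∈ Icc u v from ⟨h1, h2⟩)]
          have e1 : (Icc p u).indicator kL t = 0 := by
            by_cases h3 : t ∈ Icc p u
            · rw [indicator_of_mem h3]
              have : t = u := le_antisymm h3.2 h1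
              simp [hkL, this]
            · exact indicator_of_notMem h3 _
          have e2 : (Icc v q).indicator kR t = 0 := by
            by_cases h3 : t ∈ Icc v q
            · rw [indicator_of_mem h3]
              have : t = v := le_antisymm h2 h3.1
              simp [hkR, this]
            · exact indicator_of_notMem h3 _
          rw [e1, e2]; ring
        · rw [indicator_of_notMem (fun hh => absurd hh.2 (not_le.2 h2)),
            indicator_of_notMem (fun hh => absurd hh.2 (not_le.2 (huv.trans h2))),
            indicator_of_mem (show t ∈ Icc v q from ⟨h2.le, h.2⟩), hΔr' t (by linarith)]
          simp only [hkR]; ring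
    · rw [indicator_of_notMem h, indicator_of_notMem
        (fun hh => h ⟨hpu.trans hh.1, hh.2.trans hv.2⟩),
        indicator_of_notMem (fun hh => h ⟨hh.1, by linarith [hh.2]⟩),
        indicator_of_notMem (fun hh => h ⟨by linarith [hh.1, hv.1], hh.2⟩)]
      ring
  have hEdec : empMean x ((Icc p q).indicator Δ) = empMean x ((Icc u v).indicator Δ)
      - empMean x ((Icc p u).indicator kL) - κ * empMean x ((Icc v q).indicator kR) := by
    rw [hdec, empMean_sub, empMean_sub, empMean_const_mul]
  have hI0 := integrableOn_indicator_mul hx.integrableOn hΔcont p q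
  have hI1 := integrableOn_indicator_mul hx.integrableOn hΔcont u v
  have hI2 := integrableOn_indicator_mul hx.integrableOn hkLc p u
  have hI3 := integrableOn_indicator_mul hx.integrableOn hkRc v q
  have hIdec : ∫ t in Icc 0 R, (Icc p q).indicator Δ t * f t
      = (∫ t in Icc 0 R, (Icc u v).indicator Δ t * f t)
        - (∫ t in Icc 0 R, (Icc p u).indicator kL t * f t)
        - κ * ∫ t in Icc 0 R, (Icc v q).indicator kR t * f t := by
    have hI12 : IntegrableOn (fun t => (Icc u v).indicator Δ t * f t - (Icc p u).indicator kL t * f t)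
        (Icc 0 R) := hI1.sub hI2
    rw [← integral_const_mul, ← integral_sub hI1 hI2, ← integral_sub hI12 (hI3.const_mul κ)]
    congr 1; ext t
    rw [hdec]; ring
  -- the gain
  have hIS := integrableOn_indicator_mul hx.integrableOn (hΔcont.pow 2) p q
  set S := ∫ t in Icc 0 R, (Icc p q).indicator (fun t => Δ t ^ 2) t * f t with hS
  have hgain : ε / 2 * S ≤ (∫ t in Icc 0 R, (Icc p q).indicator Δ t * f t)
      - ∫ t in Icc 0 R, (Icc p q).indicator Δ t * Real.exp (g t) := by
    have hIg := integrableOn_indicator_mul hg.adm.integrableOn_exp hΔcont p q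
    rw [← integral_sub hI0 hIg, hS, ← integral_const_mul]
    refine setIntegral_mono_on (hIS.const_mul _) (hI0.sub hIg) measurableSet_Icc fun t ht => ?_
    by_cases h : t ∈ Icc p q
    · rw [indicator_of_mem h, indicator_of_mem h]
      have hf := hx.pos t ht
      have h1 := half_mul_sq_le_of_sign hε hε1 (hΔ1 t) (hsign t h).1 (hsign t h).2
      have h2 : Real.exp (g t) = f t * Real.exp (-D t) := by
        have : g t = Real.log (f t) + -D t := by rw [hon t h]; simp only [hDdef]; ring
        rw [this, Real.exp_add, Real.exp_log hf]
      rw [h2]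
      have := mul_le_mul_of_nonneg_right h1 hf.le
      linarith
    · rw [indicator_of_notMem h, indicator_of_notMem h]; simp
  -- lower bounds for the second moment
  have hSlow : ∀ i j κ₀ : ℝ, p ≤ i → i ≤ j → j ≤ q → j ≤ B → 0 ≤ κ₀ →
      (∀ t ∈ Icc i j, κ₀ ≤ |Δ t|) → m * κ₀ ^ 2 * (j - i) ≤ S := by
    intro i j κ₀ hpi hij hjq hjB hκ₀ hh
    refine hx.le_integral_mul (hp0.trans hpi) hij hjB
      (fun t _ => indicator_nonneg (fun t _ => sq_nonneg _) t) (fun t ht => ?_) hIS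
    rw [indicator_of_mem (show t ∈ Icc p q from ⟨hpi.trans ht.1, ht.2.trans hjq⟩), ← sq_abs (Δ t)]
    exact pow_le_pow_left₀ hκ₀ (hh t ht) 2
  set W := min (v - u) τ with hW
  have hWδ : δ ≤ W := le_min (by linarith [hv.1]) hδτ
  have hW0 : 0 < W := hδ0.trans_le hWδ
  have hSW : m * W / 8 ≤ S := by
    set j := min ((d + v) / 2) (d + τ / 2) with hj
    have hj1 : j ≤ (d + v) / 2 := min_le_left _ _
    have hj2 : j ≤ d + τ / 2 := min_le_right _ _
    have hdj : d ≤ j := le_min (by linarith) (by linarith)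
    have h1 := hSlow ((u + c) / 2) j (1 / 2) (by linarith) (by linarith)
      (by linarith [hv.2]) (by linarith) (by norm_num) (fun t ht => by
        refine le_trans ?_ (le_abs_self _)
        rcases le_total t c with h | h
        · rw [hΔl t h]
          have : κ' * (c - t) ≤ κ' * ((c - u) / 2) := by gcongr; linarith [ht.1]
          linarith
        · rcases le_total t d with h' | h'
          · rw [hΔm t h h']; norm_num
          · rw [hΔr t h']
            have : κ * (t - d) ≤ κ * ((v - d) / 2) := by gcongr; linarith [ht.2]
            linarith)
    have h2 : W / 2 ≤ j - (u + c) / 2 := by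
      rcases le_total ((d + v) / 2) (d + τ / 2) with h | h
      · rw [hj, min_eq_left h]
        have : W ≤ v - u := min_le_left _ _
        linarith
      · rw [hj, min_eq_right h]
        have : W ≤ τ := min_le_right _ _
        linarith
    have h3 := mul_le_mul_of_nonneg_left h2 hm.le
    linarith
  have hSpos : 0 < S := lt_of_lt_of_le (by positivity) hSW
  -- the fluctuations
  set K := 16 * A ^ 2 / (m * τ ^ 2) with hK
  obtain ⟨hKm, hKmτ, hAK, hmτ1, hmτ2, hmτ3⟩ := fluctuation_const_bounds hA hm hm1 hτ hτ1
  rw [← hK] at hKm hKmτ hAK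
  have hP : 0 ≤ √ρ * √S + ρ := by positivity
  have hF1 : |empMean x ((Icc u v).indicator Δ) - ∫ t in Icc 0 R, (Icc u v).indicator Δ t * f t|
      ≤ K * (√ρ * √S + ρ) := by
    have hmass : ∫ y in Icc u v, f y ≤ A * (W / τ) := by
      rcases le_total (v - u) τ with h | h
      · have h1 := hx.mass_Icc_le (u := u) (v := v) (by linarith) (by linarith [hv.1])
          (hv.2.trans hqR)
        refine h1.trans ?_
        rw [hW, min_eq_left h]
        gcongr
        rw [le_div_iff₀ hτ]
        exact mul_le_of_le_one_right (by linarith [hv.1]) hτ1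
      · have h1 := hx.mass_Icc_le_const (u := u) (v := v) (by linarith) (hv.2.trans hqR)
          (by linarith)
        rw [hW, min_eq_right h, div_self hτ.ne', mul_one]; exact h1
    refine (hx.abs_empMean_sub_le_sqrt (H := 1) (ℓ := W / τ) (S := S) (μ := m * τ) (by linarith)
      (hv.2.trans hqR) zero_le_one ((hΔconc.subset (Icc_subset_Icc (by linarith)
        (hv.2.trans hqR)) (convex_Icc _ _)).quasiconcaveOn) hΔin (fun t _ => hΔ1 t)
      (by positivity) hmass (by positivity) hmτ1 ?_ (Or.inl le_rfl)).trans ?_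
    · have : m * τ * 1 ^ 2 * (W / τ) / 8 = m * W / 8 := by field_simp
      rw [this]; exact hSW
    · gcongr
  have hF2 : |empMean x ((Icc p u).indicator kL) - ∫ t in Icc 0 R, (Icc p u).indicator kL t * f t|
      ≤ K * (√ρ * √S + ρ) := by
    set ℓ := u - p with hℓ
    have hℓ0 : 0 ≤ ℓ := sub_nonneg.2 hpu
    refine (hx.abs_empMean_sub_le_sqrt (H := κ' * ℓ) (ℓ := ℓ) (S := S) (μ := m) hp0
      (by linarith) (by positivity) ?_ (fun t ht => mul_nonneg hκ'0 (sub_nonneg.2 ht.2))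
      (fun t ht => by gcongr; linarith [ht.1]) hℓ0
      (hx.mass_Icc_le hp0 hpu (by linarith)) hm hm1 ?_ ?_).trans ?_
    · refine ConcaveOn.quasiconcaveOn ⟨convex_Icc _ _, fun x _ y _ a b _ _ hab => ?_⟩
      simp only [smul_eq_mul]
      have : a = 1 - b := by linarith
      subst this; apply le_of_eq; ring
    · have h1 := hSlow p (p + ℓ / 2) (κ' * ℓ / 2) le_rfl (by linarith) (by linarith [hv.1, hv.2])
        (by linarith) (by positivity) (fun t ht => by
          rcases eq_or_lt_of_le hpu with h | h
          · have : ℓ = 0 := by rw [hℓ]; linarith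
            rw [this]; simp
          · have htu : t < u := by linarith [ht.2]
            rw [hΔl t (by linarith), hu0 t ht.1 htu, abs_neg]
            refine le_trans ?_ (le_abs_self _)
            rw [mul_div_assoc]
            gcongr
            linarith [ht.2])
      linarith
    · rcases le_total ρ ℓ with h | h
      · exact Or.inr h
      · left
        calc κ' * ℓ ≤ κ' * (δ / 3) := by gcongr; linarith
          _ ≤ 1 := hκ'δ
    · gcongr
  have hF3 : |κ * empMean x ((Icc v q).indicator kR)
      - κ * ∫ t in Icc 0 R, (Icc v q).indicator kR t * f t| ≤ K * (√ρ * √S + ρ) := by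
    have hv0 : 0 ≤ v := by linarith [hv.1]
    have htailbound : κ ≤ 8 / (m * τ ^ 2) * √S →
        |κ * empMean x ((Icc v q).indicator kR)
          - κ * ∫ t in Icc 0 R, (Icc v q).indicator kR t * f t| ≤ K * (√ρ * √S + ρ) := by
      intro hκS
      have h1 := hx.abs_empMean_sub_le_tail hv0 hv.2 hqR
      rw [← mul_sub, abs_mul, abs_of_pos hκ0]
      calc κ * _ ≤ (8 / (m * τ ^ 2) * √S) * (2 * A ^ 2 * √ρ) := by gcongr
        _ = K * (√ρ * √S) := by rw [hK]; ring
        _ ≤ K * (√ρ * √S + ρ) := by gcongr; linarith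
    have hroot : ∀ z : ℝ, 0 ≤ z → z ^ 2 ≤ (8 / (m * τ ^ 2)) ^ 2 * S → z ≤ 8 / (m * τ ^ 2) * √S := by
      intro z hz h
      refine (abs_le_of_sq_le_sq' ?_ (by positivity)).2
      rw [mul_pow, Real.sq_sqrt hSpos.le]; exact h
    rcases le_or_gt (v - d) τ with hlen | hlen
    · rcases le_or_gt (q - v) τ with hlen' | hlen'
      · set ℓ := q - v with hℓ
        have hℓ0 : 0 ≤ ℓ := sub_nonneg.2 hv.2
        have h := hx.abs_empMean_sub_le_sqrt (H := κ * ℓ) (ℓ := ℓ) (S := S) (μ := m)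
          (k := fun t => κ * (t - v)) hv0 hqR
          (by positivity) (by
            refine ConcaveOn.quasiconcaveOn ⟨convex_Icc _ _, fun x _ y _ a b _ _ hab => ?_⟩
            simp only [smul_eq_mul]
            have : a = 1 - b := by linarith
            subst this; apply le_of_eq; ring) (fun t ht => mul_nonneg hκ0.le (sub_nonneg.2 ht.1))
          (fun t ht => by gcongr; linarith [ht.2]) hℓ0
          (hx.mass_Icc_le hv0 hv.2 hqR) hm hm1 (by
            have h1 := hSlow (q - ℓ / 2) q (κ * ℓ / 2) (by linarith [hv.1]) (by linarith)
              le_rfl (by linarith) (by positivity) (fun t ht => by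
                rw [hΔr' t (by linarith [hv.1, ht.1]), ← abs_neg]
                refine le_trans ?_ (le_abs_self _)
                have : κ * (ℓ / 2) ≤ κ * (t - v) := by gcongr; linarith [ht.1]
                linarith)
            linarith) (by
            rcases le_total ρ ℓ with h | h
            · exact Or.inr h
            · left
              calc κ * ℓ ≤ κ * (δ / 3) := by gcongr; linarith
                _ ≤ 1 := hκδ)
        have e : (Icc v q).indicator (fun t => κ * (t - v))
            = fun t => κ * (Icc v q).indicator kR t := by
          ext t
          by_cases ht : t ∈ Icc v q
          · simp only [indicator_of_mem ht, hkR]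
          · simp only [indicator_of_notMem ht, mul_zero]
        rw [e, empMean_const_mul] at h
        simp only [mul_assoc κ] at h
        rw [integral_const_mul] at h
        refine h.trans ?_
        gcongr
      · refine htailbound (hroot κ hκ0.le ?_)
        have h1 := hSlow (v + τ / 2) (v + τ) (κ * (τ / 2)) (by linarith [hv.1]) (by linarith)
          (by linarith) (by linarith) (by positivity) (fun t ht => by
            rw [hΔr' t (by linarith [hv.1, ht.1]), ← abs_neg]
            refine le_trans ?_ (le_abs_self _)
            have : κ * (τ / 2) ≤ κ * (t - v) := by gcongr; linarith [ht.1]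
            linarith)
        have h2 : m * τ ^ 3 / 8 * κ ^ 2 ≤ S := by linarith
        rw [div_pow 8, div_mul_eq_mul_div, le_div_iff₀ (by positivity)]
        have h3 : (m * τ ^ 3 / 8 * κ ^ 2) * (8 * (m * τ)) ≤ S * (8 * (m * τ)) :=
          mul_le_mul_of_nonneg_right h2 (by positivity)
        have h4 : S * (8 * (m * τ)) ≤ S * (8 * 1) := by gcongr
        linarith
    · refine htailbound (hroot κ hκ0.le ?_)
      have hWτ : W = τ := by rw [hW]; exact min_eq_right (by linarith)
      have h1 : κ ^ 2 * τ ^ 2 ≤ 1 := by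
        rw [← mul_pow]
        refine pow_le_one₀ (by positivity) ?_
        rw [← hκv]; gcongr
      rw [hWτ] at hSW
      rw [div_pow 8, div_mul_eq_mul_div, le_div_iff₀ (by positivity)]
      have h2 : κ ^ 2 * (m * τ ^ 2) ^ 2 = κ ^ 2 * τ ^ 2 * (m ^ 2 * τ ^ 2) := by ring
      rw [h2]
      calc κ ^ 2 * τ ^ 2 * (m ^ 2 * τ ^ 2) ≤ 1 * (m * τ) := by gcongr
        _ ≤ 8 ^ 2 * S := by linarith
  -- balance of gain and fluctuation
  have hbal : ε / 2 * S ≤ 3 * (K * (√ρ * √S + ρ)) + 2 * (A * ρ) := by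
    have h1 := (abs_le.1 hF1).1
    have h2 := (abs_le.1 hF2).2
    have h3 := (abs_le.1 hF3).2
    linarith
  set y := ε * √S with hy
  have hy0 : 0 < y := mul_pos hε (Real.sqrt_pos.2 hSpos)
  have hSsq : √S ^ 2 = S := Real.sq_sqrt hSpos.le
  have hρsq : √ρ ^ 2 = ρ := Real.sq_sqrt hρ.le
  have hK1 : 1 ≤ K := hA.trans hAK
  have hy2 : y ^ 2 ≤ 6 * K * √ρ * y + 10 * K * √ρ ^ 2 := by
    have h1 := mul_le_mul_of_nonneg_left hbal hε.le
    have h2 : A * ρ ≤ K * ρ := by gcongr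
    have h3 : ε * (K * ρ) ≤ K * ρ := mul_le_of_le_one_left (by positivity) hε1
    have h4 : y ^ 2 = ε * (ε * S) := by rw [hy, mul_pow, hSsq]; ring
    have h5 : ε * (A * ρ) ≤ ε * (K * ρ) := by gcongr
    rw [h4, hρsq, hy]
    linarith
  have hyK := le_of_sq_le_mul_add hy0 (Real.sqrt_pos.2 hρ) hK1 hy2
  have hε2S : ε ^ 2 * S ≤ 100 * K ^ 2 * ρ := by
    calc ε ^ 2 * S = y ^ 2 := by rw [hy, mul_pow, hSsq]
      _ ≤ (10 * K * √ρ) ^ 2 := by gcongr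
      _ = 100 * K ^ 2 * ρ := by rw [mul_pow, hρsq]; ring
  have hSδ : m * δ / 8 ≤ S := by
    refine le_trans ?_ hSW; gcongr
  have h1 : ε ^ 2 * (m * δ / 8) ≤ ε ^ 2 * S := by gcongr
  have h2 : m * (ε ^ 2 * δ) ≤ 800 * K ^ 2 * ρ := by linarith
  calc ε ^ 2 * δ ≤ 800 * K ^ 2 * ρ / m := by rw [le_div_iff₀ hm]; linarith
    _ = _ := by ring

end Deviations

/-! ### Errors on intervals and at points -/

section Deviations
variable {n : ℕ} {x : Fin n → ℝ} {R : ℝ} {f g : ℝ → ℝ} {ρ A m B ε : ℝ}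

/-- If the logarithm of the fit misses `log f` by `ε` on a whole interval, always with the same
sign, then the interval has length at most of the order of `ρ / ε ^ 2`. -/
theorem IsTypical.sq_mul_le (hx : IsTypical x R f ρ A m B) (hg : IsFit x R g) {c d τ : ℝ}
    (hε : 0 < ε) (hε1 : ε ≤ 1) (hc : 0 ≤ c) (hτ : 0 < τ) (hτ1 : τ ≤ 1) (hdB : d + 2 * τ ≤ B)
    (hdτ : d - c ≤ τ) (hρ : 9 * ρ ≤ d - c)
    (hD : (∀ t ∈ Icc c d, Real.log (f t) + ε ≤ g t) ∨ ∀ t ∈ Icc c d, g t + ε ≤ Real.log (f t)) :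
    ε ^ 2 * (d - c) ≤ 2400 / m * (16 * A ^ 2 / (m * τ ^ 2)) ^ 2 * ρ := by
  have hm := hx.m_pos
  have hm1 := hx.m_le
  have hA := hx.one_le
  have hρ0 := hx.rho_pos
  have hBR := hx.B_le
  have hcd : c < d := by linarith
  set K := 16 * A ^ 2 / (m * τ ^ 2) with hK
  have hKm : 16 * A ^ 2 / m ≤ K := (fluctuation_const_bounds hA hm hm1 hτ hτ1).1
  have hm800 : 1 ≤ 800 / m := by rw [le_div_iff₀ hm]; linarith
  have h2400 : 2400 / m = 3 * (800 / m) := by ring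
  have hKρ : 0 ≤ K ^ 2 * ρ := by positivity
  have hA1 : (16 * A ^ 2 / m) ^ 2 * ρ ≤ K ^ 2 * ρ := by gcongr
  have hweak : ∀ z, z ≤ K ^ 2 * ρ → z ≤ 2400 / m * K ^ 2 * ρ := fun z hz => by
    have := mul_le_mul_of_nonneg_right hm800 hKρ
    rw [h2400]; linarith
  have hthird : ε ^ 2 * ((d - c) / 3) ≤ 800 / m * K ^ 2 * ρ →
      ε ^ 2 * (d - c) ≤ 2400 / m * K ^ 2 * ρ := fun h => by rw [h2400]; linarith
  rcases hD with hD | hD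
  · by_cases haff : AffOn g c d
    · obtain ⟨s, hs⟩ := haff
      exact hweak _ (sq_mul_le_of_affOn hx hg hε hc hcd hτ hτ1 (by linarith) (by linarith) hdτ hD hs)
    · exact hweak _ ((sq_mul_le_of_gain_le hm hA hρ0 (by linarith) hε
        (gain_le_of_not_affOn hx hg hε hc hcd (by linarith) hD haff)).trans hA1)
  · set c₁ := c + (d - c) / 3 with hc₁
    set d₁ := c + 2 * (d - c) / 3 with hd₁
    by_cases h1 : AffOn g c c₁
    · obtain ⟨s, hs⟩ := h1
      have e : c₁ - c = (d - c) / 3 := by rw [hc₁]; ring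
      have h := sq_mul_le_of_affOn_below hx hg hε hε1 hc (by linarith : c < c₁) hτ hτ1
        (by linarith) (by linarith) (by linarith) (fun t ht => hD t ⟨ht.1, by linarith [ht.2]⟩) hs
      rw [e] at h
      exact hthird h
    by_cases h2 : AffOn g d₁ d
    · obtain ⟨s, hs⟩ := h2
      have e : d - d₁ = (d - c) / 3 := by rw [hd₁]; ring
      have h := sq_mul_le_of_affOn_below hx hg hε hε1 (by linarith) (by linarith : d₁ < d) hτ hτ1
        (by linarith) (by linarith) (by linarith) (fun t ht => hD t ⟨by linarith [ht.1], ht.2⟩) hs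
      rw [e] at h
      exact hthird h
    have h := gain_le_of_not_affOn_thirds hx hg hε hε1 hc (by linarith : c ≤ c₁)
      (by linarith : c₁ ≤ d₁) (by linarith) (by linarith) (by linarith) hD h1 h2
    have e : d₁ - c₁ = (d - c) / 3 := by rw [hd₁, hc₁]; ring
    rw [e] at h
    have h3 : 0 ≤ ε * m * (d - c) := by have := sub_pos.2 hcd; positivity
    exact hweak _ ((sq_mul_le_of_gain_le hm hA hρ0 (by linarith) hε (le_trans (by linarith) h)).trans
      hA1)

/-- The pointwise form: where `log f` is within `ε / 8` of an affine function, concavity of the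
fit turns an error `ε` at the point `t` into an error on an interval of length `η` near `t`. An
excess of the fit propagates to the right; a deficit propagates to the right or to the left, and
to the right for certain if the slope `p` is not too negative, because the fit decreases. -/
theorem IsTypical.abs_sub_lt (hx : IsTypical x R f ρ A m B) (hg : IsFit x R g) {t η p τ : ℝ}
    (hε : 0 < ε) (hε1 : ε ≤ 1) (ht : 0 ≤ t) (hτ : 0 < τ) (hτ1 : τ ≤ 1)
    (htB : t + 3 * η + 2 * τ ≤ B) (hητ : η ≤ τ) (hρ : 9 * ρ ≤ η)
    (hp : ∀ y ∈ Icc (t - η) (t + 3 * η), 0 ≤ y →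
      |Real.log (f y) - Real.log (f t) - p * (y - t)| ≤ ε / 8)
    (hpη : η ≤ t ∨ -p * η ≤ ε / 4)
    (hlarge : 2400 / m * (16 * A ^ 2 / (m * τ ^ 2)) ^ 2 * ρ < (ε / 8) ^ 2 * η) :
    |g t - Real.log (f t)| < ε := by
  have hρ0 := hx.rho_pos
  have hη : 0 < η := by linarith
  have hBR := hx.B_le
  by_contra hcon
  have hcon := not_lt.1 hcon
  have key : ∀ c, 0 ≤ c → c + η ≤ t + 3 * η →
      ¬ ((∀ y ∈ Icc c (c + η), Real.log (f y) + ε / 8 ≤ g y) ∨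
        ∀ y ∈ Icc c (c + η), g y + ε / 8 ≤ Real.log (f y)) := fun c hc hc' hD => by
    have e : c + η - c = η := by ring
    have := hx.sq_mul_le hg (ε := ε / 8) (by linarith) (by linarith) hc hτ hτ1
      (d := c + η) (by linarith) (by linarith) (by linarith) hD
    rw [e] at this
    linarith
  have hmem : ∀ y, 0 ≤ y → y ≤ t + 3 * η → y ∈ Icc 0 R := fun y h1 h2 => ⟨h1, by linarith⟩
  have htI := hmem t ht (by linarith)
  rcases le_abs.1 hcon with h | h
  · by_cases h2 : Real.log (f t) + p * (2 * η) - ε / 2 ≤ g (t + 2 * η)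
    · refine key t ht (by linarith) (Or.inl fun y hy => ?_)
      have h3 := hg.adm.concave.chord_le htI (hmem (t + 2 * η) (by linarith) (by linarith)) hy.1
        (by linarith [hy.2])
      have h4 := (abs_le.1 (hp y ⟨by linarith [hy.1], by linarith [hy.2]⟩ (ht.trans hy.1))).2
      have h5 := mul_le_mul_of_nonneg_left h2 (sub_nonneg.2 hy.1)
      have h6 : (t + 2 * η - y) * (Real.log (f t) + ε) ≤ (t + 2 * η - y) * g t :=
        mul_le_mul_of_nonneg_left (by linarith) (by linarith [hy.2])
      have h7 : 2 * η * (ε / 4) ≤ (t + 2 * η - y) * ε - (y - t) * (ε / 2) := by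
        nlinarith [mul_nonneg hε.le (sub_nonneg.2 hy.2)]
      have h8 : (2 * η) * (Real.log (f t) + p * (y - t) + ε / 4) ≤ (2 * η) * g y := by
        linarith
      have h9 := le_of_mul_le_mul_left h8 (by linarith)
      linarith
    · refine key (t + 2 * η) (by linarith) (by linarith) (Or.inr fun y hy => ?_)
      have h2' := not_le.1 h2
      have h3 := hg.adm.concave.chord_le htI (hmem y (by linarith [hy.1]) (by linarith [hy.2]))
        (by linarith : t ≤ t + 2 * η) hy.1
      have h4 := (abs_le.1 (hp y ⟨by linarith [hy.1], by linarith [hy.2]⟩ (by linarith [hy.1]))).1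
      have h5 : (y - t) * g (t + 2 * η) ≤ (y - t) * (Real.log (f t) + p * (2 * η) - ε / 2) :=
        mul_le_mul_of_nonneg_left h2'.le (by linarith [hy.1])
      have h6 : (y - (t + 2 * η)) * (Real.log (f t) + ε) ≤ (y - (t + 2 * η)) * g t :=
        mul_le_mul_of_nonneg_left (by linarith) (by linarith [hy.1])
      have h7 : 0 ≤ (y - (t + 2 * η)) * ε := mul_nonneg (by linarith [hy.1]) hε.le
      have h8 : (2 * η) * g y ≤ (2 * η) * (Real.log (f t) + p * (y - t) - ε / 2) := by
        nlinarith
      have h9 := le_of_mul_le_mul_left h8 (by linarith)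
      linarith
  · by_cases h2 : ∀ y ∈ Icc t (t + η), g y ≤ Real.log (f t) + p * (y - t) - ε / 4
    · refine key t ht (by linarith) (Or.inr fun y hy => ?_)
      have h3 := h2 y hy
      have h4 := (abs_le.1 (hp y ⟨by linarith [hy.1], by linarith [hy.2]⟩ (ht.trans hy.1))).1
      linarith
    push Not at h2
    obtain ⟨z, hz, hgz⟩ := h2
    have hzI := hmem z (ht.trans hz.1) (by linarith [hz.2])
    have hηt : η ≤ t := by
      rcases hpη with hpη | hpη
      · exact hpη
      · exfalso
        have h3 := hg.adm.antitone htI hzI hz.1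
        have h4 : -p * (z - t) ≤ ε / 4 := by
          rcases le_total 0 (-p) with h5 | h5
          · have : -p * (z - t) ≤ -p * η := by gcongr; linarith [hz.2]
            linarith
          · have := mul_nonpos_of_nonpos_of_nonneg h5 (sub_nonneg.2 hz.1)
            linarith
        linarith
    refine key (t - η) (by linarith) (by linarith) (Or.inr fun y hy => ?_)
    have hy2 : y ≤ t := by linarith [hy.2]
    have hy0 : 0 ≤ y := by linarith [hy.1]
    have h4 := (abs_le.1 (hp y ⟨hy.1, by linarith⟩ hy0)).1
    have h3 := hg.adm.concave.chord_le (hmem y hy0 (by linarith)) hzI hy2 hz.1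
    have htz : 0 < z - t := by
      rcases eq_or_lt_of_le hz.1 with h5 | h5
      · subst h5; simp only [sub_self, mul_zero] at hgz; linarith
      · linarith
    have h5 := mul_le_mul_of_nonneg_left hgz.le (sub_nonneg.2 hy2)
    have h6 : (z - y) * g t ≤ (z - y) * (Real.log (f t) - ε) :=
      mul_le_mul_of_nonneg_left (by linarith) (by linarith)
    have h7 : 0 ≤ (t - y) * ε := mul_nonneg (by linarith) hε.le
    have h8 : (z - t) * g y ≤ (z - t) * (Real.log (f t) + p * (y - t) - ε) := by
      nlinarith
    have h9 := le_of_mul_le_mul_left h8 htz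
    linarith

end Deviations

/-! ### Local affine approximation under Hölder smoothness -/

section Smoothness
variable {f : ℝ → ℝ} {β L : ℝ} {J : Set ℝ}

lemma HolderClass.continuousOn (h : HolderClass β L J f) (hβ : 1 ≤ β) : ContinuousOn f J := by
  rcases eq_or_lt_of_le hβ with h1 | h1
  · have : LipschitzOnWith (Real.toNNReal L) f J := LipschitzOnWith.of_dist_le_mul fun x hx y hy => by
      rw [Real.dist_eq, Real.dist_eq]
      have := h.1 h1.symm y hy x hx
      exact this.trans (by gcongr; exact Real.le_coe_toNNReal L)
    exact this.continuousOn
  · exact (h.2 h1).1.continuousOn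

/-- First order Taylor expansion in the Hölder class. -/
lemma HolderClass.abs_sub_sub_le (h : HolderClass β L J f) (hβ : 1 < β) (hL : 0 ≤ L)
    (hJ : Convex ℝ J) {t y : ℝ} (ht : t ∈ J) (hy : y ∈ J) :
    |f y - f t - derivWithin f J t * (y - t)| ≤ L * |y - t| ^ β := by
  have hsub : segment ℝ t y ⊆ J := hJ.segment_subset ht hy
  have h1 : ∀ z ∈ segment ℝ t y, HasDerivWithinAt (fun z => f z - derivWithin f J t * z)
      (derivWithin f J z - derivWithin f J t) (segment ℝ t y) z := fun z hz => by
    have := (((h.2 hβ).1 z (hsub hz)).hasDerivWithinAt.mono hsub).sub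
      ((hasDerivWithinAt_id z (segment ℝ t y)).const_mul (derivWithin f J t))
    rw [mul_one] at this
    exact this
  have h2 : ∀ z ∈ segment ℝ t y, ‖derivWithin f J z - derivWithin f J t‖ ≤ L * |y - t| ^ (β - 1) :=
    fun z hz => by
      refine ((h.2 hβ).2 t ht z (hsub hz)).trans ?_
      have hzy : |z - t| ≤ |y - t| := by
        rw [segment_eq_uIcc] at hz
        exact abs_sub_left_of_mem_uIcc hz
      gcongr
  have h3 := (convex_segment t y).norm_image_sub_le_of_norm_hasDerivWithin_le h1 h2
    (left_mem_segment ℝ t y) (right_mem_segment ℝ t y)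
  have e : f y - derivWithin f J t * y - (f t - derivWithin f J t * t)
      = f y - f t - derivWithin f J t * (y - t) := by ring
  rw [e, Real.norm_eq_abs, Real.norm_eq_abs, mul_assoc] at h3
  refine h3.trans (le_of_eq ?_)
  congr 1
  rcases eq_or_lt_of_le (abs_nonneg (y - t)) with h4 | h4
  · rw [← h4, mul_zero, Real.zero_rpow (by linarith)]
  · rw [← Real.rpow_add_one h4.ne']; congr 1; ring

lemma abs_log_sub_log_sub_le {u v m : ℝ} (hm : 0 < m) (hu : m ≤ u) (hv : m ≤ v) :
    |Real.log v - Real.log u - (v - u) / u| ≤ ((v - u) / m) ^ 2 := by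
  have hu0 := hm.trans_le hu
  have hv0 := hm.trans_le hv
  have h1 := Real.log_le_sub_one_of_pos (div_pos hv0 hu0)
  have h2 := Real.log_le_sub_one_of_pos (div_pos hu0 hv0)
  rw [Real.log_div hv0.ne' hu0.ne'] at h1
  rw [Real.log_div hu0.ne' hv0.ne'] at h2
  have e1 : (v - u) / u = v / u - 1 := by field_simp
  have e2 : v / u - 1 - (1 - u / v) = (v - u) ^ 2 / (u * v) := by field_simp
  have e3 : (v - u) ^ 2 / (u * v) ≤ ((v - u) / m) ^ 2 := by
    rw [div_pow, sq m]; gcongr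
  rw [abs_le]
  constructor
  · linarith
  · have := sq_nonneg ((v - u) / m); linarith

lemma abs_log_sub_log_le {u v m : ℝ} (hm : 0 < m) (hu : m ≤ u) (hv : m ≤ v) :
    |Real.log v - Real.log u| ≤ |v - u| / m := by
  have key : ∀ u v : ℝ, m ≤ u → m ≤ v → Real.log v - Real.log u ≤ |v - u| / m := fun u v hu hv => by
    have hu0 := hm.trans_le hu
    have hv0 := hm.trans_le hv
    have h1 := Real.log_le_sub_one_of_pos (div_pos hv0 hu0)
    rw [Real.log_div hv0.ne' hu0.ne'] at h1
    calc Real.log v - Real.log u ≤ v / u - 1 := h1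
      _ = (v - u) / u := by field_simp
      _ ≤ |v - u| / u := by gcongr; exact le_abs_self _
      _ ≤ |v - u| / m := by gcongr
  rw [abs_le]
  constructor
  · have := key v u hv hu
    rw [abs_sub_comm] at this; linarith
  · exact key u v hu hv

/-- Near each point of `[a, b]` the function `log f` is affine up to an error of order `η ^ β` at
scale `η`. Within `η` of the boundary point `0` the slope is moreover at least of order
`-η ^ (β - 1)`, as the slope at `0` vanishes. The margin `5 * τ` to the right of `b` leaves
room for a neighbourhood of width `3 * τ` and for a further `2 * τ`. -/
lemma exists_affine_approx (hf : IsMonotoneLogConcaveDensity f) (hβ₁ : 1 ≤ β) (hβ₂ : β ≤ 2)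
    (hL : 0 < L) {a b δ : ℝ} (ha : 0 ≤ a) (hab : a ≤ b) (hpos : 0 < f b) (hδ : 0 < δ)
    (hH : HolderClass β L (Icc (a - δ) (b + δ) ∩ Ici 0) f)
    (hzero : 1 < β → a = 0 → derivWithin f (Ici 0) 0 = 0) :
    ∃ K τ : ℝ, 0 < K ∧ 0 < τ ∧ τ ≤ 1 ∧ 0 < f (b + 5 * τ) ∧
      ∀ t ∈ Icc a b, ∀ η, 0 < η → η ≤ τ → ∃ p,
        (∀ y ∈ Icc (t - η) (t + 3 * η), 0 ≤ y →
          |Real.log (f y) - Real.log (f t) - p * (y - t)| ≤ K * η ^ β) ∧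
        (η ≤ t ∨ -p * η ≤ K * η ^ β) := by
  set J := Icc (a - δ) (b + δ) ∩ Ici 0 with hJdef
  have hJ : Convex ℝ J := (convex_Icc _ _).inter (convex_Ici _)
  have hbJ : b ∈ J := ⟨⟨by linarith, by linarith⟩, ha.trans hab⟩
  obtain ⟨τ, hτ, hτ1, hτδ, hτa, hτf⟩ : ∃ τ : ℝ, 0 < τ ∧ τ ≤ 1 ∧ 5 * τ ≤ δ ∧ (0 < a → τ ≤ a) ∧
      0 < f (b + 5 * τ) := by
    have h1 : Tendsto (fun τ : ℝ => b + 5 * τ) (𝓝[>] 0) (𝓝[J] b) := by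
      refine tendsto_nhdsWithin_iff.2 ⟨?_, ?_⟩
      · refine Tendsto.mono_left ?_ nhdsWithin_le_nhds
        have : Continuous (fun τ : ℝ => b + 5 * τ) := by fun_prop
        simpa using this.tendsto 0
      · filter_upwards [Ioc_mem_nhdsGT (show (0 : ℝ) < δ / 5 by linarith)] with τ hτ
        exact ⟨⟨by linarith [hτ.1], by linarith [hτ.2]⟩, by
          change 0 ≤ b + 5 * τ
          linarith [hτ.1]⟩
    have h2 := ((hH.continuousOn hβ₁ b hbJ).tendsto.comp h1).eventually (eventually_gt_nhds hpos)
    have h3 : ∀ᶠ τ : ℝ in 𝓝[>] 0, 0 < a → τ ≤ a := by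
      rcases eq_or_lt_of_le ha with h | h
      · exact Eventually.of_forall fun τ h' => absurd h' (by simp [← h])
      · filter_upwards [Ioc_mem_nhdsGT h] with τ hτ _ using hτ.2
    have h8 : ∀ᶠ τ : ℝ in 𝓝[>] 0, τ ∈ Ioc (0 : ℝ) 1 := Ioc_mem_nhdsGT zero_lt_one
    have h9 : ∀ᶠ τ : ℝ in 𝓝[>] 0, τ ∈ Ioc (0 : ℝ) (δ / 5) := Ioc_mem_nhdsGT (by linarith)
    obtain ⟨τ, h4, h5, h6, h7⟩ := (h2.and (h3.and (h8.and h9))).exists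
    exact ⟨τ, h6.1, h6.2, by linarith [h7.2], h5, h4⟩
  set m := f (b + 5 * τ) with hm
  have hge : ∀ y, 0 ≤ y → y ≤ b + 5 * τ → m ≤ f y := fun y h1 h2 =>
    hf.antitone h1 (h1.trans h2) h2
  have hmemJ : ∀ t ∈ Icc a b, ∀ η, 0 < η → η ≤ τ → ∀ y ∈ Icc (t - η) (t + 3 * η), 0 ≤ y →
      y ∈ J := fun t ht η h1 h2 y hy hy0 =>
    ⟨⟨by linarith [hy.1, ht.1], by linarith [hy.2, ht.2]⟩, hy0⟩
  have hdist : ∀ t η y : ℝ, 0 < η → y ∈ Icc (t - η) (t + 3 * η) → |y - t| ≤ 3 * η :=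
    fun t η y h hy => abs_le.2 ⟨by linarith [hy.1], by linarith [hy.2]⟩
  rcases eq_or_lt_of_le hβ₁ with hβ | hβ
  · refine ⟨3 * L / m, τ, by positivity, hτ, hτ1, hτf, fun t ht η hη hητ => ⟨0, fun y hy hy0 => ?_,
      Or.inr ?_⟩⟩
    · have ht0 := ha.trans ht.1
      have h1 := abs_log_sub_log_le hτf (hge t ht0 (by linarith [ht.2]))
        (hge y hy0 (by linarith [hy.2, ht.2]))
      have h2 := hH.1 hβ.symm t (hmemJ t ht η hη hητ t ⟨by linarith, by linarith⟩ ht0) y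
        (hmemJ t ht η hη hητ y hy hy0)
      rw [zero_mul, sub_zero, ← hβ, Real.rpow_one]
      calc _ ≤ |f y - f t| / m := h1
        _ ≤ L * (3 * η) / m := by
          gcongr
          exact h2.trans (by gcongr; exact hdist t η y hη hy)
        _ = _ := by ring
    · have : 0 ≤ 3 * L / m * η ^ β := by positivity
      simpa using this
  · set D := |derivWithin f J b| + L * (b - a) ^ (β - 1) with hD
    have hβ0 : 0 ≤ β - 1 := by linarith
    have hba : 0 ≤ b - a := by linarith
    have hD0 : 0 ≤ D := by positivity
    have hDt : ∀ t ∈ Icc a b, |derivWithin f J t| ≤ D := fun t ht => by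
      have h1 := (hH.2 hβ).2 b hbJ t ⟨⟨by linarith [ht.1], by linarith [ht.2]⟩, ha.trans ht.1⟩
      have h2 : |t - b| ^ (β - 1) ≤ (b - a) ^ (β - 1) := by
        gcongr
        exact abs_le.2 ⟨by linarith [ht.1], by linarith [ht.2]⟩
      have h3 := abs_sub_abs_le_abs_sub (derivWithin f J t) (derivWithin f J b)
      have h4 := mul_le_mul_of_nonneg_left h2 hL.le
      linarith
    set C := 3 * D + 9 * L with hC
    have hC0 : 0 < C := by positivity
    refine ⟨9 * L / m + (C / m) ^ 2, τ, by positivity, hτ, hτ1, hτf, fun t ht η hη hητ =>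
      ⟨derivWithin f J t / f t, fun y hy hy0 => ?_, ?_⟩⟩
    · have ht0 := ha.trans ht.1
      have hft := hge t ht0 (by linarith [ht.2])
      have htJ := hmemJ t ht η hη hητ t ⟨by linarith, by linarith⟩ ht0
      have hft0 : 0 < f t := hτf.trans_le hft
      have h1 := abs_log_sub_log_sub_le hτf hft (hge y hy0 (by linarith [hy.2, ht.2]))
      have h2 := hH.abs_sub_sub_le hβ hL.le hJ htJ (hmemJ t ht η hη hητ y hy hy0)
      have h3 : |y - t| ^ β ≤ 9 * η ^ β := by
        calc |y - t| ^ β ≤ (3 * η) ^ β := by gcongr; exact hdist t η y hη hy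
          _ = 3 ^ β * η ^ β := Real.mul_rpow (by norm_num) hη.le
          _ ≤ (3 : ℝ) ^ (2 : ℝ) * η ^ β := by
            gcongr; norm_num
          _ = _ := by norm_num
      have h4 : |f y - f t - derivWithin f J t * (y - t)| ≤ 9 * L * η ^ β := by
        have := mul_le_mul_of_nonneg_left h3 hL.le
        linarith
      have hη1 : η ^ β ≤ η := by
        calc η ^ β ≤ η ^ (1 : ℝ) :=
            Real.rpow_le_rpow_of_exponent_ge hη (hητ.trans hτ1) hβ.le
          _ = η := Real.rpow_one η
      have hη2 : η ^ 2 ≤ η ^ β := by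
        rw [← Real.rpow_two]
        exact Real.rpow_le_rpow_of_exponent_ge hη (hητ.trans hτ1) hβ₂
      have h5 : |f y - f t| ≤ C * η := by
        have e : f y - f t = (f y - f t - derivWithin f J t * (y - t))
          + derivWithin f J t * (y - t) := by ring
        rw [e]
        refine (abs_add_le _ _).trans ?_
        rw [abs_mul]
        have h6 : |derivWithin f J t| * |y - t| ≤ D * (3 * η) := by
          gcongr
          · exact hDt t ht
          · exact hdist t η y hη hy
        have h7 : 9 * L * η ^ β ≤ 9 * L * η := by gcongr
        rw [hC]; linarith
      have h6 : ((f y - f t) / m) ^ 2 ≤ (C / m) ^ 2 * η ^ β := by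
        calc ((f y - f t) / m) ^ 2 = (|f y - f t| / m) ^ 2 := by
              rw [div_pow, div_pow, sq_abs]
          _ ≤ (C * η / m) ^ 2 := by gcongr
          _ = (C / m) ^ 2 * η ^ 2 := by ring
          _ ≤ _ := by gcongr
      have e : Real.log (f y) - Real.log (f t) - derivWithin f J t / f t * (y - t)
          = (Real.log (f y) - Real.log (f t) - (f y - f t) / f t)
            + (f y - f t - derivWithin f J t * (y - t)) / f t := by
        field_simp; ring
      rw [e]
      refine (abs_add_le _ _).trans ?_
      rw [abs_div, abs_of_pos hft0]
      have h7 : |f y - f t - derivWithin f J t * (y - t)| / f t ≤ 9 * L * η ^ β / m := by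
        gcongr
      have e2 : 9 * L * η ^ β / m = 9 * L / m * η ^ β := by ring
      linarith
    · rcases le_or_gt η t with h | h
      · exact Or.inl h
      right
      have ht0 := ha.trans ht.1
      have ha0 : a = 0 := by
        by_contra hne
        have := hτa (lt_of_le_of_ne ha (Ne.symm hne))
        linarith [ht.1]
      have hft := hge t ht0 (by linarith [ht.2])
      have hft0 : 0 < f t := hτf.trans_le hft
      have htJ := hmemJ t ht η hη hητ t ⟨by linarith, by linarith⟩ ht0
      have h0J : (0 : ℝ) ∈ J := ⟨⟨by linarith, by linarith⟩, by simp⟩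
      have hd0 : derivWithin f J 0 = 0 := by
        rw [hJdef, inter_comm, derivWithin_inter (Icc_mem_nhds (by linarith) (by linarith))]
        exact hzero hβ ha0
      have h1 := (hH.2 hβ).2 0 h0J t htJ
      rw [hd0, sub_zero, sub_zero, abs_of_nonneg ht0] at h1
      have h2 : L * t ^ (β - 1) ≤ L * η ^ (β - 1) := by gcongr
      have h3 : -(derivWithin f J t / f t) ≤ L * η ^ (β - 1) / m := by
        rw [← neg_div]
        calc -derivWithin f J t / f t ≤ L * η ^ (β - 1) / f t := by
              gcongr; linarith [neg_abs_le (derivWithin f J t)]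
          _ ≤ _ := by gcongr
      calc -(derivWithin f J t / f t) * η ≤ L * η ^ (β - 1) / m * η := by gcongr
        _ = L / m * (η ^ (β - 1) * η) := by ring
        _ = L / m * η ^ β := by
          rw [← Real.rpow_add_one hη.ne']; congr 2; ring
        _ ≤ _ := by
          gcongr
          have h4 : 0 ≤ (C / m) ^ 2 := by positivity
          have h5 : 0 ≤ L / m := by positivity
          have e : 9 * L / m = 9 * (L / m) := by ring
          linarith
end Smoothness

/-! ### Decay of log-concave densities -/

namespace IsMonotoneLogConcaveDensity
variable {f : ℝ → ℝ}

lemma aemeasurable (hf : IsMonotoneLogConcaveDensity f) :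
    AEMeasurable f (volume.restrict (Ici 0)) :=
  aemeasurable_restrict_of_antitoneOn measurableSet_Ici hf.antitone

lemma integrableOn (hf : IsMonotoneLogConcaveDensity f) : IntegrableOn f (Ici 0) := by
  refine ⟨hf.aemeasurable.aestronglyMeasurable, ?_⟩
  rw [hasFiniteIntegral_iff_ofReal]
  · rw [hf.lintegral_eq_one]; exact ENNReal.one_lt_top
  · filter_upwards [ae_restrict_mem measurableSet_Ici] with y hy using hf.nonneg y hy

lemma integral_eq_one (hf : IsMonotoneLogConcaveDensity f) : ∫ y in Ici 0, f y = 1 := by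
  rw [integral_eq_lintegral_of_nonneg_ae ?_ hf.aemeasurable.aestronglyMeasurable,
    hf.lintegral_eq_one, ENNReal.toReal_one]
  filter_upwards [ae_restrict_mem measurableSet_Ici] with y hy using hf.nonneg y hy

lemma densityLaw_apply {S : Set ℝ} (hS : MeasurableSet S) (h0 : S ⊆ Ici 0) :
    densityLaw f S = ∫⁻ y in S, ENNReal.ofReal (f y) := by
  rw [densityLaw, withDensity_apply _ hS, Measure.restrict_restrict hS, inter_eq_left.2 h0]

lemma densityLaw_real (hf : IsMonotoneLogConcaveDensity f) {S : Set ℝ} (hS : MeasurableSet S)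
    (h0 : S ⊆ Ici 0) : (densityLaw f).real S = ∫ y in S, f y := by
  rw [measureReal_def, densityLaw_apply hS h0, integral_eq_lintegral_of_nonneg_ae ?_
    (hf.integrableOn.mono_set h0).aestronglyMeasurable]
  filter_upwards [ae_restrict_mem hS] with y hy using hf.nonneg y (h0 hy)

lemma pos_of_pos (hf : IsMonotoneLogConcaveDensity f) {R : ℝ} (hR : 0 < f R) {y : ℝ}
    (hy : y ∈ Icc 0 R) : 0 < f y :=
  hR.trans_le (hf.antitone hy.1 (hy.1.trans hy.2) hy.2)

lemma concaveOn_log (hf : IsMonotoneLogConcaveDensity f) {R : ℝ} (hR : 0 < f R) :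
    ConcaveOn ℝ (Icc 0 R) (fun t => Real.log (f t)) := by
  rw [concaveOn_iff_forall_pos]
  refine ⟨convex_Icc _ _, fun x hx y hy a b ha hb hab => ?_⟩
  have h1 := hf.logConcave x y a b hx.1 hy.1 ha hb hab
  have hfx := hf.pos_of_pos hR hx
  have hfy := hf.pos_of_pos hR hy
  have h2 := Real.log_le_log (by positivity) h1
  rw [Real.log_mul (by positivity) (by positivity), Real.log_rpow hfx, Real.log_rpow hfy] at h2
  exact h2

lemma zero_pos (hf : IsMonotoneLogConcaveDensity f) : 0 < f 0 := by
  by_contra h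
  have h1 : ∀ y ∈ Ici (0 : ℝ), f y = 0 := fun y hy =>
    le_antisymm ((hf.antitone self_mem_Ici hy hy).trans (not_lt.1 h)) (hf.nonneg y hy)
  have := hf.integral_eq_one
  rw [setIntegral_congr_fun measurableSet_Ici h1] at this
  simp at this

/-- A log-concave density on the half-line decays exponentially. -/
lemma exists_le_exp (hf : IsMonotoneLogConcaveDensity f) :
    ∃ C lam : ℝ, 0 < C ∧ 0 < lam ∧ ∀ y, 0 ≤ y → f y ≤ C * Real.exp (-lam * y) := by
  have h0 := hf.zero_pos
  obtain ⟨z, hz, hfz⟩ : ∃ z, 0 < z ∧ f z < f 0 := by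
    by_contra hcon
    push Not at hcon
    have h1 : ∀ y ∈ Ici (0 : ℝ), f 0 ≤ f y := fun y hy => by
      rcases eq_or_lt_of_le (show (0 : ℝ) ≤ y from hy) with h | h
      · rw [h]
      · exact hcon y h
    have h2 : IntegrableOn (fun _ => f 0) (Ici (0 : ℝ)) := by
      refine hf.integrableOn.mono' (by fun_prop) ?_
      filter_upwards [ae_restrict_mem measurableSet_Ici] with y hy
      rw [Real.norm_eq_abs, abs_of_pos h0]
      exact h1 y hy
    rw [integrableOn_const_iff] at h2
    simp [h0.ne'] at h2
  set r := max (f z / f 0) (1 / 2) with hr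
  have hr0 : 0 < r := lt_of_lt_of_le (by norm_num) (le_max_right _ _)
  have hr1 : r < 1 := max_lt ((div_lt_one h0).2 hfz) (by norm_num)
  have hzr : f z ≤ r * f 0 := by rw [← div_le_iff₀ h0]; exact le_max_left _ _
  have hlog : Real.log r < 0 := Real.log_neg hr0 hr1
  have hpow : ∀ y, Real.exp (-(-Real.log r / z) * y) = r ^ (y / z) := fun y => by
    rw [Real.rpow_def_of_pos hr0]; congr 1; ring
  refine ⟨f 0 / r, -Real.log r / z, by positivity, div_pos (neg_pos.2 hlog) hz, fun y hy => ?_⟩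
  rw [hpow]
  rcases le_or_gt y z with hyz | hyz
  · have h1 : r ≤ r ^ (y / z) := by
      calc r = r ^ (1 : ℝ) := (Real.rpow_one r).symm
        _ ≤ _ := Real.rpow_le_rpow_of_exponent_ge hr0 hr1.le ((div_le_one hz).2 hyz)
    calc f y ≤ f 0 := hf.antitone self_mem_Ici hy hy
      _ = f 0 / r * r := by field_simp
      _ ≤ _ := by gcongr
  · have hy0 : 0 < y := hz.trans hyz
    have hzy : z / y < 1 := (div_lt_one hy0).2 hyz
    have h1 := hf.logConcave 0 y (1 - z / y) (z / y) le_rfl hy (by linarith) (by positivity)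
      (by ring)
    have e : (1 - z / y) * 0 + z / y * y = z := by field_simp; ring
    rw [e] at h1
    have h2 : f 0 * (f y / f 0) ^ (z / y) ≤ f 0 * r := by
      rw [Real.div_rpow (hf.nonneg y hy) h0.le]
      rw [Real.rpow_sub h0, Real.rpow_one] at h1
      calc f 0 * (f y ^ (z / y) / f 0 ^ (z / y)) = f 0 / f 0 ^ (z / y) * f y ^ (z / y) := by ring
        _ ≤ f 0 * r := by linarith
    have h3 := le_of_mul_le_mul_left h2 h0
    have hfy0 : 0 ≤ f y / f 0 := div_nonneg (hf.nonneg y hy) h0.le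
    have h4 : f y / f 0 ≤ r ^ (y / z) := by
      calc f y / f 0 = ((f y / f 0) ^ (z / y)) ^ (y / z) := by
            rw [← Real.rpow_mul hfy0]
            have : z / y * (y / z) = 1 := by field_simp
            rw [this, Real.rpow_one]
        _ ≤ r ^ (y / z) := by gcongr
    calc f y = f y / f 0 * f 0 := by field_simp
      _ ≤ r ^ (y / z) * f 0 := by gcongr
      _ = f 0 * r ^ (y / z) := mul_comm _ _
      _ ≤ f 0 / r * r ^ (y / z) := by
        gcongr
        exact le_div_self h0.le hr0 hr1.le

/-- Of the exponential decay only a polynomial tail bound is kept, with a constant that also bounds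
`f`. -/
lemma exists_tail_bound (hf : IsMonotoneLogConcaveDensity f) :
    ∃ A : ℝ, 1 ≤ A ∧ (∀ y, 0 ≤ y → f y ≤ A) ∧
      ∀ t, 0 ≤ t → ∫ y in Ici t, f y ≤ A / (1 + t) ^ 4 := by
  obtain ⟨C, lam, hC, hlam, hle⟩ := hf.exists_le_exp
  set A₀ := C / lam * (24 * Real.exp lam / lam ^ 4) with hA₀
  refine ⟨max 1 (max (f 0) A₀), le_max_left _ _, fun y hy =>
    (hf.antitone self_mem_Ici hy hy).trans ((le_max_left _ _).trans (le_max_right _ _)),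
    fun t ht => ?_⟩
  have h1 : ∫ y in Ici t, f y ≤ ∫ y in Ici t, C * Real.exp (-lam * y) := by
    refine setIntegral_mono_on (hf.integrableOn.mono_set (Ici_subset_Ici.2 ht)) ?_
      measurableSet_Ici fun y hy => hle y (ht.trans hy)
    rw [integrableOn_Ici_iff_integrableOn_Ioi]
    exact (integrableOn_exp_mul_Ioi (by linarith) t).const_mul C
  have h2 : ∫ y in Ici t, C * Real.exp (-lam * y) = C / lam * Real.exp (-lam * t) := by
    rw [integral_const_mul, integral_Ici_eq_integral_Ioi, integral_exp_mul_Ioi (by linarith) t]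
    field_simp
  have h3 : Real.exp (-lam * t) ≤ 24 * Real.exp lam / lam ^ 4 / (1 + t) ^ 4 := by
    have h4 := Real.pow_div_factorial_le_exp (x := lam * (1 + t)) (by positivity) 4
    have e : Real.exp (-lam * t) = Real.exp lam / Real.exp (lam * (1 + t)) := by
      rw [← Real.exp_sub]; congr 1; ring
    rw [e, div_div, div_le_div_iff₀ (Real.exp_pos _) (by positivity)]
    have e2 : ((Nat.factorial 4 : ℕ) : ℝ) = 24 := by norm_num [Nat.factorial]
    rw [e2, mul_pow, div_le_iff₀ (by norm_num)] at h4
    have := mul_le_mul_of_nonneg_left h4 (Real.exp_pos lam).le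
    linarith
  rw [h2] at h1
  refine h1.trans ?_
  calc C / lam * Real.exp (-lam * t) ≤ C / lam * (24 * Real.exp lam / lam ^ 4 / (1 + t) ^ 4) := by
        gcongr
    _ = A₀ / (1 + t) ^ 4 := by rw [hA₀]; ring
    _ ≤ _ := by
      gcongr
      exact (le_max_right _ _).trans (le_max_right _ _)

lemma ae_pos (hf : IsMonotoneLogConcaveDensity f) :
    ∀ᵐ y ∂(densityLaw f), 0 < y ∧ 0 < f y := by
  set S : Set ℝ := {y | 0 ≤ y ∧ f y ≤ 0} with hS
  have hSm : MeasurableSet S := by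
    have : S.OrdConnected := ⟨fun y hy z hz w hw => ⟨hy.1.trans hw.1,
      (hf.antitone hy.1 (hy.1.trans hw.1) hw.1).trans hy.2⟩⟩
    exact this.measurableSet
  have h1 : densityLaw f S = 0 := by
    rw [densityLaw_apply hSm fun y hy => hy.1]
    rw [setLIntegral_congr_fun (g := fun _ => 0) hSm fun y hy => ENNReal.ofReal_eq_zero.2 hy.2]
    simp
  have h2 : densityLaw f (Iic 0) = 0 := by
    rw [densityLaw, withDensity_apply _ measurableSet_Iic,
      Measure.restrict_restrict measurableSet_Iic]
    have : Iic (0 : ℝ) ∩ Ici 0 = {0} := by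
      ext y; simp only [mem_inter_iff, mem_Iic, mem_Ici, mem_singleton_iff]
      exact ⟨fun h => le_antisymm h.1 h.2, fun h => by simp [h]⟩
    rw [this]
    simp
  have h3 : densityLaw f (Iic 0 ∪ S) = 0 := measure_union_null h2 h1
  refine measure_mono_null (fun y hy => ?_) h3
  by_contra hcon
  simp only [mem_union, mem_Iic, not_or, not_le] at hcon
  refine hy ⟨hcon.1, ?_⟩
  by_contra hle
  exact hcon.2 ⟨hcon.1.le, not_lt.1 hle⟩

end IsMonotoneLogConcaveDensity

/-! ### Bernstein's inequality for empirical masses -/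

section Probability
variable {Ω : Type*} [MeasurableSpace Ω] {P : Measure Ω} {X : ℕ → Ω → ℝ} {ν : Measure ℝ} {S : Set ℝ}

lemma integral_indicator_one_comp {Y : Ω → ℝ} (hY : AEMeasurable Y P) (hl : P.map Y = ν)
    (hS : MeasurableSet S) : ∫ ω, S.indicator (1 : ℝ → ℝ) (Y ω) ∂P = ν.real S := by
  have hm : Measurable (S.indicator (1 : ℝ → ℝ)) := measurable_one.indicator hS
  rw [← integral_map hY hm.aestronglyMeasurable, hl, integral_indicator_one hS]

variable [IsProbabilityMeasure P]

lemma mgf_indicator_le {Y : Ω → ℝ} (hY : AEMeasurable Y P) (hl : P.map Y = ν)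
    (hS : MeasurableSet S) {lam : ℝ} (hlam : |lam| ≤ 1) :
    mgf (fun ω => S.indicator (1 : ℝ → ℝ) (Y ω)) P lam
      ≤ Real.exp (ν.real S * (lam + lam ^ 2)) := by
  have hm : Measurable (S.indicator (1 : ℝ → ℝ)) := measurable_one.indicator hS
  have hint : Integrable (fun ω => S.indicator (1 : ℝ → ℝ) (Y ω)) P := by
    refine Integrable.of_bound (hm.comp_aemeasurable hY).aestronglyMeasurable 1
      (Eventually.of_forall fun ω => ?_)
    by_cases h : Y ω ∈ S
    · rw [indicator_of_mem h]; simp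
    · rw [indicator_of_notMem h]; simp
  have e : ∀ ω, Real.exp (lam * S.indicator (1 : ℝ → ℝ) (Y ω))
      = 1 + (Real.exp lam - 1) * S.indicator (1 : ℝ → ℝ) (Y ω) := fun ω => by
    by_cases h : Y ω ∈ S
    · rw [indicator_of_mem h]; simp
    · rw [indicator_of_notMem h]; simp
  rw [mgf]
  simp only [e]
  rw [integral_add (integrable_const _) (hint.const_mul _), integral_const_mul,
    integral_indicator_one_comp hY hl hS]
  simp only [integral_const, probReal_univ, smul_eq_mul, mul_one]
  have h1 := (abs_le.1 (Real.abs_exp_sub_one_sub_id_le hlam)).2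
  have h2 : (Real.exp lam - 1) * ν.real S ≤ (lam + lam ^ 2) * ν.real S := by
    gcongr; linarith
  have h3 := Real.add_one_le_exp (ν.real S * (lam + lam ^ 2))
  linarith

/-- The parameter in the Chernoff bound: `√(s / v)` for a variance `v` above `s`, otherwise `1`. -/
lemma exists_chernoff_parameter {v s : ℝ} (hs : 0 < s) :
    ∃ lam : ℝ, 0 < lam ∧ lam ≤ 1 ∧ v * lam ^ 2 ≤ s ∧ s ≤ lam * (√(v * s) + s) := by
  rcases le_total v s with h | h
  · refine ⟨1, one_pos, le_rfl, by linarith, ?_⟩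
    have := Real.sqrt_nonneg (v * s)
    linarith
  · have hv0 : 0 < v := hs.trans_le h
    refine ⟨√(s / v), by positivity, ?_, ?_, ?_⟩
    · exact Real.sqrt_le_one.2 ((div_le_one hv0).2 h)
    · rw [Real.sq_sqrt (by positivity)]; exact (mul_div_cancel₀ s hv0.ne').le
    · rw [mul_add, ← Real.sqrt_mul (by positivity)]
      have e : s / v * (v * s) = s ^ 2 := by field_simp
      rw [e, Real.sqrt_sq hs.le]
      have : 0 ≤ √(s / v) * s := by positivity
      linarith

/-- Bernstein's inequality for the empirical mass of a set. -/
lemma measureReal_lt_abs_empMean_sub_le (hXm : ∀ i, AEMeasurable (X i) P) (hXi : iIndepFun X P)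
    (hXl : ∀ i, P.map (X i) = ν) (hS : MeasurableSet S) {n : ℕ} (hn : n ≠ 0) {s C : ℝ}
    (hs : 0 < s) (hC : 0 ≤ C) :
    P.real {ω | C * (√(s / n * ν.real S) + s / n)
        < |empMean (fun i : Fin n => X i ω) (S.indicator 1) - ν.real S|}
      ≤ 2 * Real.exp (-(C - 1) * s) := by
  have hn0 : (0 : ℝ) < n := by positivity
  set p := ν.real S with hp
  have hp0 : 0 ≤ p := measureReal_nonneg
  obtain ⟨lam, hlam0, hlam1, hlam2, hlam3⟩ := exists_chernoff_parameter
    (v := n * p) hs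
  have hm : Measurable (S.indicator (1 : ℝ → ℝ)) := measurable_one.indicator hS
  set Z : ℕ → Ω → ℝ := fun i ω => S.indicator (1 : ℝ → ℝ) (X i ω) with hZ
  have hZm : ∀ i, AEMeasurable (Z i) P := fun i => hm.comp_aemeasurable (hXm i)
  have hZi : iIndepFun Z P := hXi.comp (fun _ => S.indicator (1 : ℝ → ℝ)) fun _ => hm
  set T : Ω → ℝ := ∑ i ∈ Finset.range n, Z i with hT
  have hmgf : ∀ l : ℝ, |l| ≤ 1 → mgf T P l ≤ Real.exp (n * p * (l + l ^ 2)) := fun l hl => by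
    rw [hT, hZi.mgf_sum₀ hZm]
    calc ∏ i ∈ Finset.range n, mgf (Z i) P l
        ≤ ∏ _i ∈ Finset.range n, Real.exp (p * (l + l ^ 2)) :=
          Finset.prod_le_prod (fun i _ => mgf_nonneg) fun i _ =>
            mgf_indicator_le (hXm i) (hXl i) hS hl
      _ = _ := by
        rw [Finset.prod_const, Finset.card_range, ← Real.exp_nat_mul]; congr 1; ring
  have hint : ∀ l : ℝ, Integrable (fun ω => Real.exp (l * T ω)) P := fun l => by
    refine Integrable.of_bound ((Finset.aemeasurable_sum _ fun i _ => hZm i).const_mul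
      l).exp.aestronglyMeasurable (Real.exp (|l| * n)) (Eventually.of_forall fun ω => ?_)
    rw [Real.norm_eq_abs, Real.abs_exp]
    refine Real.exp_le_exp.2 ((le_abs_self _).trans ?_)
    rw [abs_mul]
    gcongr
    rw [hT, Finset.sum_apply]
    calc |∑ i ∈ Finset.range n, Z i ω| ≤ ∑ i ∈ Finset.range n, |Z i ω| :=
          Finset.abs_sum_le_sum_abs _ _
      _ ≤ ∑ _i ∈ Finset.range n, (1 : ℝ) := Finset.sum_le_sum fun i _ => by
          by_cases h : X i ω ∈ S
          · simp [hZ, h]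
          · simp [hZ, h]
      _ = n := by simp
  set w := C * (√(n * p * s) + s) with hw
  have hwlam : C * s ≤ lam * w := by
    have := mul_le_mul_of_nonneg_left hlam3 hC
    rw [hw]; linarith
  have hup : P.real {ω | n * p + w ≤ T ω} ≤ Real.exp (-(C - 1) * s) := by
    refine (measure_ge_le_exp_mul_mgf _ hlam0.le (hint lam)).trans ?_
    calc _ ≤ Real.exp (-lam * (n * p + w)) * Real.exp (n * p * (lam + lam ^ 2)) := by
          gcongr
          exact hmgf lam (by rw [abs_of_pos hlam0]; exact hlam1)
      _ = Real.exp (-lam * (n * p + w) + n * p * (lam + lam ^ 2)) := (Real.exp_add _ _).symm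
      _ ≤ _ := Real.exp_le_exp.2 (by linarith)
  have hlow : P.real {ω | T ω ≤ n * p - w} ≤ Real.exp (-(C - 1) * s) := by
    refine (measure_le_le_exp_mul_mgf _ (neg_nonpos.2 hlam0.le) (hint (-lam))).trans ?_
    calc _ ≤ Real.exp (-(-lam) * (n * p - w)) * Real.exp (n * p * (-lam + (-lam) ^ 2)) := by
          gcongr
          exact hmgf (-lam) (by rw [abs_neg, abs_of_pos hlam0]; exact hlam1)
      _ = Real.exp (-(-lam) * (n * p - w) + n * p * (-lam + (-lam) ^ 2)) :=
          (Real.exp_add _ _).symm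
      _ ≤ _ := Real.exp_le_exp.2 (by rw [neg_sq]; linarith)
  have hsub : {ω | C * (√(s / n * p) + s / n)
        < |empMean (fun i : Fin n => X i ω) (S.indicator 1) - p|}
      ⊆ {ω | n * p + w ≤ T ω} ∪ {ω | T ω ≤ n * p - w} := by
    intro ω hω
    have e1 : empMean (fun i : Fin n => X i ω) (S.indicator 1) = T ω / n := by
      simp only [empMean, hT, Finset.sum_apply, hZ, Finset.sum_range]
    have e2 : √(s / n * p) = √(n * p * s) / n := by
      have : s / n * p = n * p * s / n ^ 2 := by field_simp
      rw [this, Real.sqrt_div (by positivity), Real.sqrt_sq hn0.le]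
    have e3 : C * (√(s / n * p) + s / n) = w / n := by rw [e2, hw]; ring
    simp only [mem_ofPred_eq] at hω
    rw [e1, e3] at hω
    have e4 : T ω / n - p = (T ω - n * p) / n := by field_simp
    rw [e4, abs_div, abs_of_pos hn0, div_lt_div_iff_of_pos_right hn0] at hω
    rcases lt_abs.1 hω with h | h
    · left; change n * p + w ≤ T ω; linarith
    · right; change T ω ≤ n * p - w; linarith
  calc _ ≤ P.real ({ω | n * p + w ≤ T ω} ∪ {ω | T ω ≤ n * p - w}) :=
        measureReal_mono hsub (measure_ne_top _ _)
    _ ≤ _ := measureReal_union_le _ _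
    _ ≤ _ := by linarith

end Probability

/-! ### From a grid of intervals to all intervals -/

lemma empMean_mono {n : ℕ} {x : Fin n → ℝ} {h k : ℝ → ℝ} (hhk : ∀ t, h t ≤ k t) :
    empMean x h ≤ empMean x k := by
  unfold empMean
  gcongr
  exact hhk _

namespace IsMonotoneLogConcaveDensity
variable {f : ℝ → ℝ}

lemma isProbabilityMeasure (hf : IsMonotoneLogConcaveDensity f) :
    IsProbabilityMeasure (densityLaw f) := by
  constructor
  rw [densityLaw, withDensity_apply _ MeasurableSet.univ, Measure.restrict_univ,
    hf.lintegral_eq_one]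

lemma measureReal_Icc_le (hf : IsMonotoneLogConcaveDensity f) {A u v : ℝ}
    (hA : ∀ y, 0 ≤ y → f y ≤ A) (hu : 0 ≤ u) (huv : u ≤ v) :
    (densityLaw f).real (Icc u v) ≤ A * (v - u) := by
  have hsub : Icc u v ⊆ Ici 0 := fun y hy => hu.trans hy.1
  rw [hf.densityLaw_real measurableSet_Icc hsub]
  calc ∫ y in Icc u v, f y ≤ ∫ y in Icc u v, A :=
        setIntegral_mono_on (hf.integrableOn.mono_set hsub) (by simp) measurableSet_Icc
          fun t ht => hA t (hsub ht)
    _ = _ := by simp [huv, mul_comm]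

/-- If the empirical masses of the closed intervals with end points in the grid `ℕ / n` are close
to the true ones, then so are those of all intervals: compare with the next larger and the next
smaller grid interval, whose masses differ by at most `2 * A / n`. -/
lemma abs_empMean_sub_le_of_grid (hf : IsMonotoneLogConcaveDensity f) {n : ℕ} (hn : n ≠ 0)
    {x : Fin n → ℝ} {A C ρ : ℝ} (hA1 : 1 ≤ A) (hA : ∀ y, 0 ≤ y → f y ≤ A) (hC : 0 ≤ C)
    (hρn : 1 / n ≤ ρ)
    (hgrid : ∀ k l : ℕ, k ≤ n ^ 2 + 1 → l ≤ n ^ 2 + 1 →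
      |empMean x ((Icc (k / n : ℝ) (l / n)).indicator 1)
          - (densityLaw f).real (Icc (k / n : ℝ) (l / n))|
        ≤ C * (√(ρ * (densityLaw f).real (Icc (k / n : ℝ) (l / n))) + ρ))
    {J : Set ℝ} (hJ : J ⊆ Icc 0 n) (hJc : J.OrdConnected) :
    |empMean x (J.indicator 1) - ∫ y in J, f y|
      ≤ (C + 2 * A + 2 * A * C) * (√(ρ * ∫ y in J, f y) + ρ) := by
  have hprob := hf.isProbabilityMeasure
  have hn0 : (0 : ℝ) < n := by positivity
  have hρ : 0 < ρ := lt_of_lt_of_le (by positivity) hρn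
  rcases J.eq_empty_or_nonempty with rfl | hne
  · simp only [indicator_empty, Measure.restrict_empty, integral_zero_measure, mul_zero,
      Real.sqrt_zero, zero_add, sub_zero]
    have : empMean x (fun _ => (0 : ℝ)) = 0 := by simp [empMean]
    rw [this, abs_zero]
    positivity
  have hbb : BddBelow J := ⟨0, fun y hy => (hJ hy).1⟩
  have hba : BddAbove J := ⟨n, fun y hy => (hJ hy).2⟩
  have hJ0 : J ⊆ Ici 0 := fun y hy => (hJ hy).1
  rw [← hf.densityLaw_real hJc.measurableSet hJ0]
  set μ := densityLaw f with hμ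
  set i := sInf J with hi
  set s := sSup J with hs
  have hi0 : 0 ≤ i := le_csInf hne fun y hy => (hJ hy).1
  have hsn : s ≤ n := csSup_le hne fun y hy => (hJ hy).2
  have his : i ≤ s := csInf_le_csSup hne hbb hba
  set k := ⌊n * i⌋₊ with hk
  set l := ⌈n * s⌉₊ with hl
  have hk1 : (k / n : ℝ) ≤ i := by
    rw [div_le_iff₀ hn0, mul_comm]; exact Nat.floor_le (by positivity)
  have hk2 : i < ((k + 1 : ℕ) / n : ℝ) := by
    rw [lt_div_iff₀ hn0, mul_comm]; push_cast; exact Nat.lt_floor_add_one _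
  have hl1 : s ≤ (l / n : ℝ) := by
    rw [le_div_iff₀ hn0, mul_comm]; exact Nat.le_ceil _
  have hl2 : ∀ y, i < y → y ≤ ((l - 1 : ℕ) / n : ℝ) → y < s := fun y hy hyl => by
    have hs0 : 0 < l := by
      by_contra hcon
      have : l = 0 := by omega
      rw [this] at hyl
      simp only [zero_tsub, Nat.cast_zero, zero_div] at hyl
      linarith
    have h1 : ((l - 1 : ℕ) : ℝ) < n * s := Nat.lt_ceil.1 (Nat.sub_one_lt hs0.ne')
    refine hyl.trans_lt ?_
    rw [div_lt_iff₀ hn0]; linarith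
  have hln : l ≤ n ^ 2 := by
    refine Nat.ceil_le.2 ?_
    push_cast
    calc n * s ≤ n * n := by gcongr
      _ = (n : ℝ) ^ 2 := by ring
  have hkn : k ≤ n ^ 2 := by
    refine le_trans (Nat.floor_le_ceil _) (le_trans (Nat.ceil_le_ceil ?_) hln)
    gcongr
  set O := Icc (k / n : ℝ) (l / n) with hO
  set I := Icc ((k + 1 : ℕ) / n : ℝ) ((l - 1 : ℕ) / n) with hI
  have hJO : J ⊆ O := fun y hy => ⟨hk1.trans (csInf_le hbb hy), (le_csSup hba hy).trans hl1⟩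
  have hIJ : I ⊆ J := fun y hy => by
    have h1 : i < y := hk2.trans_le hy.1
    have h2 : y < s := hl2 y h1 hy.2
    obtain ⟨u, hu, huy⟩ := exists_lt_of_csInf_lt hne h1
    obtain ⟨v, hv, hyv⟩ := exists_lt_of_lt_csSup hne h2
    exact hJc.out hu hv ⟨huy.le, hyv.le⟩
  have hOI : μ.real O ≤ μ.real I + 2 * A / n := by
    have hsub : O ⊆ I ∪ (Icc (k / n : ℝ) ((k + 1 : ℕ) / n) ∪ Icc ((l - 1 : ℕ) / n : ℝ) (l / n)) := by
      intro y hy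
      rcases le_or_gt y ((k + 1 : ℕ) / n : ℝ) with h | h
      · exact Or.inr (Or.inl ⟨hy.1, h⟩)
      rcases le_or_gt y ((l - 1 : ℕ) / n : ℝ) with h' | h'
      · exact Or.inl ⟨h.le, h'⟩
      · exact Or.inr (Or.inr ⟨h'.le, hy.2⟩)
    have h1 : μ.real (Icc (k / n : ℝ) ((k + 1 : ℕ) / n)) ≤ A / n := by
      refine (hf.measureReal_Icc_le hA (by positivity) (by gcongr; omega)).trans (le_of_eq ?_)
      push_cast; ring
    have h2 : μ.real (Icc ((l - 1 : ℕ) / n : ℝ) (l / n)) ≤ A / n := by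
      refine (hf.measureReal_Icc_le hA (by positivity) (by gcongr; omega)).trans ?_
      rw [← sub_div, mul_div_assoc']
      have h3 : (l : ℝ) ≤ ((l - 1 : ℕ) : ℝ) + 1 := by
        exact_mod_cast (by omega : l ≤ l - 1 + 1)
      gcongr
      exact mul_le_of_le_one_right (by linarith) (by linarith)
    have h3 := (measureReal_mono hsub (measure_ne_top μ _)).trans (measureReal_union_le _ _)
    have h4 := measureReal_union_le (μ := μ) (Icc (k / n : ℝ) ((k + 1 : ℕ) / n))
      (Icc ((l - 1 : ℕ) / n : ℝ) (l / n))
    have e : 2 * A / n = A / n + A / n := by ring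
    linarith
  have hAn : 2 * A / n ≤ 2 * A * ρ := by
    calc 2 * A / n = 2 * A * (1 / n) := by ring
      _ ≤ _ := by gcongr
  have hIm : μ.real I ≤ μ.real J := measureReal_mono hIJ (measure_ne_top _ _)
  have hJm : μ.real J ≤ μ.real O := measureReal_mono hJO (measure_ne_top _ _)
  have hJ0' : 0 ≤ μ.real J := measureReal_nonneg
  set z := √(ρ * μ.real J) with hz
  have hz0 : 0 ≤ z := Real.sqrt_nonneg _
  have hOz : √(ρ * μ.real O) ≤ z + 2 * A * ρ := by
    rw [Real.sqrt_le_left (by positivity)]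
    have h1 : z ^ 2 = ρ * μ.real J := Real.sq_sqrt (by positivity)
    have h2 : ρ * μ.real O ≤ ρ * (μ.real J + 2 * A * ρ) := by gcongr; linarith
    have h3 : 0 ≤ z * (2 * A * ρ) := by positivity
    have h4 : 2 * A * ρ ^ 2 ≤ (2 * A) * (2 * A) * ρ ^ 2 := by
      have h5 : 2 * A ≤ (2 * A) * (2 * A) := le_mul_of_one_le_left (by linarith) (by linarith)
      exact mul_le_mul_of_nonneg_right h5 (sq_nonneg ρ)
    linarith
  have hIz : √(ρ * μ.real I) ≤ z := Real.sqrt_le_sqrt (by gcongr)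
  have hup := (abs_le.1 (hgrid k l (by omega) (by omega))).2
  have hlow := (abs_le.1 (hgrid (k + 1) (l - 1) (by omega) (by omega))).1
  have he1 : empMean x (J.indicator 1) ≤ empMean x (O.indicator 1) :=
    empMean_mono fun t => indicator_le_indicator_of_subset hJO (fun _ => zero_le_one) t
  have he2 : empMean x (I.indicator 1) ≤ empMean x (J.indicator 1) :=
    empMean_mono fun t => indicator_le_indicator_of_subset hIJ (fun _ => zero_le_one) t
  have hb1 : C * (√(ρ * μ.real O) + ρ) ≤ C * (z + 2 * A * ρ + ρ) := by gcongr
  have hb2 : C * (√(ρ * μ.real I) + ρ) ≤ C * (z + ρ) := by gcongr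
  have hb3 : 0 ≤ (2 * A + 2 * A * C) * z := by positivity
  have hb4 : 0 ≤ 2 * A * C * ρ := by positivity
  rw [abs_le]
  constructor <;> linarith

end IsMonotoneLogConcaveDensity

/-! ### The rate of convergence on typical samples -/

/-- The empirical masses of the closed intervals with end points in the grid `ℕ / n` obey the
Bernstein bound at noise level `ρ`. -/
def GridDev (f : ℝ → ℝ) {n : ℕ} (x : Fin n → ℝ) (C ρ : ℝ) : Prop :=
  ∀ k l : ℕ, k ≤ n ^ 2 + 1 → l ≤ n ^ 2 + 1 →
    |empMean x ((Icc (k / n : ℝ) (l / n)).indicator 1)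
        - (densityLaw f).real (Icc (k / n : ℝ) (l / n))|
      ≤ C * (√(ρ * (densityLaw f).real (Icc (k / n : ℝ) (l / n))) + ρ)

namespace IsMonotoneLogConcaveDensity
variable {f : ℝ → ℝ}

/-- A sample that obeys the Bernstein bounds on the grid, and does not exceed `T ≤ ρ ^ (-1 / 2)`, is
typical on `[0, max x i]`. The mass of `[B, B']` is large enough for a sample point to lie there,
so that `B ≤ max x i`. -/
lemma exists_isTypical (hf : IsMonotoneLogConcaveDensity f) {n : ℕ} (hn : n ≠ 0)
    {x : Fin n → ℝ} {A C ρ T B B' : ℝ} (hA1 : 1 ≤ A) (hA : ∀ y, 0 ≤ y → f y ≤ A)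
    (htail : ∀ t, 0 ≤ t → ∫ y in Ici t, f y ≤ A / (1 + t) ^ 4) (hC : 0 ≤ C)
    (hρn : 1 / n ≤ ρ) (hx : ∀ i, 0 < x i ∧ 0 < f (x i)) (hxT : ∀ i, x i ≤ T)
    (hT : ρ * T ^ 2 ≤ 1) (hTn : T ≤ n) (hgrid : GridDev f x C ρ)
    (hB : 0 ≤ B) (hBB : B ≤ B') (hB' : 0 < f B') (hBn : B' ≤ n)
    (hmass : (C + 2 * A + 2 * A * C) * (√(ρ * ∫ y in Icc B B', f y) + ρ) < ∫ y in Icc B B', f y) :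
    ∃ j, (∀ i, x i ≤ x j) ∧
      IsTypical x (x j) f ρ (C + 2 * A + 2 * A * C) (min 1 (f B')) B := by
  have : Nonempty (Fin n) := ⟨⟨0, Nat.pos_of_ne_zero hn⟩⟩
  obtain ⟨j, hj⟩ := Finite.exists_max x
  have hn0 : (0 : ℝ) < n := by positivity
  have hρ : 0 < ρ := lt_of_lt_of_le (by positivity) hρn
  have hdev := fun (J : Set ℝ) (hJ : J ⊆ Icc 0 (n : ℝ)) (hJc : J.OrdConnected) =>
    hf.abs_empMean_sub_le_of_grid hn hA1 hA hC hρn hgrid hJ hJc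
  have hAC : 0 ≤ A * C := by positivity
  have hAA : A ≤ C + 2 * A + 2 * A * C := by linarith
  have hsub : Icc 0 (x j) ⊆ Icc 0 (n : ℝ) := Icc_subset_Icc_right ((hxT j).trans hTn)
  refine ⟨j, hj, ⟨hn, by linarith, lt_min one_pos hB', min_le_left _ _, hρ, ?_, ?_,
    fun i => ⟨(hx i).1.le, hj i⟩, fun t ht => hf.pos_of_pos (hx j).2 ht,
    fun t ht => (hA t ht.1).trans hAA, fun t ht => (min_le_right _ _).trans
      (hf.antitone ht.1 (hB.trans hBB) (ht.2.trans hBB)),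
    hf.antitone.mono fun t ht => ht.1, hf.concaveOn_log (hx j).2, fun t ht => ?_,
    fun J hJ hJc => hdev J (hJ.trans hsub) hJc⟩⟩
  · -- the interval `[B, B']` contains a point of the sample
    by_contra hcon
    have h1 : empMean x ((Icc B B').indicator 1) = 0 := by
      simp only [empMean]
      rw [Finset.sum_eq_zero, zero_div]
      intro i _
      exact indicator_of_notMem (fun h => hcon (h.1.trans (hj i))) _
    have h2 := (abs_le.1 (hdev (Icc B B') (Icc_subset_Icc hB hBn) ordConnected_Icc)).1
    rw [h1] at h2
    linarith
  · have hxj := (hx j).1.le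
    refine le_trans ?_ hT
    gcongr
    exact hxT j
  · have h1 : ∫ y in Icc t (x j), f y ≤ ∫ y in Ici t, f y := by
      refine setIntegral_mono_set (hf.integrableOn.mono_set (Ici_subset_Ici.2 ht.1)) ?_
        Icc_subset_Ici_self.eventuallyLE
      filter_upwards [ae_restrict_mem measurableSet_Ici] with y hy
      exact hf.nonneg y (ht.1.trans hy)
    refine (h1.trans (htail t ht.1)).trans ?_
    have := ht.1
    gcongr

end IsMonotoneLogConcaveDensity

lemma tendsto_log_pow_div_atTop (k : ℕ) :
    Tendsto (fun n : ℕ => Real.log n ^ k / n) atTop (𝓝 0) := by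
  have := (Real.tendsto_pow_log_div_mul_add_atTop 1 0 k one_ne_zero).comp
    tendsto_natCast_atTop_atTop
  simpa [Function.comp_def] using this

lemma tendsto_log_div_atTop : Tendsto (fun n : ℕ => Real.log n / n) atTop (𝓝 0) := by
  simpa using tendsto_log_pow_div_atTop 1

lemma one_le_log_of_three_le {n : ℕ} (hn : 3 ≤ n) : 1 ≤ Real.log n := by
  rw [Real.le_log_iff_exp_le (by positivity)]
  have h1 := Real.exp_one_lt_d9
  have h2 : (3 : ℝ) ≤ n := by exact_mod_cast hn
  linarith

/-- The deterministic part of the theorem: for large `n`, the rate of convergence holds for every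
sample that lies in `(0, (log n / n) ^ (-1 / 2)]` and satisfies the Bernstein bounds. -/
theorem exists_abs_densityMLE_sub_le {f : ℝ → ℝ} (hf : IsMonotoneLogConcaveDensity f)
    {β L : ℝ} (hβ₁ : 1 ≤ β) (hβ₂ : β ≤ 2) (hL : 0 < L)
    {a b δ : ℝ} (ha : 0 ≤ a) (hab : a ≤ b) (hpos : 0 < f b) (hδ : 0 < δ)
    (hH : HolderClass β L (Icc (a - δ) (b + δ) ∩ Ici 0) f)
    (hzero : 1 < β → a = 0 → derivWithin f (Ici 0) 0 = 0) {C : ℝ} (hC : 0 ≤ C) :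
    ∃ M : ℝ, 0 < M ∧ ∀ᶠ n : ℕ in atTop, ∀ x : Fin n → ℝ, (∀ i, 0 < x i ∧ 0 < f (x i)) →
      (∀ i, x i ≤ (√(Real.log n / n))⁻¹) → GridDev f x C (Real.log n / n) →
      ∀ t ∈ Icc a b, |densityMLE x t - f t| ≤ M * (Real.log n / n) ^ (β / (2 * β + 1)) := by
  obtain ⟨A, hA1, hA, htail⟩ := hf.exists_tail_bound
  obtain ⟨K, τ₀, hK, hτ₀, hτ₀1, hfτ, happrox⟩ :=
    exists_affine_approx hf hβ₁ hβ₂ hL ha hab hpos hδ hH hzero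
  -- `b + 5 * τ` lies strictly to the left of `b + 5 * τ₀`, where `f` is still positive
  set τ := 5 * τ₀ / 6 with hτ
  have hτ0 : 0 < τ := by positivity
  set B := b + 5 * τ with hB
  set B' := b + 5 * τ₀ with hB'
  have hBB : B < B' := by linarith
  have hB0 : 0 ≤ B := by linarith
  set A' := C + 2 * A + 2 * A * C with hA'
  set m := min 1 (f B') with hm
  have hm0 : 0 < m := lt_min one_pos hfτ
  have hAC : 0 ≤ A * C := by positivity
  have hA'0 : 0 < A' := by linarith
  have hAA : A ≤ A' := by linarith
  set C₀ := 2400 / m * (16 * A' ^ 2 / (m * τ ^ 2)) ^ 2 with hC₀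
  -- at scale `η = Q * ρ ^ γ` the error is `ε = 8 * K * η ^ β`; the bound `Q > C₀ / K ^ 2` makes
  -- `ε ^ 2 * η` too large for an interval of length `η`, and `Q ≥ 9` gives `9 * ρ ≤ η`
  set Q := max 9 (C₀ / K ^ 2 + 1) with hQ
  have hQ9 : 9 ≤ Q := le_max_left _ _
  have hQ1 : 1 ≤ Q := by linarith
  set γ := 1 / (2 * β + 1) with hγ
  have hβ0 : 0 < β := by linarith
  have hγ0 : 0 < γ := by positivity
  have hγ1 : γ ≤ 1 := by rw [hγ, div_le_one (by positivity)]; linarith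
  set p := ∫ y in Icc B B', f y with hp
  have hp0 : 0 < p := by
    have hsub : Icc B B' ⊆ Ici 0 := fun y hy => hB0.trans hy.1
    have h1 : ∫ y in Icc B B', f B' ≤ p :=
      setIntegral_mono_on (by simp) (hf.integrableOn.mono_set hsub) measurableSet_Icc
        fun y hy => hf.antitone (hB0.trans hy.1) (hB0.trans hBB.le) hy.2
    have h2 : ∫ y in Icc B B', f B' = f B' * (B' - B) := by simp [hBB.le, mul_comm]
    rw [h2] at h1
    exact (mul_pos hfτ (sub_pos.2 hBB)).trans_le h1
  set M := A' * (2 * (8 * K * Q ^ β)) with hM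
  have hρlim := tendsto_log_div_atTop
  have hlim : ∀ c : ℝ, 0 < c → Tendsto (fun n : ℕ => (Real.log n / n) ^ c) atTop (𝓝 0) :=
    fun c hc => by
      have := hρlim.rpow_const (p := c) (Or.inr hc.le)
      rwa [Real.zero_rpow hc.ne'] at this
  have hev1 : ∀ᶠ n : ℕ in atTop, A' * (√(Real.log n / n * p) + Real.log n / n) < p := by
    have h1 : Tendsto (fun n : ℕ => A' * (√(Real.log n / n * p) + Real.log n / n)) atTop
        (𝓝 (A' * (√(0 * p) + 0))) :=
      (((hρlim.mul_const p).sqrt).add hρlim).const_mul A'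
    simp only [zero_mul, Real.sqrt_zero, add_zero, mul_zero] at h1
    exact h1.eventually (eventually_lt_nhds hp0)
  have hev2 : ∀ᶠ n : ℕ in atTop, Q * (Real.log n / n) ^ γ ≤ τ := by
    have h1 := (hlim γ hγ0).const_mul Q
    rw [mul_zero] at h1
    exact h1.eventually (eventually_le_nhds hτ0)
  have hev3 : ∀ᶠ n : ℕ in atTop, 8 * K * Q ^ β * (Real.log n / n) ^ (β / (2 * β + 1)) ≤ 1 := by
    have h1 := (hlim (β / (2 * β + 1)) (by positivity)).const_mul (8 * K * Q ^ β)
    rw [mul_zero] at h1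
    exact h1.eventually (eventually_le_nhds one_pos)
  have hev4 : ∀ᶠ n : ℕ in atTop, Real.log n / n ≤ 1 :=
    hρlim.eventually (eventually_le_nhds one_pos)
  refine ⟨M, by positivity, ?_⟩
  filter_upwards [hev1, hev2, hev3, hev4, eventually_ge_atTop 3,
    tendsto_natCast_atTop_atTop.eventually_ge_atTop B'] with n h1 h2 h3 h4 hn3 hBn x hx hxT hgrid
    t ht
  set ρ := Real.log n / n with hρ
  have hn : n ≠ 0 := by omega
  have hn0 : (0 : ℝ) < n := by positivity
  have hn1 : (1 : ℝ) ≤ n := by exact_mod_cast (by omega : 1 ≤ n)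
  have hρn : 1 / n ≤ ρ := by
    rw [hρ]; gcongr; exact one_le_log_of_three_le hn3
  have hρ0 : 0 < ρ := lt_of_lt_of_le (by positivity) hρn
  have hsq : √ρ ^ 2 = ρ := Real.sq_sqrt hρ0.le
  have hTn : (√ρ)⁻¹ ≤ n := by
    rw [inv_le_comm₀ (Real.sqrt_pos.2 hρ0) hn0]
    refine Real.le_sqrt_of_sq_le (le_trans ?_ hρn)
    rw [← one_div, div_pow, one_pow]
    exact one_div_le_one_div_of_le hn0 (by nlinarith)
  obtain ⟨j, hj, htyp⟩ := hf.exists_isTypical hn hA1 hA htail hC hρn hx hxT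
    (by rw [inv_pow, hsq, mul_inv_cancel₀ hρ0.ne']) hTn hgrid hB0 hBB.le hfτ hBn h1
  obtain ⟨g, hg, hMLE⟩ := exists_isFit_densityMLE (j := j) (fun i => (hx i).1) rfl hj
  set η := Q * ρ ^ γ with hη
  set ε := 8 * K * η ^ β with hε
  have hη0 : 0 < η := by positivity
  have hε0 : 0 < ε := by positivity
  have hεeq : ε = 8 * K * Q ^ β * ρ ^ (β / (2 * β + 1)) := by
    rw [hε, hη, Real.mul_rpow (by linarith) (by positivity), ← Real.rpow_mul hρ0.le]
    have : γ * β = β / (2 * β + 1) := by rw [hγ]; ring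
    rw [this]; ring
  have hε1 : ε ≤ 1 := by rw [hεeq]; exact h3
  have hρη : 9 * ρ ≤ η := by
    have h5 : ρ ≤ ρ ^ γ := by
      calc ρ = ρ ^ (1 : ℝ) := (Real.rpow_one ρ).symm
        _ ≤ _ := Real.rpow_le_rpow_of_exponent_ge hρ0 h4 hγ1
    rw [hη]; gcongr
  obtain ⟨q, hq1, hq2⟩ := happrox t ht η hη0 (h2.trans (by linarith))
  have hε8 : K * η ^ β = ε / 8 := by rw [hε]; ring
  rw [hε8] at hq1 hq2
  have hlarge : C₀ * ρ < (ε / 8) ^ 2 * η := by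
    have e1 : η ^ β * η ^ β * η = η ^ (2 * β + 1) := by
      rw [← Real.rpow_add hη0, ← Real.rpow_add_one hη0.ne']; congr 1; ring
    have e2 : η ^ (2 * β + 1) = Q ^ (2 * β + 1) * ρ := by
      rw [hη, Real.mul_rpow (by linarith) (by positivity), ← Real.rpow_mul hρ0.le]
      have : γ * (2 * β + 1) = 1 := by rw [hγ]; field_simp
      rw [this, Real.rpow_one]
    have e3 : (ε / 8) ^ 2 * η = K ^ 2 * (Q ^ (2 * β + 1) * ρ) := by
      rw [← hε8, ← e2, ← e1]; ring
    have h5 : Q ≤ Q ^ (2 * β + 1) := by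
      calc Q = Q ^ (1 : ℝ) := (Real.rpow_one Q).symm
        _ ≤ _ := Real.rpow_le_rpow_of_exponent_le hQ1 (by linarith)
    have h6 : C₀ / K ^ 2 < Q := lt_of_lt_of_le (by linarith) (le_max_right _ _)
    rw [div_lt_iff₀ (by positivity)] at h6
    rw [e3]
    calc C₀ * ρ < Q * K ^ 2 * ρ := by gcongr
      _ = K ^ 2 * (Q * ρ) := by ring
      _ ≤ _ := by gcongr
  have ht0 : 0 ≤ t := ha.trans ht.1
  have hbound := htyp.abs_sub_lt hg hε0 hε1 ht0 hτ0 (by linarith) (by linarith [ht.2]) h2 hρη hq1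
    (hq2.imp_right fun h => by linarith) hlarge
  have htI : t ∈ Icc 0 (x j) := ⟨ht0, by linarith [ht.2, htyp.B_le]⟩
  have hft := htyp.pos t htI
  rw [hMLE t htI]
  have e : Real.exp (g t) - f t = f t * (Real.exp (g t - Real.log (f t)) - 1) := by
    rw [Real.exp_sub, Real.exp_log hft]; field_simp
  rw [e, abs_mul, abs_of_pos hft]
  calc f t * |Real.exp (g t - Real.log (f t)) - 1|
      ≤ A' * (2 * |g t - Real.log (f t)|) := by
        gcongr
        · exact (hA t ht0).trans hAA
        · exact Real.abs_exp_sub_one_le (hbound.le.trans hε1)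
    _ ≤ A' * (2 * ε) := by gcongr
    _ = M * ρ ^ (β / (2 * β + 1)) := by rw [hεeq, hM]; ring

/-! ### Probability of typical samples -/

section Probability
variable {Ω : Type*} [MeasurableSpace Ω] {P : Measure Ω} {X : ℕ → Ω → ℝ} {f : ℝ → ℝ}

lemma ae_forall_pos (hf : IsMonotoneLogConcaveDensity f) (hXm : ∀ i, AEMeasurable (X i) P)
    (hXl : ∀ i, P.map (X i) = densityLaw f) : ∀ᵐ ω ∂P, ∀ i, 0 < X i ω ∧ 0 < f (X i ω) := by
  refine ae_all_iff.2 fun i => ?_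
  have h := hf.ae_pos
  rw [← hXl i] at h
  exact ae_of_ae_map (hXm i) h

lemma measureReal_exists_lt_le (hf : IsMonotoneLogConcaveDensity f) {A : ℝ}
    (htail : ∀ t, 0 ≤ t → ∫ y in Ici t, f y ≤ A / (1 + t) ^ 4) (hA : 0 ≤ A)
    (hXm : ∀ i, AEMeasurable (X i) P) (hXl : ∀ i, P.map (X i) = densityLaw f) (n : ℕ) {T : ℝ}
    (hT : 0 < T) : P.real {ω | ∃ i : Fin n, T < X i ω} ≤ n * (A / T ^ 4) := by
  have h1 : ∀ i : Fin n, P.real {ω | T < X i ω} ≤ A / T ^ 4 := fun i => by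
    have h2 : P.real {ω | T < X i ω} = (densityLaw f).real (Ioi T) := by
      rw [measureReal_def, measureReal_def, ← hXl i,
        Measure.map_apply_of_aemeasurable (hXm i) measurableSet_Ioi]
      rfl
    have hprob := hf.isProbabilityMeasure
    rw [h2]
    calc (densityLaw f).real (Ioi T) ≤ (densityLaw f).real (Ici T) :=
          measureReal_mono Ioi_subset_Ici_self (measure_ne_top _ _)
      _ = ∫ y in Ici T, f y := hf.densityLaw_real measurableSet_Ici (Ici_subset_Ici.2 hT.le)
      _ ≤ A / (1 + T) ^ 4 := htail T hT.le
      _ ≤ A / T ^ 4 := by gcongr; linarith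
  have h3 : {ω | ∃ i : Fin n, T < X i ω} = ⋃ i : Fin n, {ω | T < X i ω} := by
    ext ω; simp
  rw [h3]
  calc _ ≤ ∑ i : Fin n, P.real {ω | T < X i ω} := measureReal_iUnion_fintype_le _
    _ ≤ ∑ _i : Fin n, A / T ^ 4 := Finset.sum_le_sum fun i _ => h1 i
    _ = _ := by simp

variable [IsProbabilityMeasure P]

/-- A union bound over the at most `9 * n ^ 4` pairs of grid points; the constant `6` gives a failure
probability of at most `2 / n ^ 5` for each of them. -/
lemma measureReal_not_gridDev_le (hf : IsMonotoneLogConcaveDensity f)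
    (hXm : ∀ i, AEMeasurable (X i) P) (hXi : iIndepFun X P)
    (hXl : ∀ i, P.map (X i) = densityLaw f) {n : ℕ} (hn : 3 ≤ n) :
    P.real {ω | ¬ GridDev f (fun i : Fin n => X i ω) 6 (Real.log n / n)} ≤ 18 / n := by
  have hprob := hf.isProbabilityMeasure
  have hn0 : (0 : ℝ) < n := by positivity
  have hn1 : (1 : ℝ) ≤ n := by exact_mod_cast (by omega : 1 ≤ n)
  have hlog : 0 < Real.log n := lt_of_lt_of_le one_pos (one_le_log_of_three_le hn)
  set N := Finset.range (n ^ 2 + 2) with hN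
  set bad : ℕ × ℕ → Set Ω := fun z => {ω | 6 * (√(Real.log n / n *
      (densityLaw f).real (Icc (z.1 / n : ℝ) (z.2 / n))) + Real.log n / n)
    < |empMean (fun i : Fin n => X i ω) ((Icc (z.1 / n : ℝ) (z.2 / n)).indicator 1)
        - (densityLaw f).real (Icc (z.1 / n : ℝ) (z.2 / n))|} with hbad
  have hsub : {ω | ¬ GridDev f (fun i : Fin n => X i ω) 6 (Real.log n / n)}
      ⊆ ⋃ z ∈ N ×ˢ N, bad z := by
    intro ω hω
    simp only [GridDev, mem_ofPred_eq, not_forall, not_le] at hω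
    obtain ⟨k, l, hk, hl, h⟩ := hω
    simp only [mem_iUnion]
    refine ⟨(k, l), ?_, h⟩
    simp only [hN, Finset.mem_product, Finset.mem_range]
    omega
  have hexp : Real.exp (-(6 - 1) * Real.log n) = ((n : ℝ) ^ 5)⁻¹ := by
    rw [← Real.exp_log (by positivity : 0 < (n : ℝ) ^ 5), Real.log_pow, ← Real.exp_neg]
    congr 1; push_cast; ring
  calc _ ≤ P.real (⋃ z ∈ N ×ˢ N, bad z) := measureReal_mono hsub (measure_ne_top _ _)
    _ ≤ ∑ z ∈ N ×ˢ N, P.real (bad z) := measureReal_biUnion_finset_le _ _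
    _ ≤ ∑ _z ∈ N ×ˢ N, 2 * ((n : ℝ) ^ 5)⁻¹ := Finset.sum_le_sum fun z _ => by
        rw [← hexp]
        exact measureReal_lt_abs_empMean_sub_le hXm hXi hXl measurableSet_Icc (by omega) hlog
          (by norm_num)
    _ = ((n : ℝ) ^ 2 + 2) ^ 2 * (2 * ((n : ℝ) ^ 5)⁻¹) := by
        rw [Finset.sum_const, Finset.card_product, hN, Finset.card_range, nsmul_eq_mul]
        push_cast; ring
    _ ≤ (3 * (n : ℝ) ^ 2) ^ 2 * (2 * ((n : ℝ) ^ 5)⁻¹) := by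
        have : (1 : ℝ) ≤ (n : ℝ) ^ 2 := one_le_pow₀ hn1
        gcongr
        linarith
    _ = 18 / n := by field_simp; norm_num

/-- The samples to which the deterministic theorem applies have probability tending to one. -/
lemma tendsto_measureReal_not_gridDev_or (hf : IsMonotoneLogConcaveDensity f)
    (hXm : ∀ i, AEMeasurable (X i) P) (hXi : iIndepFun X P)
    (hXl : ∀ i, P.map (X i) = densityLaw f) :
    Tendsto (fun n : ℕ => P.real ({ω | ¬ GridDev f (fun i : Fin n => X i ω) 6 (Real.log n / n)} ∪
      {ω | ∃ i : Fin n, (√(Real.log n / n))⁻¹ < X i ω})) atTop (𝓝 0) := by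
  obtain ⟨A, hA1, -, htail⟩ := hf.exists_tail_bound
  have hlim : Tendsto (fun n : ℕ => 18 / (n : ℝ) + A * (Real.log n ^ 2 / n)) atTop (𝓝 0) := by
    have := (tendsto_const_div_atTop_nhds_zero_nat 18).add
      ((tendsto_log_pow_div_atTop 2).const_mul A)
    simpa using this
  refine squeeze_zero' (Eventually.of_forall fun n => measureReal_nonneg) ?_ hlim
  filter_upwards [eventually_ge_atTop 3] with n hn
  have hn0 : (0 : ℝ) < n := by positivity
  have hlog : 0 < Real.log n := lt_of_lt_of_le one_pos (one_le_log_of_three_le hn)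
  have hρ : 0 < Real.log n / n := by positivity
  refine (measureReal_union_le _ _).trans (add_le_add
    (measureReal_not_gridDev_le hf hXm hXi hXl hn) ?_)
  refine (measureReal_exists_lt_le hf htail (by linarith) hXm hXl n
    (inv_pos.2 (Real.sqrt_pos.2 hρ))).trans (le_of_eq ?_)
  have e : (√(Real.log n / n))⁻¹ ^ 4 = ((Real.log n / n) ^ 2)⁻¹ := by
    rw [inv_pow, show √(Real.log n / n) ^ 4 = (√(Real.log n / n) ^ 2) ^ 2 by ring,
      Real.sq_sqrt hρ.le]
  rw [e]
  field_simp

end Probability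

theorem theorem3 {Ω : Type*} [MeasurableSpace Ω] (P : Measure Ω) [IsProbabilityMeasure P]
    (f : ℝ → ℝ) (hf : IsMonotoneLogConcaveDensity f)
    (X : ℕ → Ω → ℝ) (hXm : ∀ i, AEMeasurable (X i) P) (hXi : iIndepFun X P)
    (hXl : ∀ i, P.map (X i) = densityLaw f)
    (β L : ℝ) (hβ₁ : 1 ≤ β) (hβ₂ : β ≤ 2) (hL : 0 < L)
    (a b : ℝ) (ha : 0 ≤ a) (hab : a ≤ b) (hpos : ∀ t ∈ Icc a b, 0 < f t)
    (δ : ℝ) (hδ : 0 < δ)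
    (hHolder : HolderClass β L (Icc (a - δ) (b + δ) ∩ Ici 0) f)
    (hzero : 1 < β → a = 0 → derivWithin f (Ici 0) 0 = 0) :
    IsBigOInProb P
      (fun n ω => ⨆ t ∈ Icc a b,
        ENNReal.ofReal |densityMLE (fun i : Fin n => X i ω) t - f t|)
      (fun n => (Real.log n / n) ^ (β / (2 * β + 1))) := by

  obtain ⟨M, hM, hev⟩ := exists_abs_densityMLE_sub_le hf hβ₁ hβ₂ hL ha hab
    (hpos b (right_mem_Icc.2 hab)) hδ hHolder hzero (C := 6) (by norm_num)
  intro ε hε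
  refine ⟨M, hM, ?_⟩
  filter_upwards [hev, (tendsto_measureReal_not_gridDev_or hf hXm hXi hXl).eventually
    (eventually_le_nhds hε)] with n hn hbad
  have hnull : P {ω | ¬ ∀ i, 0 < X i ω ∧ 0 < f (X i ω)} = 0 := ae_forall_pos hf hXm hXl
  have hsub : {ω | ENNReal.ofReal (M * (Real.log n / n) ^ (β / (2 * β + 1)))
        < ⨆ t ∈ Icc a b, ENNReal.ofReal |densityMLE (fun i : Fin n => X i ω) t - f t|}
      ⊆ ({ω | ¬ GridDev f (fun i : Fin n => X i ω) 6 (Real.log n / n)} ∪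
        {ω | ∃ i : Fin n, (√(Real.log n / n))⁻¹ < X i ω}) ∪
        {ω | ¬ ∀ i, 0 < X i ω ∧ 0 < f (X i ω)} := by
    intro ω hω
    by_contra hcon
    simp only [mem_union, mem_ofPred_eq, not_or, not_not, not_exists, not_lt] at hcon hω
    refine absurd hω (not_lt.2 (iSup₂_le fun t ht => ENNReal.ofReal_le_ofReal ?_))
    exact hn _ (fun i => hcon.2 i) hcon.1.2 hcon.1.1 t ht
  refine (measure_mono hsub).trans ((measure_union_le _ _).trans ?_)
  rw [hnull, add_zero, ← ofReal_measureReal]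
  exact ENNReal.ofReal_le_ofReal hbad
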